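/- Let $\omega_0$ be the standard rotation invariant area form on $S^2$, normalized so that $\int_{S^2}\omega_0=2\pi$ (half of the area form of the unit sphere), and let $k\ge 1$ be an integer. Let $(V,\lambda)$ be a prequantization bundle over $(S^2,k\omega_0)$: $\pi\colon V\to S^2$ is a smooth principal $S^1$-bundle (with $S^1=\{e^{it}\}$ acting with period $2\pi$), and $\lambda$ is a real-valued connection 1-form on it with curvature $k\omega_0$, that is, $\lambda$ is an $S^1$-invariant smooth 1-form with $\lambda(R)=1$ for the generator $R$ of the action and $d\lambda=\pi^*(k\omega_0)$. Put $\xi=\ker\lambda$. Then: 1. $(V,\xi)$ is contactomorphic to the lens space $L(k,1)=S^3/\mathbb{Z}_k$, where $\mathbb{Z}_k$ acts on $S^3\subset\mathbb{C}^2$ by $(u,v)\mapsto(\zeta u,\zeta v)$, $\zeta^k=1$, with the contact structure $\xi_{std}$ induced by the standard contact form $\frac{i}{2}(u\,d\bar u-\bar u\,du+v\,d\bar v-\bar v\,dv)$ of $S^3$. More precisely, there is a diffeomorphism $V\to L(k,1)$ that pulls the induced contact form back to $f\lambda$ with a smooth function $f>0$. 2. The $S^1$-action $(t,x)\mapsto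 e^{it}x$ is the flow of the Reeb vector field of $\lambda$; and for every simple closed Reeb orbit $\gamma$ of $\lambda$ the $k$-fold cover $\gamma^k$ is contractible in $V$. 3. For every simple closed Reeb orbit $\gamma$ of $\lambda$, the Robbin-Salamon index is $\mu_{RS}^{\Phi}(\gamma^k)=4$. Here $\Phi$ is any symplectic trivialization of $(\xi,d\lambda)$ along $\gamma^k$ that extends to a trivialization of $u^*\xi$ over a disk $u\colon D^2\to V$ bounded by $\gamma^k$ (such disks and trivializations exist, and all of them give this value), and $\mu_{RS}^{\Phi}(\gamma^k)$ is the index of the path in $\mathrm{Sp}(2,\mathbb{R})$ that represents the linearized Reeb flow $d\varphi_t\colon\xi_{\gamma(0)}\to\xi_{\gamma(t)}$, $0\le t\le kT$ ($T$ the period of $\gamma$), in $\Phi$: the path is deformed, with fixed end points, to a continuously differentiable path $\Psi$ with regular crossings only, and the signatures of the crossing forms $v\mapsto\omega_{std}(v,\dot\Psi(t)v)$ on $\ker(\Psi(t)-1)$, where $\omega_{std}=dx\wedge dy$, are added up, with weight $\frac12$ at the two ends of the interval. -/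

import Mathlib

open scoped Manifold ContDiff
open Metric Set

namespace Prequantization

noncomputable section

/-! ## One-forms on manifolds and Reeb dynamics -/

/-- The model space of 3-manifolds. -/
abbrev E3 : Type := EuclideanSpace ℝ (Fin 3)

section Forms

variable {V : Type*} [TopologicalSpace V] [ChartedSpace E3 V]

/-- A (not necessarily smooth) differential one-form on the 3-manifold `V`. -/
abbrev OneForm (V : Type*) [TopologicalSpace V] [ChartedSpace E3 V] : Type _ :=
  (x : V) → TangentSpace (𝓡 3) x →L[ℝ] ℝ

/-- The expression of a one-form in the preferred chart at `x₀`: the pullback of the form under the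
inverse of the chart. -/
def OneForm.inChart (lam : OneForm V) (x₀ : V) (y : E3) : E3 →L[ℝ] ℝ :=
  (lam ((extChartAt (𝓡 3) x₀).symm y)).comp
    (mfderiv 𝓘(ℝ, E3) (𝓡 3) (extChartAt (𝓡 3) x₀).symm y)

/-- A one-form is smooth if its coordinate expressions are smooth. -/
def OneForm.IsSmooth (lam : OneForm V) : Prop :=
  ∀ x₀ : V, ContDiffOn ℝ ∞ (lam.inChart x₀) (extChartAt (𝓡 3) x₀).target

/-- The exterior derivative of a one-form, `dλ(v, w) = D_v λ(w) - D_w λ(v)`, computed at `x` in the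
preferred chart at `x` (by means of which Mathlib identifies `T_x V` with the model space). -/
def OneForm.d (lam : OneForm V) (x : V) (v w : TangentSpace (𝓡 3) x) : ℝ :=
  fderiv ℝ (lam.inChart x) (extChartAt (𝓡 3) x x) (v : E3) (w : E3) -
    fderiv ℝ (lam.inChart x) (extChartAt (𝓡 3) x x) (w : E3) (v : E3)

/-- `v` is the value at `x` of the Reeb vector field of `lam`: `λ(v) = 1` and `dλ(v, ·) = 0`. -/
def IsReebVector (lam : OneForm V) (x : V) (v : TangentSpace (𝓡 3) x) : Prop :=
  lam x v = 1 ∧ ∀ w : TangentSpace (𝓡 3) x, lam.d x v w = 0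

/-- `φ` is the flow of the Reeb vector field of `lam`. -/
structure IsReebFlow (lam : OneForm V) (φ : ℝ → V → V) : Prop where
  zero : ∀ x, φ 0 x = x
  mdifferentiableAt : ∀ x t, MDifferentiableAt 𝓘(ℝ, ℝ) (𝓡 3) (fun s : ℝ => φ s x) t
  reeb : ∀ x t, IsReebVector lam (φ t x) (mfderiv 𝓘(ℝ, ℝ) (𝓡 3) (fun s : ℝ => φ s x) t (1 : ℝ))

/-- `t ↦ φ t p`, `t ∈ [0, T]`, is a simple (once covered) closed orbit of `φ`, with minimal
period `T`. -/
structure IsSimpleClosedOrbit (φ : ℝ → V → V) (p : V) (T : ℝ) : Prop where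
  pos : 0 < T
  closed : φ T p = p
  simple : ∀ t ∈ Ioo 0 T, φ t p ≠ p

end Forms

/-! ## Prequantization bundles over the two-sphere -/

/-- The unit sphere `S²` in `ℝ³`. -/
abbrev S2 : Type := sphere (0 : EuclideanSpace ℝ (Fin 3)) 1

/-- A (not necessarily smooth) two-tensor on `S²`. -/
abbrev TwoFormS2 : Type := (p : S2) → TangentSpace (𝓡 2) p → TangentSpace (𝓡 2) p → ℝ

/-- The differential of the inclusion `S² ⊆ ℝ³`. -/
def inclS2 (p : S2) : TangentSpace (𝓡 2) p →L[ℝ] EuclideanSpace ℝ (Fin 3) :=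
  mfderiv (𝓡 2) 𝓘(ℝ, EuclideanSpace ℝ (Fin 3)) (Subtype.val : S2 → EuclideanSpace ℝ (Fin 3)) p

/-- The rotation invariant area form on `S²` of total area `2π`, that is, one half of the area form
`(v, w) ↦ det (p, v, w)` of the unit sphere. Its class divided by `2π` is a generator of
`H²(S²; ℤ)`. -/
def omega0 : TwoFormS2 := fun p v w =>
  (1 / 2 : ℝ) * Matrix.det
    (Matrix.of ![fun i => p.1 i, fun i => inclS2 p v i, fun i => inclS2 p w i])

section Bundle

variable {V : Type*} [TopologicalSpace V] [ChartedSpace E3 V] [MulAction Circle V]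

/-- The action of `S¹` on `V` and the map `proj : V → S²` form a smooth principal `S¹`-bundle:
the action is smooth, and over a neighbourhood `U` of every point of `S²` there is a fibre
preserving, equivariant diffeomorphism of `proj ⁻¹' U` with `U × S¹`. -/
structure IsPrincipalBundle (proj : V → S2) : Prop where
  smooth_smul : ContMDiff ((𝓡 1).prod (𝓡 3)) (𝓡 3) ∞ (fun q : Circle × V => q.1 • q.2)
  smooth_proj : ContMDiff (𝓡 3) (𝓡 2) ∞ proj
  locally_trivial : ∀ b : S2, ∃ (U : Set S2) (e : OpenPartialHomeomorph V (S2 × Circle)),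
    IsOpen U ∧ b ∈ U ∧ e.source = proj ⁻¹' U ∧ e.target = U ×ˢ univ ∧
    ContMDiffOn (𝓡 3) ((𝓡 2).prod (𝓡 1)) ∞ e e.source ∧
    ContMDiffOn ((𝓡 2).prod (𝓡 1)) (𝓡 3) ∞ e.symm e.target ∧
    (∀ x ∈ e.source, (e x).1 = proj x) ∧
    (∀ (z : Circle), ∀ x ∈ e.source, z • x ∈ e.source ∧ e (z • x) = ((e x).1, z * (e x).2))

/-- `proj : V → S²` is a principal `S¹`-bundle and `lam` is a real-valued connection one-form on it
with curvature `om`. The generator of the action is the velocity of `t ↦ e^{it} • x`, so that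
the fibres have period `2π`. -/
structure IsPrequantizationBundle (om : TwoFormS2) (proj : V → S2) (lam : OneForm V) : Prop
    extends IsPrincipalBundle proj where
  smooth_form : lam.IsSmooth
  invariant : ∀ (z : Circle) (x : V) (v : TangentSpace (𝓡 3) x),
    lam (z • x) (mfderiv (𝓡 3) (𝓡 3) (fun y : V => z • y) x v) = lam x v
  normalized : ∀ (x : V) (t : ℝ),
    lam (Circle.exp t • x)
      (mfderiv 𝓘(ℝ, ℝ) (𝓡 3) (fun s : ℝ => Circle.exp s • x) t (1 : ℝ)) = 1
  curvature : ∀ (x : V) (v w : TangentSpace (𝓡 3) x),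
    lam.d x v w =
      om (proj x) (mfderiv (𝓡 3) (𝓡 2) proj x v) (mfderiv (𝓡 3) (𝓡 2) proj x w)

end Bundle

/-! ## The lens spaces `L(k, 1)` with their standard contact structures -/

/-- The space `ℂ²`. -/
abbrev C2 : Type := EuclideanSpace ℂ (Fin 2)

/-- The unit sphere `S³` in `ℂ²`. -/
abbrev S3 : Type := sphere (0 : C2) 1

instance finrank_C2 : Fact (Module.finrank ℝ C2 = 3 + 1) :=
  ⟨by
    rw [← Module.finrank_mul_finrank ℝ ℂ C2, Complex.finrank_real_complex, finrank_euclideanSpace]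
    simp⟩

/-- The diagonal action `z • (u, v) = (z u, z v)` of `S¹` on `S³`. -/
instance circleActionS3 : MulAction Circle S3 where
  smul z x := ⟨(z : ℂ) • x.1, by
    simpa [norm_smul] using Circle.norm_coe z⟩
  one_smul x := Subtype.ext (one_smul ℂ x.1)
  mul_smul z w x := Subtype.ext (mul_smul (z : ℂ) (w : ℂ) x.1)

/-- The group of `k`-th roots of unity. -/
abbrev rootsOfUnityCircle (k : ℕ) : Subgroup Circle := (powMonoidHom k : Circle →* Circle).ker

instance continuousConstSMul_roots (k : ℕ) : ContinuousConstSMul (rootsOfUnityCircle k) S3 where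
  continuous_const_smul z :=
    Continuous.subtype_mk ((continuous_const_smul ((z : Circle) : ℂ)).comp continuous_subtype_val) _

instance isCancelSMul_roots (k : ℕ) : IsCancelSMul (rootsOfUnityCircle k) S3 where
  right_cancel' z w x h := by
    have hx : x.1 ≠ 0 := fun h0 => by
      have := x.2
      simp [h0] at this
    have h1 : ((z : Circle) : ℂ) • x.1 = ((w : Circle) : ℂ) • x.1 := congrArg Subtype.val h
    exact Subtype.ext (Circle.ext (smul_left_injective ℂ hx h1))

instance finite_roots (k : ℕ) [NeZero k] : Finite (rootsOfUnityCircle k) := by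
  have hfin : (Set.range fun z : rootsOfUnityCircle k => ((z : Circle) : ℂ)).Finite := by
    refine ((Polynomial.nthRootsFinset k (1 : ℂ)).finite_toSet).subset ?_
    rintro _ ⟨z, rfl⟩
    have hz : (z : Circle) ^ k = 1 := z.2
    simp only [Finset.mem_coe, Polynomial.mem_nthRootsFinset (NeZero.pos k)]
    exact_mod_cast congrArg (fun w : Circle => (w : ℂ)) hz
  have hinj : Function.Injective fun z : rootsOfUnityCircle k => ((z : Circle) : ℂ) :=
    fun z w h => Subtype.ext (Circle.ext h)
  exact (Set.finite_range_iff hinj).mp hfin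

/-- The lens space `L(k, 1)`: the quotient of `S³` by the `k`-th roots of unity, which act by
`(u, v) ↦ (ζ u, ζ v)`. Its atlas is Mathlib's one for quotients by free properly discontinuous
actions. -/
abbrev LensSpace (k : ℕ) : Type := MulAction.orbitRel.Quotient (rootsOfUnityCircle k) S3

/-- The quotient map `S³ → L(k, 1)`. -/
def lensMk (k : ℕ) : S3 → LensSpace k := Quotient.mk _

/-- The standard contact form `λ_std = (i/2) (u dū - ū du + v dv̄ - v̄ dv)` on `S³`, in other
words `λ_std(w) = ⟨i p, w⟩` for `w` tangent to `S³` at `p`. -/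
def stdForm : OneForm S3 := fun p =>
  (innerSL ℝ (Complex.I • p.1)).comp
    (mfderiv (𝓡 3) 𝓘(ℝ, C2) (Subtype.val : S3 → C2) p)

/-- The contact form induced on `L(k, 1)` by the (invariant) standard contact form of `S³`; its
kernel is the standard contact structure. The quotient map is a local diffeomorphism, and the value
at `y` does not depend on the point over `y` that is used. -/
def lensForm (k : ℕ) [NeZero k] : OneForm (LensSpace k) := fun y =>
  (stdForm (Quotient.out y)).comp
    (mfderiv (𝓡 3) (𝓡 3) (lensMk k) (Quotient.out y)).inverse

/-- `Φ` is a contactomorphism from `(V, ker lam)` to `(W, ker mu)`, preserving the co-orientations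
given by the two forms: `Φ^* mu = f · lam` for a smooth positive function `f`. -/
def IsContactomorphism {V W : Type*} [TopologicalSpace V] [ChartedSpace E3 V]
    [TopologicalSpace W] [ChartedSpace E3 W] (lam : OneForm V) (mu : OneForm W)
    (Φ : V ≃ₘ^∞⟮𝓡 3, 𝓡 3⟯ W) : Prop :=
  ∃ f : V → ℝ, ContMDiff (𝓡 3) 𝓘(ℝ, ℝ) ∞ f ∧ (∀ x, 0 < f x) ∧
    ∀ (x : V) (v : TangentSpace (𝓡 3) x), mu (Φ x) (mfderiv (𝓡 3) (𝓡 3) Φ x v) = f x * lam x v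

/-! ## The Robbin–Salamon index of paths in `Sp(2, ℝ)` -/

/-- Real `2 × 2` matrices. -/
abbrev Mat2 : Type := Matrix (Fin 2) (Fin 2) ℝ

/-- The standard symplectic form `ω₀ = dx ∧ dy` on `ℝ²`. -/
def stdSymp : LinearMap.BilinForm ℝ (Fin 2 → ℝ) := Matrix.toBilin' !![0, 1; -1, 0]

/-- `A` is a symplectic matrix. -/
def IsSymplectic (A : Mat2) : Prop :=
  ∀ v w : Fin 2 → ℝ, stdSymp (A.mulVec v) (A.mulVec w) = stdSymp v w

/-- `ker (Ψ(t) - 1)`; it is nonzero exactly if `t` is a crossing. -/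
def crossingSpace (Ψ : ℝ → Mat2) (t : ℝ) : Submodule ℝ (Fin 2 → ℝ) :=
  LinearMap.ker (Matrix.toLin' (Ψ t - 1))

/-- The derivative at `t` of a path of matrices defined on `[0, T]`. -/
def velocity (Ψ : ℝ → Mat2) (T t : ℝ) : Mat2 :=
  Matrix.of fun i j => derivWithin (fun s => Ψ s i j) (Icc 0 T) t

/-- The crossing form `v ↦ ω₀(v, Ψ'(t) v)` on `ker (Ψ(t) - 1)`. -/
def crossingForm (Ψ : ℝ → Mat2) (T t : ℝ) : QuadraticForm ℝ (crossingSpace Ψ t) :=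
  (LinearMap.BilinMap.toQuadraticMap
    (stdSymp.compl₂ (Matrix.toLin' (velocity Ψ T t)))).restrict (crossingSpace Ψ t)

/-- The signature of the crossing form; it is zero if `t` is not a crossing. -/
def crossingSign (Ψ : ℝ → Mat2) (T t : ℝ) : ℚ :=
  (sigPos (crossingForm Ψ T t) : ℚ) - (sigNeg (crossingForm Ψ T t) : ℚ)

/-- A continuously differentiable path `[0, T] → Sp(2, ℝ)` starting at `1`, all of whose crossings
are regular. -/
structure IsRegularPath (Ψ : ℝ → Mat2) (T : ℝ) : Prop where
  contDiffOn : ∀ i j, ContDiffOn ℝ 1 (fun t => Ψ t i j) (Icc 0 T)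
  symplectic : ∀ t ∈ Icc 0 T, IsSymplectic (Ψ t)
  start : Ψ 0 = 1
  regular : ∀ t ∈ Icc 0 T, (QuadraticMap.polarBilin (crossingForm Ψ T t)).SeparatingLeft

/-- The Robbin–Salamon index of a path with regular crossings: the sum of the signatures of the
crossing forms, where the crossings at the two ends count one half. (Regular crossings are isolated,
so the sum over the interior crossings is finite.) -/
def regularIndex (Ψ : ℝ → Mat2) (T : ℝ) : ℚ :=
  (1 / 2) * crossingSign Ψ T 0 + (∑ᶠ t ∈ Ioo 0 T, crossingSign Ψ T t) +
    (1 / 2) * crossingSign Ψ T T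

/-- `Ψ₀` and `Ψ₁` are homotopic with fixed end points as paths `[0, T] → Sp(2, ℝ)`. -/
def SymplecticHomotopic (Ψ₀ Ψ₁ : ℝ → Mat2) (T : ℝ) : Prop :=
  ∃ H : ℝ × ℝ → Mat2, ContinuousOn H (Icc 0 1 ×ˢ Icc 0 T) ∧
    (∀ s ∈ Icc (0 : ℝ) 1, ∀ t ∈ Icc 0 T, IsSymplectic (H (s, t))) ∧
    (∀ t ∈ Icc 0 T, H (0, t) = Ψ₀ t ∧ H (1, t) = Ψ₁ t) ∧
    (∀ s ∈ Icc (0 : ℝ) 1, H (s, 0) = Ψ₀ 0 ∧ H (s, T) = Ψ₀ T)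

/-- The continuous path `Ψ : [0, T] → Sp(2, ℝ)` starting at `1` has Robbin–Salamon index `m`: it is
homotopic with fixed end points to a path with regular crossings only, of index `m`. -/
def HasRobbinSalamonIndex (Ψ : ℝ → Mat2) (T : ℝ) (m : ℚ) : Prop :=
  ∃ Ψ' : ℝ → Mat2, IsRegularPath Ψ' T ∧ SymplecticHomotopic Ψ Ψ' T ∧ regularIndex Ψ' T = m

/-! ## Trivializations over capping disks -/

section Capping

variable {V : Type*} [TopologicalSpace V] [ChartedSpace E3 V]

/-- The point `e^{2π i t / S}` of the boundary of the unit disk. -/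
def bdry (S t : ℝ) : ℂ := Complex.exp (((2 * Real.pi * t / S : ℝ) : ℂ) * Complex.I)

/-- A capping disk of the closed orbit `t ↦ φ t p`, `t ∈ [0, S]`, and a symplectic trivialization
of the contact structure over it: `u` is a continuous map from the closed unit disk to `V` whose
boundary is the orbit, and `(e 0, e 1)` is a continuous symplectic frame of `u^* (ker lam, d lam)`
over the disk. -/
structure IsCappingFrame [IsManifold (𝓡 3) ∞ V] (lam : OneForm V) (φ : ℝ → V → V) (p : V) (S : ℝ)
    (u : ℂ → V) (e : Fin 2 → (z : ℂ) → TangentSpace (𝓡 3) (u z)) : Prop where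
  continuousOn_disk : ContinuousOn u (closedBall 0 1)
  boundary : ∀ t : ℝ, u (bdry S t) = φ t p
  continuousOn_frame : ∀ i, ContinuousOn
    (fun z => (⟨u z, e i z⟩ : TangentBundle (𝓡 3) V)) (closedBall 0 1)
  contact : ∀ i, ∀ z ∈ closedBall (0 : ℂ) 1, lam (u z) (e i z) = 0
  symplectic : ∀ z ∈ closedBall (0 : ℂ) 1, lam.d (u z) (e 0 z) (e 1 z) = 1

/-- The matrix of the linearized flow `dφ_t : ξ_p → ξ_{φ_t p}` in the symplectic frame `e` along
the orbit. The coordinates of `w ∈ ξ` in a symplectic frame `(e 0, e 1)` are `dλ(w, e 1)` and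
`dλ(e 0, w)`. The frame at `p` is the one at the boundary point `1` of the disk, where
`u 1 = p`. -/
def linearizedPath (lam : OneForm V) (φ : ℝ → V → V) (p : V) (S : ℝ) (u : ℂ → V)
    (e : Fin 2 → (z : ℂ) → TangentSpace (𝓡 3) (u z)) (t : ℝ) : Mat2 :=
  let w (j : Fin 2) : E3 := mfderiv (𝓡 3) (𝓡 3) (φ t) p (e j 1 : E3)
  Matrix.of ![fun j => lam.d (u (bdry S t)) (w j) (e 1 (bdry S t)),
    fun j => lam.d (u (bdry S t)) (e 0 (bdry S t)) (w j)]

end Capping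

end

end Prequantization

open Prequantization

/-! The whole theorem comes from one map. On `ℂ² ∖ 0` the form `conn`, that is `⟨ix, ·⟩ / |x|²`, has
exterior derivative equal to the pullback of `omega0` under the Hopf map (`fderiv_conn_eq_omega0`).
Pull the bundle `V` back by the Hopf map: its connection and `k • conn` have the same curvature, so
their difference is flat, and since `ℂ² ∖ 0` is simply connected there is a parallel section. This
is a map `P : ℂ² ∖ 0 → V` over the Hopf map with `P^* lam = k • conn` (`exists_lift_hopf`). Simple
connectedness enters by hand: lifts exist locally by the Poincaré lemma, are unique up to a constant
rotation, extend over star-shaped sets, and two slit domains with connected intersection cover `ℂ² ∖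
0`.

Since `conn` takes the value 1 on the velocity of a Hopf circle, `P (e^{it} x) = e^{ikt} • P x`.
Hence the fibres of `P` on `S³` are exactly the orbits of the `k`-th roots of unity, and `P` induces
a diffeomorphism with `L(k, 1)` under which the standard form becomes `lam / k`.

The curvature is nondegenerate, so a Reeb vector is vertical, and `lam = 1` fixes its length: the
Reeb flow is the circle action and every simple orbit has period `2π`. The `k`-fold cover of an
orbit is the image of one Hopf circle, which bounds a disk in `S³`.

For the index, `ξ` is identified with the pullback of `TS²`. The flow covers the identity of `S²`,
so its linearization is the identity there, and all turning comes from the frame. A capping disk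
lifts to `S³`, where `baseFrame`, the image of the frame `jx, ijx`, trivializes the pullback of
`TS²`; along a Hopf circle it makes two full turns (`baseFrame_smul`). If `G` is the matrix of the
given frame in `baseFrame`, the path is `G(b)⁻¹ · rot(4πt/S) · G(1)` with `b` on the boundary
circle. Contracting `b` to `1` inside the disk leaves a conjugate of a double rotation, whose
crossings at `0`, `S/2`, `S` have signature 2 each, so the index is `1 + 2 + 1 = 4`
(`hasRobbinSalamonIndex_four`). -/

namespace Prequantization

open Filter Topology

/-! ### Free and fibre-transitive circle actions from local triviality -/

section Bundle

variable {V : Type*} [TopologicalSpace V] [ChartedSpace E3 V]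

/-- The value of a one-form depends only on the base point and on the coordinates of the vector. -/
theorem OneForm.apply_congr (lam : OneForm V) {x y : V} (h : x = y) {v w : E3} (hvw : v = w) :
    lam x (v : TangentSpace (𝓡 3) x) = lam y (w : TangentSpace (𝓡 3) y) := by
  subst h hvw; rfl

theorem OneForm.apply_mfderiv_congr (lam : OneForm V) {E : Type*} [NormedAddCommGroup E]
    [NormedSpace ℝ E] {s s' : E → V} {x : E} (h : s =ᶠ[𝓝 x] s') (w : E) :
    lam (s x) (mfderiv 𝓘(ℝ, E) (𝓡 3) s x w) = lam (s' x) (mfderiv 𝓘(ℝ, E) (𝓡 3) s' x w) := by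
  exact lam.apply_congr h.eq_of_nhds (congrArg (fun L : E →L[ℝ] E3 => L w) h.mfderiv_eq)

variable [MulAction Circle V] {proj : V → S2}

namespace IsPrincipalBundle

variable (hB : IsPrincipalBundle proj)
include hB

theorem proj_smul (z : Circle) (x : V) : proj (z • x) = proj x := by
  obtain ⟨U, e, hU, hb, hs, ht, h1, h2, h3, h4⟩ := hB.locally_trivial (proj x)
  have hx : x ∈ e.source := by rw [hs]; exact hb
  obtain ⟨h5, h6⟩ := h4 z x hx
  rw [← h3 _ h5, h6, h3 _ hx]

theorem eq_one_of_smul_eq {z : Circle} {x : V} (h : z • x = x) : z = 1 := by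
  obtain ⟨U, e, hU, hb, hs, ht, h1, h2, h3, h4⟩ := hB.locally_trivial (proj x)
  have hx : x ∈ e.source := by rw [hs]; exact hb
  obtain ⟨h5, h6⟩ := h4 z x hx
  rw [h] at h6
  exact (mul_eq_right.mp (congrArg Prod.snd h6).symm)

theorem smul_right_cancel {z w : Circle} {x : V} (h : z • x = w • x) : z = w := by
  have : (w⁻¹ * z) • x = x := by rw [mul_smul, h, inv_smul_smul]
  exact (inv_mul_eq_one.mp (hB.eq_one_of_smul_eq this)).symm

theorem exists_smul_eq {x y : V} (h : proj x = proj y) : ∃ z : Circle, y = z • x := by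
  obtain ⟨U, e, hU, hb, hs, ht, h1, h2, h3, h4⟩ := hB.locally_trivial (proj x)
  have hx : x ∈ e.source := by rw [hs]; exact hb
  have hy : y ∈ e.source := by rw [hs, mem_preimage, ← h]; exact hb
  refine ⟨(e y).2 / (e x).2, ?_⟩
  obtain ⟨h5, h6⟩ := h4 ((e y).2 / (e x).2) x hx
  refine e.injOn hy h5 ?_
  rw [h6]
  exact Prod.ext (by rw [h3 _ hx, h3 _ hy, h]) (by simp)

theorem contMDiff_smul_left (z : Circle) : ContMDiff (𝓡 3) (𝓡 3) ∞ (fun x : V => z • x) :=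
  hB.smooth_smul.comp (contMDiff_const.prodMk contMDiff_id)

theorem contMDiff_smul_right (x : V) : ContMDiff (𝓡 1) (𝓡 3) ∞ (fun z : Circle => z • x) :=
  hB.smooth_smul.comp (contMDiff_id.prodMk contMDiff_const)

theorem contMDiff_exp_smul (x : V) :
    ContMDiff 𝓘(ℝ, ℝ) (𝓡 3) ∞ (fun t : ℝ => Circle.exp t • x) :=
  (hB.contMDiff_smul_right x).comp contMDiff_circleExp

end IsPrincipalBundle

end Bundle

/-! ### Lifts with prescribed connection form, and their uniqueness up to rotation -/

section Lift

variable {V : Type*} [TopologicalSpace V] [ChartedSpace E3 V]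
  {E : Type*} [NormedAddCommGroup E] [NormedSpace ℝ E]

/-- `s : E → V` is, at `x`, a differentiable lift of `h : E → S²` along `proj` such that
`s^* lam = α`. -/
structure IsLift (proj : V → S2) (lam : OneForm V) (h : E → S2) (α : E → E →L[ℝ] ℝ)
    (s : E → V) (x : E) : Prop where
  mdifferentiableAt : MDifferentiableAt 𝓘(ℝ, E) (𝓡 3) s x
  proj_eq : proj (s x) = h x
  form_eq : ∀ w : E, lam (s x) (mfderiv 𝓘(ℝ, E) (𝓡 3) s x w) = α x w

variable {proj : V → S2} {lam : OneForm V} {h : E → S2} {α : E → E →L[ℝ] ℝ} {s s' : E → V} {x : E}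

theorem IsLift.congr (hs : IsLift proj lam h α s x) (hss : s =ᶠ[𝓝 x] s') :
    IsLift proj lam h α s' x where
  mdifferentiableAt := hs.mdifferentiableAt.congr_of_eventuallyEq hss.symm
  proj_eq := by rw [← hss.eq_of_nhds]; exact hs.proj_eq
  form_eq w := by rw [← hs.form_eq w]; exact lam.apply_mfderiv_congr hss.symm w

variable [MulAction Circle V] {om : TwoFormS2}

/-- Rotating a lift by the angle `f` adds `df` to the pulled back form. -/
theorem IsLift.exp_smul (hV : IsPrequantizationBundle om proj lam)
    (hs : IsLift proj lam h α s x) {f : E → ℝ} {f' : E →L[ℝ] ℝ} (hf : HasFDerivAt f f' x) :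
    IsLift proj lam h (fun y => α y + f') (fun y => Circle.exp (f y) • s y) x := by
  have hB := hV.toIsPrincipalBundle
  have hfm : MDifferentiableAt 𝓘(ℝ, E) 𝓘(ℝ, ℝ) f x := hf.differentiableAt.mdifferentiableAt
  have hc : MDifferentiableAt 𝓘(ℝ, E) (𝓡 1) (fun y => Circle.exp (f y)) x :=
    (contMDiff_circleExp (m := ∞)).mdifferentiableAt (by simp) |>.comp x hfm
  have hpair := hc.prodMk hs.mdifferentiableAt
  have hsm : MDifferentiableAt ((𝓡 1).prod (𝓡 3)) (𝓡 3) (fun q : Circle × V => q.1 • q.2)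
    (Circle.exp (f x), s x) := hB.smooth_smul.mdifferentiableAt (by simp)
  refine ⟨hsm.comp x hpair, by rw [hB.proj_smul, hs.proj_eq], fun w => ?_⟩
  have e1 : mfderiv 𝓘(ℝ, E) (𝓡 3) (fun y => Circle.exp (f y) • s y) x w =
      mfderiv ((𝓡 1).prod (𝓡 3)) (𝓡 3) (fun q : Circle × V => q.1 • q.2) (Circle.exp (f x), s x)
        (mfderiv 𝓘(ℝ, E) (𝓡 1) (fun y => Circle.exp (f y)) x w, mfderiv 𝓘(ℝ, E) (𝓡 3) s x w) := by
    have := mfderiv_comp x hsm hpair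
    have h2 := congrArg (fun L => L w) this
    refine h2.trans ?_
    rw [mfderiv_prodMk hc hs.mdifferentiableAt]
    rfl
  have e2 := mfderiv_prod_eq_add_apply (v := ((mfderiv 𝓘(ℝ, E) (𝓡 1)
    (fun y => Circle.exp (f y)) x w, mfderiv 𝓘(ℝ, E) (𝓡 3) s x w) :
      TangentSpace ((𝓡 1).prod (𝓡 3)) (Circle.exp (f x), s x))) hsm
  -- The vertical part of the derivative is `f' w` times the generator: the same map is factored
  -- once through the circle and once through the angle in `ℝ`.
  have e3 : mfderiv (𝓡 1) (𝓡 3) (fun z : Circle => z • s x) (Circle.exp (f x))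
      (mfderiv 𝓘(ℝ, E) (𝓡 1) (fun y => Circle.exp (f y)) x w) =
      f' w • mfderiv 𝓘(ℝ, ℝ) (𝓡 3) (fun t : ℝ => Circle.exp t • s x) (f x) (1 : ℝ) := by
    have h1 : MDifferentiableAt (𝓡 1) (𝓡 3) (fun z : Circle => z • s x) (Circle.exp (f x)) :=
      (hB.contMDiff_smul_right (s x)).mdifferentiableAt (by simp)
    have h2 : MDifferentiableAt 𝓘(ℝ, ℝ) (𝓡 3) (fun t : ℝ => Circle.exp t • s x) (f x) :=
      (hB.contMDiff_exp_smul (s x)).mdifferentiableAt (by simp)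
    have h3 := congrArg (fun L => L w) (mfderiv_comp x h1 hc)
    have h4 := congrArg (fun L => L w) (mfderiv_comp x h2 hfm)
    refine h3.symm.trans (h4.trans ?_)
    have h5 : mfderiv 𝓘(ℝ, E) 𝓘(ℝ, ℝ) f x = f' := by rw [mfderiv_eq_fderiv]; exact hf.fderiv
    have h6 : mfderiv 𝓘(ℝ, E) 𝓘(ℝ, ℝ) f x w = f' w • (1 : ℝ) := by
      rw [h5, smul_eq_mul, mul_one]; rfl
    exact (congrArg (mfderiv 𝓘(ℝ, ℝ) (𝓡 3) (fun t : ℝ => Circle.exp t • s x) (f x)) h6).trans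
      (map_smul _ _ _)
  refine (congrArg (lam (Circle.exp (f x) • s x)) (e1.trans (e2.trans (congrArg₂ (· + ·) e3 rfl)))).trans ?_
  refine (map_add _ _ _).trans ?_
  have h7 := hV.invariant (Circle.exp (f x)) (s x) (mfderiv 𝓘(ℝ, E) (𝓡 3) s x w)
  have h8 := hV.normalized (s x) (f x)
  refine (congrArg₂ (· + ·) (map_smul _ _ _) h7).trans ?_
  rw [h8, hs.form_eq, add_comm]
  simp

theorem IsLift.const_smul (hV : IsPrequantizationBundle om proj lam)
    (hs : IsLift proj lam h α s x) (z : Circle) :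
    IsLift proj lam h α (fun y => z • s y) x := by
  have := hs.exp_smul hV (hasFDerivAt_const (Complex.arg z) x)
  simpa using this


theorem contMDiff_circle_coe : ContMDiff (𝓡 1) 𝓘(ℝ, ℂ) ∞ (fun z : Circle => (z : ℂ)) :=
  haveI : Fact (Module.finrank ℝ ℂ = 1 + 1) := finrank_real_complex_fact'
  contMDiff_coe_sphere (E := ℂ) (n := 1)

/-- Two lifts of the same data differ by a rotation with a differentiable angle. -/
theorem IsLift.exists_exp_smul_eq (hB : IsPrincipalBundle proj) {U : Set E} (hU : IsOpen U)
    (hx : x ∈ U) (hs : ∀ y ∈ U, IsLift proj lam h α s y) (hs' : ∀ y ∈ U, IsLift proj lam h α s' y)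
    (hxx : s' x = s x) : ∃ f : E → ℝ, f x = 0 ∧ ∀ᶠ y in 𝓝 x, DifferentiableAt ℝ f y ∧
      s' y = Circle.exp (f y) • s y := by
  obtain ⟨W, e, hW, hb, hsrc, ht, h1, h2, h3, h4⟩ := hB.locally_trivial (proj (s x))
  have hsx : s x ∈ e.source := by rw [hsrc]; exact hb
  have hmem : ∀ᶠ y in 𝓝 x, s y ∈ e.source :=
    (hs x hx).mdifferentiableAt.continuousAt.eventually_mem (e.open_source.mem_nhds hsx)
  have hmem' : ∀ᶠ y in 𝓝 x, s' y ∈ e.source :=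
    (hs' x hx).mdifferentiableAt.continuousAt.eventually_mem
      (e.open_source.mem_nhds (by rwa [hxx]))
  have hd : ∀ σ : E → V, ∀ y, MDifferentiableAt 𝓘(ℝ, E) (𝓡 3) σ y → σ y ∈ e.source →
      DifferentiableAt ℝ (fun y => ((e (σ y)).2 : ℂ)) y := by
    intro σ y hσ hy
    have a1 := (h1.contMDiffAt (e.open_source.mem_nhds hy)).mdifferentiableAt (by simp)
    have a2 : MDifferentiableAt ((𝓡 2).prod (𝓡 1)) (𝓡 1) (Prod.snd : S2 × Circle → Circle)
      (e (σ y)) := mdifferentiableAt_snd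
    have a3 := (contMDiff_circle_coe.mdifferentiableAt (by simp) :
      MDifferentiableAt (𝓡 1) 𝓘(ℝ, ℂ) (fun z : Circle => (z : ℂ)) (e (σ y)).2)
    exact (a3.comp y (a2.comp y (a1.comp y hσ))).differentiableAt
  -- The quotient of the two fibre coordinates equals 1 at `x`, so near `x` it stays in the slit
  -- plane, where its argument is differentiable.
  let g : E → Circle := fun y => (e (s' y)).2 / (e (s y)).2
  have hg : ∀ y, (g y : ℂ) = (e (s' y)).2 * (starRingEnd ℂ) ((e (s y)).2 : ℂ) := by
    intro y
    simp only [g, div_eq_mul_inv, Circle.coe_mul, Circle.coe_inv_eq_conj]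
  have hgx : g x = 1 := by simp [g, hxx]
  have hcont : ContinuousAt (fun y => (g y : ℂ)) x := by
    simp only [hg]
    exact (hd s' x (hs' x hx).mdifferentiableAt (by rwa [hxx])).continuousAt.mul
      (Complex.continuous_conj.continuousAt.comp
        (hd s x (hs x hx).mdifferentiableAt hsx).continuousAt)
  have hslit : ∀ᶠ y in 𝓝 x, (g y : ℂ) ∈ Complex.slitPlane :=
    hcont.eventually_mem (Complex.isOpen_slitPlane.mem_nhds (by simp [hgx]))
  refine ⟨fun y => Complex.arg (g y), by simp [hgx], ?_⟩
  filter_upwards [hmem, hmem', hslit, hU.mem_nhds hx] with y hy hy' hsl hyU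
  constructor
  · have d1 : DifferentiableAt ℝ (fun y => (g y : ℂ)) y := by
      simp only [hg]
      exact (hd s' y (hs' y hyU).mdifferentiableAt hy').mul
        (Complex.conjCLE.differentiableAt.comp y (hd s y (hs y hyU).mdifferentiableAt hy))
    have d0 : DifferentiableAt ℝ (fun z : ℂ => Complex.imCLM (Complex.log z)) (g y : ℂ) :=
      Complex.imCLM.differentiableAt.comp (g y : ℂ)
        ((Complex.differentiableAt_log hsl).restrictScalars ℝ)
    have d2 : DifferentiableAt ℝ (fun y => Complex.imCLM (Complex.log (g y))) y :=
      DifferentiableAt.comp (g := fun z : ℂ => Complex.imCLM (Complex.log z)) y d0 d1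
    simpa [Complex.log_im] using d2
  · rw [Circle.exp_arg]
    obtain ⟨h5, h6⟩ := h4 (g y) (s y) hy
    refine e.injOn hy' h5 ?_
    rw [h6]
    exact Prod.ext (by rw [h3 _ hy, h3 _ hy', (hs y hyU).proj_eq, (hs' y hyU).proj_eq])
      (by simp [g])

/-- Two lifts that agree at a point agree nearby. -/
theorem IsLift.eventuallyEq (hV : IsPrequantizationBundle om proj lam) {U : Set E} (hU : IsOpen U)
    (hx : x ∈ U) (hs : ∀ y ∈ U, IsLift proj lam h α s y) (hs' : ∀ y ∈ U, IsLift proj lam h α s' y)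
    (hxx : s' x = s x) : s' =ᶠ[𝓝 x] s := by
  obtain ⟨f, hfx, hf⟩ := IsLift.exists_exp_smul_eq hV.toIsPrincipalBundle hU hx hs hs' hxx
  obtain ⟨r, hr, hball⟩ := Metric.eventually_nhds_iff_ball.mp (hf.and (hU.mem_nhds hx))
  -- Rotating by `f` adds `df` to the pulled back form, yet both lifts pull `lam` back to `α`; hence
  -- `df = 0`.
  have hdf : ∀ y ∈ ball x r, HasFDerivAt f (0 : E →L[ℝ] ℝ) y := by
    intro y hy
    have hfy := (hball y hy).1.1.hasFDerivAt
    have h1 := (hs y (hball y hy).2).exp_smul hV hfy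
    have h2 : s' =ᶠ[𝓝 y] fun y => Circle.exp (f y) • s y := by
      filter_upwards [isOpen_ball.mem_nhds hy] with z hz using (hball z hz).1.2
    have h3 := (hs' y (hball y hy).2).congr h2
    have h4 : fderiv ℝ f y = 0 := by
      ext w
      have h5 := h1.form_eq w
      rw [h3.form_eq w] at h5
      simpa using h5
    rwa [h4] at hfy
  have hconst : ∀ y ∈ ball x r, f y = f x := fun y hy =>
    (convex_ball x r).is_const_of_fderivWithin_eq_zero (𝕜 := ℝ)
      (fun z hz => (hdf z hz).differentiableAt.differentiableWithinAt)
      (fun z hz => by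
        rw [fderivWithin_of_isOpen isOpen_ball hz]; exact (hdf z hz).fderiv)
      hy (mem_ball_self hr)
  filter_upwards [ball_mem_nhds x hr] with y hy
  rw [(hball y hy).1.2, hconst y hy, hfx]
  simp

/-- Two lifts over a connected open set differ by a constant rotation. -/
theorem IsLift.exists_smul_eq (hV : IsPrequantizationBundle om proj lam) {U : Set E}
    (hU : IsOpen U) (hUc : IsPreconnected U)
    (hs : ∀ y ∈ U, IsLift proj lam h α s y) (hs' : ∀ y ∈ U, IsLift proj lam h α s' y) :
    ∃ z : Circle, ∀ y ∈ U, s' y = z • s y := by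
  have hB := hV.toIsPrincipalBundle
  rcases U.eq_empty_or_nonempty with rfl | ⟨a, ha⟩
  · exact ⟨1, by simp⟩
  have hfib : ∀ y ∈ U, ∃ z : Circle, s' y = z • s y := fun y hy =>
    hB.exists_smul_eq (by rw [(hs y hy).proj_eq, (hs' y hy).proj_eq])
  -- The rotation between the two lifts is locally constant; freeness of the action makes "same
  -- rotation at two points" transitive, so connectedness applies.
  have key : ∀ x ∈ U, ∀ y ∈ U, ∃ z : Circle, s' x = z • s x ∧ s' y = z • s y := by
    intro x hx y hy
    refine hUc.induction₂' (fun x y => ∃ z : Circle, s' x = z • s x ∧ s' y = z • s y) ?_ ?_ hx hy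
    · intro x hx
      obtain ⟨z, hz⟩ := hfib x hx
      have := IsLift.eventuallyEq hV hU hx (fun y hy => (hs y hy).const_smul hV z) hs' hz
      filter_upwards [nhdsWithin_le_nhds this] with y hy
      exact ⟨⟨z, hz, hy⟩, ⟨z, hy, hz⟩⟩
    · rintro x y w hx hy hw ⟨z, h1, h2⟩ ⟨z', h3, h4⟩
      have : z = z' := hB.smul_right_cancel (h2.symm.trans h3)
      subst this
      exact ⟨z, h1, h4⟩
  obtain ⟨z, hz⟩ := hfib a ha
  refine ⟨z, fun y hy => ?_⟩
  obtain ⟨z', h1, h2⟩ := key a ha y hy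
  rwa [hB.smul_right_cancel (hz.symm.trans h1)]

end Lift
end Prequantization

namespace Prequantization
open Filter Topology

/-! ### Monodromy-free gluing of local solutions over segments and star-shaped sets -/

section Gluing

variable {E V G : Type*} [Group G] [MulAction G V]

/-- Local solutions that are unique up to the free action of a group can be glued along a
nonempty connected overlap. -/
theorem exists_glue [TopologicalSpace E] {Q : (E → V) → E → Prop}
    (hcongr : ∀ s s' x, s =ᶠ[𝓝 x] s' → Q s x → Q s' x)
    (hsmul : ∀ (g : G) s x, Q s x → Q (fun y => g • s y) x)
    {U₁ U₂ : Set E} (hU₁ : IsOpen U₁) (hU₂ : IsOpen U₂) {s₁ s₂ : E → V}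
    (h₁ : ∀ x ∈ U₁, Q s₁ x) (h₂ : ∀ x ∈ U₂, Q s₂ x)
    (huniq : ∃ g : G, ∀ x ∈ U₁ ∩ U₂, s₁ x = g • s₂ x) :
    ∃ s : E → V, (∀ x ∈ U₁, s x = s₁ x) ∧ ∀ x ∈ U₁ ∪ U₂, Q s x := by
  classical
  obtain ⟨g, hg⟩ := huniq
  refine ⟨fun x => if x ∈ U₁ then s₁ x else g • s₂ x, fun x hx => if_pos hx, ?_⟩
  rintro x (hx | hx)
  · refine hcongr s₁ _ x ?_ (h₁ x hx)
    filter_upwards [hU₁.mem_nhds hx] with y hy using (if_pos hy).symm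
  · refine hcongr (fun y => g • s₂ y) _ x ?_ (hsmul g _ _ (h₂ x hx))
    filter_upwards [hU₂.mem_nhds hx] with y hy
    by_cases hy1 : y ∈ U₁
    · simp only [if_pos hy1, hg y ⟨hy1, hy⟩]
    · simp only [if_neg hy1]

variable [NormedAddCommGroup E] [NormedSpace ℝ E]

/-- Local solutions that are unique up to the free action of a group can be glued over a
neighbourhood of a segment. -/
theorem exists_convex_nhds_segment {Q : (E → V) → E → Prop}
    (hcongr : ∀ s s' x, s =ᶠ[𝓝 x] s' → Q s x → Q s' x)
    (hsmul : ∀ (g : G) s x, Q s x → Q (fun y => g • s y) x)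
    {Ω : Set E} {a b : E} (hseg : segment ℝ a b ⊆ Ω)
    (hex : ∀ x ∈ Ω, ∃ s, ∀ᶠ y in 𝓝 x, Q s y)
    (huniq : ∀ U, IsOpen U → IsPreconnected U → ∀ s s', (∀ x ∈ U, Q s x) →
      (∀ x ∈ U, Q s' x) → ∃ g : G, ∀ x ∈ U, s' x = g • s x) :
    ∃ (N : Set E) (s : E → V), IsOpen N ∧ Convex ℝ N ∧ a ∈ N ∧ b ∈ N ∧ ∀ x ∈ N, Q s x := by
  let c : ℝ → E := fun t => a + t • (b - a)
  have hc : Continuous c := by fun_prop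
  have hcseg : ∀ t, c '' Icc 0 t = segment ℝ a (c t) ∨ t < 0 := by
    intro t
    by_cases ht : t < 0
    · exact Or.inr ht
    left
    push Not at ht
    rw [segment_eq_image']
    ext y
    constructor
    · rintro ⟨r, hr, rfl⟩
      rcases ht.eq_or_lt with rfl | ht
      · have : r = 0 := le_antisymm hr.2 hr.1
        exact ⟨0, by simp, by simp [c, this]⟩
      refine ⟨r / t, ⟨div_nonneg hr.1 ht.le, div_le_one_of_le₀ hr.2 ht.le⟩, ?_⟩
      simp only [c, add_sub_cancel_left, smul_smul, div_mul_cancel₀ _ ht.ne']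
    · rintro ⟨r, hr, rfl⟩
      refine ⟨r * t, ⟨mul_nonneg hr.1 ht, mul_le_of_le_one_left ht hr.2⟩, ?_⟩
      simp only [c, add_sub_cancel_left, smul_smul]
  have hcΩ : ∀ t ∈ Icc (0 : ℝ) 1, c t ∈ Ω := fun t ht => hseg (by
    rw [segment_eq_image']; exact ⟨t, ht, rfl⟩)
  -- The neighbourhoods are required to be convex so that their intersection with a ball is convex,
  -- hence connected, and the uniqueness hypothesis applies to it.
  let T : Set ℝ := {t | ∃ (N : Set E) (s : E → V), IsOpen N ∧ Convex ℝ N ∧ a ∈ N ∧ c t ∈ N ∧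
    ∀ x ∈ N, Q s x}
  have hball : ∀ x ∈ Ω, ∃ s : E → V, ∃ r > 0, ∀ y ∈ ball x r, Q s y := by
    intro x hx
    obtain ⟨s, hs⟩ := hex x hx
    obtain ⟨r, hr, h⟩ := Metric.eventually_nhds_iff_ball.mp hs
    exact ⟨s, r, hr, h⟩
  -- Here `δ` depends on `t` alone and not on `t₁`, so the same statement yields that `T` is open
  -- and that it is closed.
  have step : ∀ t ∈ Icc (0 : ℝ) 1, ∃ δ > 0, ∀ t₁ ∈ T, ∀ t₂, 0 ≤ t₁ → 0 ≤ t₂ → |t₁ - t| < δ →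
      |t₂ - t| < δ → t₂ ∈ T := by
    intro t ht
    obtain ⟨s₂, r, hr, hs₂⟩ := hball (c t) (hcΩ t ht)
    have hev : ∀ᶠ u in 𝓝 t, c u ∈ ball (c t) r := hc.continuousAt.eventually_mem
      (ball_mem_nhds _ hr)
    obtain ⟨δ, hδ, hδ'⟩ := Metric.eventually_nhds_iff_ball.mp hev
    refine ⟨δ, hδ, ?_⟩
    rintro t₁ ⟨N, s₁, hN, hNc, haN, hcN, hs₁⟩ t₂ h1 h2 hd1 hd2
    have hb1 : c t₁ ∈ ball (c t) r := hδ' t₁ (by simpa [Real.dist_eq] using hd1)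
    have hb2 : c t₂ ∈ ball (c t) r := hδ' t₂ (by simpa [Real.dist_eq] using hd2)
    obtain ⟨s, hss, hs⟩ := exists_glue hcongr hsmul hN isOpen_ball hs₁ hs₂
      (huniq _ (hN.inter isOpen_ball) (hNc.inter (convex_ball _ _)).isPreconnected s₂ s₁
        (fun x hx => hs₂ x hx.2) (fun x hx => hs₁ x hx.1))
    have hsub : c '' Icc 0 t₂ ⊆ N ∪ ball (c t) r := by
      rintro _ ⟨u, hu, rfl⟩
      by_cases hut : u ≤ t₁
      · left
        have : c u ∈ segment ℝ a (c t₁) := by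
          rcases hcseg t₁ with h | h
          · rw [← h]; exact ⟨u, ⟨hu.1, hut⟩, rfl⟩
          · linarith
        exact hNc.segment_subset haN hcN this
      · right
        push Not at hut
        refine hδ' u ?_
        rw [mem_ball, Real.dist_eq]
        rw [abs_lt] at *
        constructor <;> linarith [hu.2]
    have hseg2 : segment ℝ a (c t₂) ⊆ N ∪ ball (c t) r := by
      rcases hcseg t₂ with h | h
      · rwa [← h]
      · linarith
    have hcomp : IsCompact (segment ℝ a (c t₂)) := by
      rcases hcseg t₂ with h | h
      · rw [← h]; exact isCompact_Icc.image hc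
      · linarith
    obtain ⟨ε, hε, hεs⟩ := hcomp.exists_thickening_subset_open (hN.union isOpen_ball) hseg2
    -- The union of `N` and the ball need not be convex; a thickening of the compact segment inside
    -- it is.
    refine ⟨thickening ε (segment ℝ a (c t₂)), s, isOpen_thickening,
      (convex_segment _ _).thickening ε, self_subset_thickening hε _ (left_mem_segment ℝ _ _),
      self_subset_thickening hε _ (right_mem_segment ℝ _ _), fun x hx => hs x (hεs hx)⟩
  have h0 : (0 : ℝ) ∈ T := by
    obtain ⟨s, r, hr, hs⟩ := hball a (hseg (left_mem_segment ℝ a b))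
    exact ⟨ball a r, s, isOpen_ball, convex_ball _ _, mem_ball_self hr,
      by simp [c, hr], hs⟩
  have h1 : (1 : ℝ) ∈ T := by
    have key := (isPreconnected_Icc (a := (0 : ℝ)) (b := 1)).induction₂'
      (fun x y => x ∈ T → y ∈ T) ?_ (fun x y z _ _ _ h1 h2 h => h2 (h1 h))
      (x := 0) (y := 1) (by simp) (by simp)
    · exact key h0
    intro t ht
    obtain ⟨δ, hδ, h⟩ := step t ht
    filter_upwards [nhdsWithin_le_nhds (ball_mem_nhds t hδ), self_mem_nhdsWithin] with y hy hy1
    rw [mem_ball, Real.dist_eq] at hy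
    exact ⟨fun h1 => h t h1 y ht.1 hy1.1 (by simpa using hδ) hy,
      fun h1 => h y h1 t hy1.1 ht.1 hy (by simpa using hδ)⟩
  obtain ⟨N, s, h⟩ := h1
  exact ⟨N, s, by simpa [c] using h⟩

/-- Local solutions that are unique up to the free action of a group can be glued over a
star-shaped open set. -/
theorem exists_solution_of_starConvex {Q : (E → V) → E → Prop}
    (hcongr : ∀ s s' x, s =ᶠ[𝓝 x] s' → Q s x → Q s' x)
    (hsmul : ∀ (g : G) s x, Q s x → Q (fun y => g • s y) x)
    (hfree : ∀ (g : G) (v : V), g • v = v → g = 1)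
    {Ω : Set E} (hΩ : IsOpen Ω) {a : E} (ha : a ∈ Ω) (hstar : StarConvex ℝ a Ω)
    (hex : ∀ x ∈ Ω, ∃ s, ∀ᶠ y in 𝓝 x, Q s y)
    (huniq : ∀ U, IsOpen U → IsPreconnected U → ∀ s s', (∀ x ∈ U, Q s x) →
      (∀ x ∈ U, Q s' x) → ∃ g : G, ∀ x ∈ U, s' x = g • s x) :
    ∃ s, ∀ x ∈ Ω, Q s x := by
  classical
  have hN : ∀ b : Ω, ∃ (N : Set E) (s : E → V), IsOpen N ∧ Convex ℝ N ∧ a ∈ N ∧ b.1 ∈ N ∧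
      ∀ x ∈ N, Q s x := fun b =>
    exists_convex_nhds_segment hcongr hsmul (hstar.segment_subset b.2) hex huniq
  choose N σ hNo hNc haN hbN hσ using hN
  -- Each solution along a segment from `a` is normalized against one reference solution near `a`.
  have hg : ∀ b : Ω, ∃ g : G, ∀ x ∈ N b ∩ N ⟨a, ha⟩, σ ⟨a, ha⟩ x = g • σ b x := fun b =>
    huniq _ ((hNo b).inter (hNo _)) ((hNc b).inter (hNc _)).isPreconnected _ _
      (fun x hx => hσ b x hx.1) (fun x hx => hσ _ x hx.2)
  choose g hg using hg
  -- On the convex overlap two normalized solutions differ by a single group element, and they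
  -- coincide at `a`; freeness makes that element trivial.
  have hagree : ∀ b c : Ω, ∀ x ∈ N b ∩ N c, g b • σ b x = g c • σ c x := by
    intro b c
    obtain ⟨z, hz⟩ := huniq _ ((hNo b).inter (hNo c)) ((hNc b).inter (hNc c)).isPreconnected _ _
      (fun x hx => hsmul (g b) _ _ (hσ b x hx.1)) (fun x hx => hsmul (g c) _ _ (hσ c x hx.2))
    have h1 := hz a ⟨haN b, haN c⟩
    rw [← hg b a ⟨haN b, haN _⟩, ← hg c a ⟨haN c, haN _⟩] at h1
    have h2 := hfree z _ h1.symm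
    subst h2
    intro x hx
    rw [hz x hx, one_smul]
  refine ⟨fun x => if hx : x ∈ Ω then g ⟨x, hx⟩ • σ ⟨x, hx⟩ x else σ ⟨a, ha⟩ x, fun x hx => ?_⟩
  refine hcongr (fun y => g ⟨x, hx⟩ • σ ⟨x, hx⟩ y) _ x ?_
    (hsmul (g ⟨x, hx⟩) _ _ (hσ ⟨x, hx⟩ x (hbN ⟨x, hx⟩)))
  filter_upwards [(hNo ⟨x, hx⟩).mem_nhds (hbN ⟨x, hx⟩), hΩ.mem_nhds hx] with y hy hyΩ
  simp only [dif_pos hyΩ]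
  exact hagree ⟨x, hx⟩ ⟨y, hyΩ⟩ y ⟨hy, hbN ⟨y, hyΩ⟩⟩

end Gluing
end Prequantization

namespace Prequantization
open Filter Topology

/-! ### Pullback of one-forms and naturality of the exterior derivative -/

section Pullback

variable {V : Type*} [TopologicalSpace V] [ChartedSpace E3 V]
  {E : Type*} [NormedAddCommGroup E] [NormedSpace ℝ E]

/-- The pullback of a one-form under a map from a vector space. -/
noncomputable def OneForm.pullback (lam : OneForm V) (s : E → V) (y : E) : E →L[ℝ] ℝ :=
  (lam (s y)).comp (mfderiv 𝓘(ℝ, E) (𝓡 3) s y)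

theorem OneForm.pullback_apply (lam : OneForm V) (s : E → V) (y w : E) :
    lam.pullback s y w = lam (s y) (mfderiv 𝓘(ℝ, E) (𝓡 3) s y w) := rfl

variable [IsManifold (𝓡 3) ∞ V]

/-- The pullback is written in the single chart at `s x`, the one that `OneForm.d` uses at `s x`, so
that its smoothness and its derivative at `x` become calculus in vector spaces. -/
theorem OneForm.pullback_eventuallyEq (lam : OneForm V) {s : E → V} {x : E}
    (hs : ContMDiffAt 𝓘(ℝ, E) (𝓡 3) ∞ s x) :
    lam.pullback s =ᶠ[𝓝 x] fun y => (lam.inChart (s x) (extChartAt (𝓡 3) (s x) (s y))).comp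
      (fderiv ℝ (fun y => extChartAt (𝓡 3) (s x) (s y)) y) := by
  have h1 : ∀ᶠ y in 𝓝 x, s y ∈ (extChartAt (𝓡 3) (s x)).source :=
    hs.continuousAt.eventually_mem (extChartAt_source_mem_nhds (s x))
  have hs1 : ContMDiffAt 𝓘(ℝ, E) (𝓡 3) 1 s x := hs.of_le (by exact_mod_cast le_top)
  have : IsManifold (𝓡 3) 1 V := IsManifold.of_le (n := ∞) (by exact_mod_cast le_top)
  have h2 : ∀ᶠ y in 𝓝 x, ContMDiffAt 𝓘(ℝ, E) (𝓡 3) 1 s y :=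
    (contMDiffAt_iff_contMDiffAt_nhds (by simp)).mp hs1
  filter_upwards [h1.eventually_nhds, h2] with y hy hsy
  have hyy := hy.self_of_nhds
  set φ := extChartAt (𝓡 3) (s x) with hφ
  have hsy' : MDifferentiableAt 𝓘(ℝ, E) (𝓡 3) s y := hsy.mdifferentiableAt (by simp)
  have hφm : MDifferentiableAt (𝓡 3) 𝓘(ℝ, E3) φ (s y) :=
    mdifferentiableAt_extChartAt (by rwa [hφ, extChartAt_source] at hyy)
  have hσ : MDifferentiableAt 𝓘(ℝ, E) 𝓘(ℝ, E3) (fun y => φ (s y)) y := hφm.comp y hsy'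
  have hsymm : MDifferentiableAt 𝓘(ℝ, E3) (𝓡 3) φ.symm (φ (s y)) :=
    ((contMDiffOn_extChartAt_symm (n := ∞) (s x)).contMDiffAt
      (extChartAt_target_mem_nhds' (φ.map_source hyy))).mdifferentiableAt (by simp)
  have heq : s =ᶠ[𝓝 y] fun z => φ.symm (φ (s z)) := by
    filter_upwards [hy] with z hz using (φ.left_inv hz).symm
  ext w
  rw [OneForm.pullback_apply, lam.apply_mfderiv_congr heq w]
  refine congrArg (lam (φ.symm (φ (s y)))) ?_
  have h3 := congrArg (fun L => L w) (mfderiv_comp y hsymm hσ)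
  refine h3.trans ?_
  have h4 : mfderiv 𝓘(ℝ, E) 𝓘(ℝ, E3) (fun y => φ (s y)) y = fderiv ℝ (fun y => φ (s y)) y :=
    mfderiv_eq_fderiv
  exact congrArg (mfderiv 𝓘(ℝ, E3) (𝓡 3) φ.symm (φ (s y)))
    (congrArg (fun L : E →L[ℝ] E3 => L w) h4)

omit [IsManifold (𝓡 3) ∞ V] in
theorem contDiffAt_extChartAt_comp {s : E → V} {x : E} (hs : ContMDiffAt 𝓘(ℝ, E) (𝓡 3) ∞ s x) :
    ContDiffAt ℝ ∞ (fun y => extChartAt (𝓡 3) (s x) (s y)) x := by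
  rw [← contMDiffAt_iff_contDiffAt]
  exact (contMDiffAt_extChartAt (I := 𝓡 3) (x := s x)).comp x hs

-- No transition map appears because the tangent space at `s x` is identified with the model space
-- by the preferred chart at that very point.
omit [IsManifold (𝓡 3) ∞ V] in
theorem fderiv_extChartAt_comp {s : E → V} {x : E} (hs : ContMDiffAt 𝓘(ℝ, E) (𝓡 3) ∞ s x)
    (w : E) : (fderiv ℝ (fun y => extChartAt (𝓡 3) (s x) (s y)) x w : E3) =
      mfderiv 𝓘(ℝ, E) (𝓡 3) s x w := by
  have := (hs.mdifferentiableAt (by simp)).mfderiv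
  refine (congrArg (fun L : E →L[ℝ] E3 => L w) ?_ : _)
  refine Eq.trans ?_ this.symm
  simp only [writtenInExtChartAt, extChartAt_model_space_eq_id, modelWithCornersSelf_coe,
    range_id, fderivWithin_univ, PartialEquiv.refl_symm, PartialEquiv.refl_coe]
  rfl

theorem OneForm.contDiffAt_pullback {lam : OneForm V} (hlam : lam.IsSmooth) {s : E → V} {x : E}
    (hs : ContMDiffAt 𝓘(ℝ, E) (𝓡 3) ∞ s x) : ContDiffAt ℝ ∞ (lam.pullback s) x := by
  refine ContDiffAt.congr_of_eventuallyEq ?_ (lam.pullback_eventuallyEq hs)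
  have h1 := contDiffAt_extChartAt_comp hs
  have h2 : ContDiffAt ℝ ∞ (lam.inChart (s x)) (extChartAt (𝓡 3) (s x) (s x)) :=
    (hlam (s x)).contDiffAt (extChartAt_target_mem_nhds (s x))
  exact (ContDiffAt.comp x h2 h1).clm_comp (h1.fderiv_right (m := ∞) (by simp))

/-- Naturality of the exterior derivative. -/
theorem OneForm.fderiv_pullback {lam : OneForm V} (hlam : lam.IsSmooth) {s : E → V} {x : E}
    (hs : ContMDiffAt 𝓘(ℝ, E) (𝓡 3) ∞ s x) (v w : E) :
    fderiv ℝ (lam.pullback s) x v w - fderiv ℝ (lam.pullback s) x w v =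
      lam.d (s x) (mfderiv 𝓘(ℝ, E) (𝓡 3) s x v) (mfderiv 𝓘(ℝ, E) (𝓡 3) s x w) := by
  have h1 := contDiffAt_extChartAt_comp hs
  have h2 : ContDiffAt ℝ ∞ (lam.inChart (s x)) (extChartAt (𝓡 3) (s x) (s x)) :=
    (hlam (s x)).contDiffAt (extChartAt_target_mem_nhds (s x))
  have h3 := HasFDerivAt.comp (g := lam.inChart (s x)) x (h2.differentiableAt (by simp)).hasFDerivAt
      (h1.differentiableAt (by simp)).hasFDerivAt
  have h4 : HasFDerivAt (fderiv ℝ fun y => extChartAt (𝓡 3) (s x) (s y)) _ x :=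
    ((h1.fderiv_right (m := ∞) (by simp)).differentiableAt (by simp)).hasFDerivAt
  -- The second derivative of `s` in the chart is symmetric, so its contribution cancels on
  -- antisymmetrizing.
  have hsymm := (h1.isSymmSndFDerivAt (by
    simpa using (mod_cast le_top : ((2 : ℕ∞) : WithTop ℕ∞) ≤ ∞))).eq v w
  rw [(lam.pullback_eventuallyEq hs).fderiv_eq]
  have h5 := (h3.clm_comp h4).fderiv
  simp only [Function.comp_apply] at h5
  rw [h5]
  unfold OneForm.d
  rw [← fderiv_extChartAt_comp hs v, ← fderiv_extChartAt_comp hs w]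
  simp only [add_apply, ContinuousLinearMap.comp_apply,
    ContinuousLinearMap.compL_apply, ContinuousLinearMap.flip_apply, hsymm]
  ring

end Pullback
end Prequantization

namespace Prequantization
open Filter Topology

/-! ### Existence of lifts when the curvatures agree -/

section LocalExistence

/-- The value of a two-tensor depends only on the base point and on the coordinates of the
vectors. -/
theorem TwoFormS2.apply_congr (om : TwoFormS2) {x y : S2} (h : x = y)
    {v w v' w' : EuclideanSpace ℝ (Fin 2)} (hv : v = v') (hw : w = w') :
    om x (v : TangentSpace (𝓡 2) x) (w : TangentSpace (𝓡 2) x) =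
      om y (v' : TangentSpace (𝓡 2) y) (w' : TangentSpace (𝓡 2) y) := by
  subst h hv hw; rfl

variable {V : Type*} [TopologicalSpace V] [ChartedSpace E3 V] [IsManifold (𝓡 3) ∞ V]
  [MulAction Circle V] {proj : V → S2} {lam : OneForm V} {om : TwoFormS2}
  {E : Type*} [NormedAddCommGroup E] [NormedSpace ℝ E] {h : E → S2} {α : E → E →L[ℝ] ℝ}

/-- If `dα = h^* om`, then smooth lifts exist locally. -/
theorem IsLift.exists_local (hV : IsPrequantizationBundle om proj lam) {Ω : Set E} (hΩ : IsOpen Ω)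
    (hh : ContMDiffOn 𝓘(ℝ, E) (𝓡 2) ∞ h Ω) (hα : ContDiffOn ℝ ∞ α Ω)
    (hcurv : ∀ x ∈ Ω, ∀ v w, fderiv ℝ α x v w - fderiv ℝ α x w v =
      om (h x) (mfderiv 𝓘(ℝ, E) (𝓡 2) h x v) (mfderiv 𝓘(ℝ, E) (𝓡 2) h x w))
    {x : E} (hx : x ∈ Ω) :
    ∃ s : E → V, ∀ᶠ y in 𝓝 x, IsLift proj lam h α s y ∧ ContMDiffAt 𝓘(ℝ, E) (𝓡 3) ∞ s y := by
  have hB := hV.toIsPrincipalBundle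
  obtain ⟨W, e, hW, hb, hsrc, ht, h1, h2, h3, h4⟩ := hB.locally_trivial (h x)
  have hopen : IsOpen (Ω ∩ h ⁻¹' W) := hh.continuousOn.isOpen_inter_preimage hΩ hW
  obtain ⟨r, hr, hball⟩ := Metric.isOpen_iff.mp hopen x ⟨hx, hb⟩
  let s₀ : E → V := fun y => e.symm (h y, 1)
  have htgt : ∀ y ∈ ball x r, (h y, (1 : Circle)) ∈ e.target := fun y hy => by
    rw [ht]; exact ⟨(hball hy).2, mem_univ _⟩
  have hproj : ∀ y ∈ ball x r, proj (s₀ y) = h y := fun y hy => by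
    rw [← h3 _ (e.map_target (htgt y hy)), e.right_inv (htgt y hy)]
  have hs₀ : ∀ y ∈ ball x r, ContMDiffAt 𝓘(ℝ, E) (𝓡 3) ∞ s₀ y := by
    intro y hy
    have a1 : ContMDiffAt 𝓘(ℝ, E) (𝓡 2) ∞ h y := hh.contMDiffAt (hΩ.mem_nhds (hball hy).1)
    have a2 := h2.contMDiffAt (e.open_target.mem_nhds (htgt y hy))
    exact a2.comp y (a1.prodMk contMDiffAt_const)
  have hlift : ∀ y ∈ ball x r, IsLift proj lam h (lam.pullback s₀) s₀ y := fun y hy =>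
    ⟨(hs₀ y hy).mdifferentiableAt (by simp), hproj y hy, fun w => rfl⟩
  have hαd : ∀ y ∈ ball x r, ContDiffAt ℝ ∞ α y := fun y hy =>
    hα.contDiffAt (hΩ.mem_nhds (hball hy).1)
  have hβd : ∀ y ∈ ball x r, ContDiffAt ℝ ∞ (lam.pullback s₀) y := fun y hy =>
    OneForm.contDiffAt_pullback hV.smooth_form (hs₀ y hy)
  have hprojd : ∀ y ∈ ball x r, ∀ v : E, (mfderiv (𝓡 3) (𝓡 2) proj (s₀ y)
      (mfderiv 𝓘(ℝ, E) (𝓡 3) s₀ y v) : EuclideanSpace ℝ (Fin 2)) =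
        mfderiv 𝓘(ℝ, E) (𝓡 2) h y v := by
    intro y hy v
    have b1 : (fun z => proj (s₀ z)) =ᶠ[𝓝 y] h := by
      filter_upwards [isOpen_ball.mem_nhds hy] with z hz using hproj z hz
    have b2 := mfderiv_comp y (hB.smooth_proj.mdifferentiableAt (by simp))
      ((hs₀ y hy).mdifferentiableAt (by simp))
    exact (congrArg (fun L : E →L[ℝ] EuclideanSpace ℝ (Fin 2) => L v)
      (b2.symm.trans b1.mfderiv_eq))
  -- Both `α` and the pullback of `lam` by `s₀` have derivative `h^* om`, so their difference is
  -- closed and has a primitive `f` on the ball. Rotating `s₀` by `f` corrects the form to `α`.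
  obtain ⟨f, hf⟩ := (convex_ball x r).exists_forall_hasFDerivAt_of_fderiv_symmetric isOpen_ball
    (show DifferentiableOn ℝ (fun y => α y - lam.pullback s₀ y) (ball x r) from fun y hy => (((hαd y hy).sub (hβd y hy)).differentiableAt (by simp)).differentiableWithinAt)
    (by
      intro y hy v w
      have c1 := hcurv y (hball hy).1 v w
      have c2 := OneForm.fderiv_pullback hV.smooth_form (hs₀ y hy) v w
      rw [hV.curvature] at c2
      have c3 := om.apply_congr (hproj y hy) (hprojd y hy v) (hprojd y hy w)
      have c4 : fderiv ℝ (fun y => α y - lam.pullback s₀ y) y =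
          fderiv ℝ α y - fderiv ℝ (lam.pullback s₀) y :=
        fderiv_sub ((hαd y hy).differentiableAt (by simp)) ((hβd y hy).differentiableAt (by simp))
      rw [c4]
      have c5 := c2.trans (c3.trans c1.symm)
      simp only [sub_apply]
      linarith)
  have hfs : ContDiffOn ℝ ∞ f (ball x r) := by
    rw [contDiffOn_infty_iff_fderiv_of_isOpen isOpen_ball]
    refine ⟨fun y hy => (hf y hy).differentiableAt.differentiableWithinAt, ?_⟩
    refine ContDiffOn.congr (f := fun y => α y - lam.pullback s₀ y) ?_
      (fun y hy => (hf y hy).fderiv)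
    exact fun y hy => ((hαd y hy).sub (hβd y hy)).contDiffWithinAt
  refine ⟨fun y => Circle.exp (f y) • s₀ y, ?_⟩
  filter_upwards [ball_mem_nhds x hr] with y hy
  constructor
  · have d1 := (hlift y hy).exp_smul hV (hf y hy)
    refine ⟨d1.mdifferentiableAt, d1.proj_eq, fun w => ?_⟩
    rw [d1.form_eq]
    simp
  · have d2 : ContMDiffAt 𝓘(ℝ, E) (𝓡 1) ∞ (fun y => Circle.exp (f y)) y :=
      contMDiff_circleExp.contMDiffAt.comp y
        (hfs.contDiffAt (isOpen_ball.mem_nhds hy)).contMDiffAt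
    exact hB.smooth_smul.contMDiffAt.comp y (d2.prodMk (hs₀ y hy))

/-- If `dα = h^* om`, then smooth lifts exist over star-shaped domains. -/
theorem IsLift.exists_of_starConvex (hV : IsPrequantizationBundle om proj lam) {Ω : Set E}
    (hΩ : IsOpen Ω) {a : E} (ha : a ∈ Ω) (hstar : StarConvex ℝ a Ω)
    (hh : ContMDiffOn 𝓘(ℝ, E) (𝓡 2) ∞ h Ω) (hα : ContDiffOn ℝ ∞ α Ω)
    (hcurv : ∀ x ∈ Ω, ∀ v w, fderiv ℝ α x v w - fderiv ℝ α x w v =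
      om (h x) (mfderiv 𝓘(ℝ, E) (𝓡 2) h x v) (mfderiv 𝓘(ℝ, E) (𝓡 2) h x w)) :
    ∃ s : E → V, ∀ x ∈ Ω, IsLift proj lam h α s x ∧ ContMDiffAt 𝓘(ℝ, E) (𝓡 3) ∞ s x := by
  have hB := hV.toIsPrincipalBundle
  refine exists_solution_of_starConvex (G := Circle) ?_ ?_
    (fun g v => hB.eq_one_of_smul_eq) hΩ ha hstar
    (fun x hx => IsLift.exists_local hV hΩ hh hα hcurv hx) ?_
  · exact fun s s' x hss hs => ⟨hs.1.congr hss, hs.2.congr_of_eventuallyEq hss.symm⟩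
  · exact fun g s x hs => ⟨hs.1.const_smul hV g, (hB.contMDiff_smul_left g).contMDiffAt.comp x hs.2⟩
  · exact fun U hU hUc s s' hs hs' => IsLift.exists_smul_eq hV hU hUc (fun y hy => (hs y hy).1)
      (fun y hy => (hs' y hy).1)

omit [IsManifold (𝓡 3) ∞ V] in
/-- Smooth lifts over two open sets with connected intersection yield one over the union. -/
theorem IsLift.exists_of_union (hV : IsPrequantizationBundle om proj lam) {U₁ U₂ : Set E}
    (hU₁ : IsOpen U₁) (hU₂ : IsOpen U₂) (hc : IsPreconnected (U₁ ∩ U₂)) {s₁ s₂ : E → V}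
    (h₁ : ∀ x ∈ U₁, IsLift proj lam h α s₁ x ∧ ContMDiffAt 𝓘(ℝ, E) (𝓡 3) ∞ s₁ x)
    (h₂ : ∀ x ∈ U₂, IsLift proj lam h α s₂ x ∧ ContMDiffAt 𝓘(ℝ, E) (𝓡 3) ∞ s₂ x) :
    ∃ s : E → V, ∀ x ∈ U₁ ∪ U₂,
      IsLift proj lam h α s x ∧ ContMDiffAt 𝓘(ℝ, E) (𝓡 3) ∞ s x := by
  have hB := hV.toIsPrincipalBundle
  obtain ⟨s, -, hs⟩ := exists_glue (G := Circle)
    (Q := fun s x => IsLift proj lam h α s x ∧ ContMDiffAt 𝓘(ℝ, E) (𝓡 3) ∞ s x)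
    (fun s s' x hss hs => ⟨hs.1.congr hss, hs.2.congr_of_eventuallyEq hss.symm⟩)
    (fun g s x hs => ⟨hs.1.const_smul hV g, (hB.contMDiff_smul_left g).contMDiffAt.comp x hs.2⟩)
    hU₁ hU₂ h₁ h₂ (IsLift.exists_smul_eq hV (hU₁.inter hU₂) hc
      (fun y hy => (h₂ y hy.2).1) (fun y hy => (h₁ y hy.1).1))
  exact ⟨s, hs⟩

end LocalExistence
end Prequantization

namespace Prequantization
open Filter Topology

noncomputable section

/-! ### Smoothness of maps into a sphere -/

section Sphere

variable {E : Type*} [NormedAddCommGroup E] [InnerProductSpace ℝ E] {n : ℕ}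
  [Fact (Module.finrank ℝ E = n + 1)]
  {F : Type*} [NormedAddCommGroup F] [NormedSpace ℝ F] {H : Type*} [TopologicalSpace H]
  {I : ModelWithCorners ℝ F H} {M : Type*} [TopologicalSpace M] [ChartedSpace H M]

/-- A map to the sphere is smooth at a point if it is smooth as a map to the ambient space. -/
theorem contMDiffAt_sphere_of_coe {m : WithTop ℕ∞} {g : M → sphere (0 : E) 1} {x : M}
    (hg : ContMDiffAt I 𝓘(ℝ, E) m (fun y => (g y : E)) x) : ContMDiffAt I (𝓡 n) m g x := by
  rw [contMDiffAt_iff_target]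
  refine ⟨Topology.IsInducing.subtypeVal.continuousAt_iff.2 hg.continuousAt, ?_⟩
  let v := g x
  let U : _ ≃ₗᵢ[ℝ] _ :=
    (OrthonormalBasis.fromOrthogonalSpanSingleton (𝕜 := ℝ) n
      (ne_zero_of_mem_unit_sphere (-v))).repr
  -- The preferred chart at `v` is stereographic projection from `-v`, which is smooth on the
  -- ambient space near `v`.
  have h1 : ContDiffAt ℝ m (stereoToFun (-(v : E))) (v : E) := by
    refine ((contDiffOn_stereoToFun (v := -(v : E))).contDiffAt ?_).of_le le_top
    refine IsOpen.mem_nhds ?_ ?_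
    · exact isOpen_ne_fun (by fun_prop) (by fun_prop)
    · have : ‖(v : E)‖ = 1 := norm_eq_of_mem_sphere v
      simp [this]
      norm_num
  have h2 : ContDiffAt ℝ m (fun y => U (stereoToFun (-(v : E)) y)) (v : E) :=
    U.contDiff.contDiffAt.comp (v : E) h1
  exact ContMDiffAt.comp (g := fun y => U (stereoToFun (-(v : E)) y)) x h2.contMDiffAt hg

end Sphere

/-! ### The Hopf map and the curvature of the standard connection form -/

section Hopf

/-- The squared norm on `ℂ²` in real coordinates. -/
def nsq (x : C2) : ℝ := (x 0).re ^ 2 + (x 0).im ^ 2 + (x 1).re ^ 2 + (x 1).im ^ 2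

/-- The real inner product on `ℂ²` in real coordinates. -/
def rdot (x y : C2) : ℝ :=
  (x 0).re * (y 0).re + (x 0).im * (y 0).im + (x 1).re * (y 1).re + (x 1).im * (y 1).im

/-- The form `⟨i x, y⟩` in real coordinates. -/
def idot (x y : C2) : ℝ :=
  (x 0).re * (y 0).im - (x 0).im * (y 0).re + ((x 1).re * (y 1).im - (x 1).im * (y 1).re)

/-- The quadratic map underlying the Hopf map. -/
def hopfQuad (x : C2) : EuclideanSpace ℝ (Fin 3) :=
  !₂[2 * ((x 0).re * (x 1).re + (x 0).im * (x 1).im),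
    2 * ((x 0).re * (x 1).im - (x 0).im * (x 1).re),
    (x 0).re ^ 2 + (x 0).im ^ 2 - (x 1).re ^ 2 - (x 1).im ^ 2]

/-- The derivative of `hopfQuad`. -/
def hopfPolar (x v : C2) : EuclideanSpace ℝ (Fin 3) :=
  !₂[2 * ((x 0).re * (v 1).re + (x 0).im * (v 1).im + (v 0).re * (x 1).re + (v 0).im * (x 1).im),
    2 * ((x 0).re * (v 1).im - (x 0).im * (v 1).re + (v 0).re * (x 1).im - (v 0).im * (x 1).re),
    2 * ((x 0).re * (v 0).re + (x 0).im * (v 0).im - (x 1).re * (v 1).re - (x 1).im * (v 1).im)]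

/-- The Hopf map, extended to `ℂ²` by homogeneity of degree zero. -/
def hopfVec (x : C2) : EuclideanSpace ℝ (Fin 3) := (nsq x)⁻¹ • hopfQuad x

theorem norm_sq_eq_nsq (x : C2) : ‖x‖ ^ 2 = nsq x := by
  rw [EuclideanSpace.norm_sq_eq]
  simp only [Fin.sum_univ_two, Complex.sq_norm, Complex.normSq_apply, nsq]
  ring

theorem nsq_pos {x : C2} (hx : x ≠ 0) : 0 < nsq x := by
  rw [← norm_sq_eq_nsq]; positivity

theorem inner_eq_rdot (x y : C2) : inner ℝ x y = rdot x y := by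
  simp only [PiLp.inner_apply, Fin.sum_univ_two, Complex.inner, rdot]
  simp
  ring

theorem inner_I_smul_eq_idot (x y : C2) : inner ℝ (Complex.I • x) y = idot x y := by
  rw [inner_eq_rdot]
  simp [rdot, idot]
  ring

theorem contDiff_nsq : ContDiff ℝ ∞ nsq := by
  have : nsq = fun x => ‖x‖ ^ 2 := funext fun x => (norm_sq_eq_nsq x).symm
  rw [this]
  exact contDiff_norm_sq ℝ

theorem contDiff_coord (i : Fin 2) : ContDiff ℝ ∞ (fun x : C2 => x i) :=
  ((EuclideanSpace.proj i : C2 →L[ℂ] ℂ).restrictScalars ℝ).contDiff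

theorem contDiff_coord_re (i : Fin 2) : ContDiff ℝ ∞ (fun x : C2 => (x i).re) :=
  Complex.reCLM.contDiff.comp (contDiff_coord i)

theorem contDiff_coord_im (i : Fin 2) : ContDiff ℝ ∞ (fun x : C2 => (x i).im) :=
  Complex.imCLM.contDiff.comp (contDiff_coord i)

theorem contDiff_hopfQuad : ContDiff ℝ ∞ hopfQuad := by
  have h1 := contDiff_coord_re 0
  have h2 := contDiff_coord_re 1
  have h3 := contDiff_coord_im 0
  have h4 := contDiff_coord_im 1
  rw [contDiff_euclidean]
  intro i
  fin_cases i
  · simp only [hopfQuad]; simp; fun_prop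
  · simp only [hopfQuad]; simp; fun_prop
  · simp only [hopfQuad]; simp; fun_prop

theorem contDiffAt_hopfVec {x : C2} (hx : x ≠ 0) : ContDiffAt ℝ ∞ hopfVec x :=
  (contDiff_nsq.contDiffAt.inv (nsq_pos hx).ne').smul contDiff_hopfQuad.contDiffAt

theorem nsq_add_smul (x v : C2) (t : ℝ) : nsq (x + t • v) = nsq x + t * (2 * rdot x v) + t ^ 2 * nsq v := by
  simp [nsq, rdot]; ring

theorem hopfQuad_add_smul (x v : C2) (t : ℝ) :
    hopfQuad (x + t • v) = hopfQuad x + t • hopfPolar x v + t ^ 2 • hopfQuad v := by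
  ext i
  fin_cases i
  · simp [hopfQuad, hopfPolar]; ring
  · simp [hopfQuad, hopfPolar]; ring
  · simp [hopfQuad, hopfPolar]; ring

theorem hasDerivAt_nsq_line (x v : C2) :
    HasDerivAt (fun t : ℝ => nsq (x + t • v)) (2 * rdot x v) 0 := by
  simp only [nsq_add_smul]
  have := (((hasDerivAt_id (0 : ℝ)).mul_const (2 * rdot x v)).const_add (nsq x)).add
    ((hasDerivAt_pow 2 (0 : ℝ)).mul_const (nsq v))
  exact this.congr_deriv (by simp)

theorem hasDerivAt_hopfQuad_line (x v : C2) :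
    HasDerivAt (fun t : ℝ => hopfQuad (x + t • v)) (hopfPolar x v) 0 := by
  simp only [hopfQuad_add_smul]
  have := (((hasDerivAt_id (0 : ℝ)).smul_const (hopfPolar x v)).const_add (hopfQuad x)).add
    ((hasDerivAt_pow 2 (0 : ℝ)).smul_const (hopfQuad v))
  exact this.congr_deriv (by simp)

theorem hasDerivAt_line (x v : C2) : HasDerivAt (fun t : ℝ => x + t • v) v 0 := by
  simpa using ((hasDerivAt_id (0 : ℝ)).smul_const v).const_add x

/-- On the line `t ↦ x + t v` both `nsq` and `hopfQuad` are quadratic polynomials in `t`, so the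
one-variable rules give the directional derivative; differentiability is already known. -/
theorem fderiv_hopfVec {x : C2} (hx : x ≠ 0) (v : C2) :
    fderiv ℝ hopfVec x v =
      (nsq x)⁻¹ • hopfPolar x v + (-(2 * rdot x v) / nsq x ^ 2) • hopfQuad x := by
  have h1 : HasFDerivAt hopfVec (fderiv ℝ hopfVec x) (x + (0 : ℝ) • v) := by
    simpa using ((contDiffAt_hopfVec hx).differentiableAt (by simp)).hasFDerivAt
  have h2 := h1.comp_hasDerivAt (0 : ℝ) (hasDerivAt_line x v)
  have h3 := ((hasDerivAt_nsq_line x v).inv (by simpa using (nsq_pos hx).ne')).smul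
    (hasDerivAt_hopfQuad_line x v)
  have h4 := h2.unique h3
  simpa using h4

/-- The connection form `⟨i x, ·⟩ / |x|²`. -/
def conn (x : C2) : C2 →L[ℝ] ℝ := (nsq x)⁻¹ • innerSL ℝ (Complex.I • x)

theorem conn_apply (x w : C2) : conn x w = (nsq x)⁻¹ * idot x w := by
  simp only [conn, ← inner_I_smul_eq_idot]
  rfl

theorem idot_add_smul (x v w : C2) (t : ℝ) : idot (x + t • v) w = idot x w + t * idot v w := by
  simp [idot]; ring

theorem contDiff_idot (w : C2) : ContDiff ℝ ∞ (fun x => idot x w) := by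
  have h1 := contDiff_coord_re 0
  have h2 := contDiff_coord_re 1
  have h3 := contDiff_coord_im 0
  have h4 := contDiff_coord_im 1
  unfold idot
  fun_prop

theorem contDiffOn_conn : ContDiffOn ℝ ∞ conn {0}ᶜ := by
  rw [contDiffOn_clm_apply]
  intro w
  simp only [conn_apply]
  exact fun x hx => ((contDiff_nsq.contDiffAt.inv (nsq_pos hx).ne').mul
    (contDiff_idot w).contDiffAt).contDiffWithinAt

theorem fderiv_conn {x : C2} (hx : x ≠ 0) (v w : C2) :
    fderiv ℝ conn x v w =
      -(2 * rdot x v) / nsq x ^ 2 * idot x w + (nsq x)⁻¹ * idot v w := by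
  have h0 : HasFDerivAt conn (fderiv ℝ conn x) (x + (0 : ℝ) • v) := by
    simpa using ((contDiffOn_conn.contDiffAt
      (isOpen_compl_singleton.mem_nhds hx)).differentiableAt (by simp)).hasFDerivAt
  have h1 := h0.comp_hasDerivAt (0 : ℝ) (hasDerivAt_line x v)
  have h2 : HasDerivAt (fun t : ℝ => conn (x + t • v) w) (fderiv ℝ conn x v w) 0 := by
    simpa using h1.clm_apply (hasDerivAt_const (0 : ℝ) w)
  have h4 : HasDerivAt (fun t : ℝ => idot (x + t • v) w) (idot v w) 0 := by
    simp only [idot_add_smul]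
    simpa using ((hasDerivAt_id (0 : ℝ)).mul_const (idot v w)).const_add (idot x w)
  have h3 := ((hasDerivAt_nsq_line x v).inv (by simpa using (nsq_pos hx).ne')).mul h4
  simp only [conn_apply] at h2
  have h5 := h2.unique h3
  simpa using h5

/-- The determinant of three vectors of `ℝ³`. -/
def det3 (a b c : EuclideanSpace ℝ (Fin 3)) : ℝ :=
  Matrix.det (Matrix.of ![fun i => a i, fun i => b i, fun i => c i])

theorem det3_eq (a b c : EuclideanSpace ℝ (Fin 3)) : det3 a b c =
    a 0 * (b 1 * c 2 - b 2 * c 1) - a 1 * (b 0 * c 2 - b 2 * c 0) +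
      a 2 * (b 0 * c 1 - b 1 * c 0) := by
  simp [det3, Matrix.det_fin_three]; ring

/-- The curvature identity cleared of denominators: a polynomial identity in real coordinates. -/
theorem det3_hopfPolar (x v w : C2) : det3 (hopfQuad x) (hopfPolar x v) (hopfPolar x w) =
    4 * nsq x * (nsq x * idot v w - rdot x v * idot x w + rdot x w * idot x v) := by
  simp only [det3_eq, hopfQuad, hopfPolar, nsq, idot, rdot]
  simp
  ring

/-- The part of `fderiv ℝ hopfVec x` parallel to `hopfQuad x` drops out of the determinant, and
`det3_hopfPolar` evaluates the rest. The factor one half is the normalization of `omega0` to total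
area `2π`. -/
theorem det3_fderiv_hopfVec {x : C2} (hx : x ≠ 0) (v w : C2) :
    (1 / 2 : ℝ) * det3 (hopfVec x) (fderiv ℝ hopfVec x v) (fderiv ℝ hopfVec x w) =
      fderiv ℝ conn x v w - fderiv ℝ conn x w v := by
  have h1 : det3 (hopfVec x) (fderiv ℝ hopfVec x v) (fderiv ℝ hopfVec x w) =
      ((nsq x)⁻¹) ^ 3 * det3 (hopfQuad x) (hopfPolar x v) (hopfPolar x w) := by
    rw [fderiv_hopfVec hx, fderiv_hopfVec hx, hopfVec]
    simp only [det3_eq, PiLp.add_apply, PiLp.smul_apply, smul_eq_mul]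
    ring
  have h2 : idot w v = - idot v w := by simp only [idot]; ring
  rw [h1, det3_hopfPolar, fderiv_conn hx, fderiv_conn hx, h2]
  have := (nsq_pos hx).ne'
  field_simp
  ring

end Hopf
end
end Prequantization

namespace Prequantization
open Filter Topology

noncomputable section

theorem norm_hopfVec {x : C2} (hx : x ≠ 0) : ‖hopfVec x‖ = 1 := by
  have h1 : ‖hopfQuad x‖ ^ 2 = nsq x ^ 2 := by
    rw [EuclideanSpace.norm_sq_eq]
    simp [Fin.sum_univ_three, hopfQuad, nsq]
    ring
  have h2 : ‖hopfQuad x‖ = nsq x :=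
    (pow_left_inj₀ (norm_nonneg _) (nsq_pos hx).le two_ne_zero).mp h1
  rw [hopfVec, norm_smul, h2, norm_inv, Real.norm_of_nonneg (nsq_pos hx).le,
    inv_mul_cancel₀ (nsq_pos hx).ne']

open Classical in
/-- The Hopf map `ℂ² ∖ 0 → S²` (with a junk value at the origin). -/
def hopf (x : C2) : S2 :=
  if h : x ≠ 0 then ⟨hopfVec x, by simpa using norm_hopfVec h⟩
  else ⟨EuclideanSpace.single 0 1, by simp⟩

theorem coe_hopf {x : C2} (hx : x ≠ 0) : (hopf x : EuclideanSpace ℝ (Fin 3)) = hopfVec x := by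
  simp [hopf, hx]

theorem contMDiffAt_hopf {x : C2} (hx : x ≠ 0) : ContMDiffAt 𝓘(ℝ, C2) (𝓡 2) ∞ hopf x := by
  have := Fact.mk (@finrank_euclideanSpace_fin ℝ _ (2 + 1))
  refine contMDiffAt_sphere_of_coe ?_
  refine (contDiffAt_hopfVec hx).contMDiffAt.congr_of_eventuallyEq ?_
  filter_upwards [isOpen_compl_singleton.mem_nhds hx] with y hy using coe_hopf hy

theorem contMDiff_coe_S2 : ContMDiff (𝓡 2) 𝓘(ℝ, EuclideanSpace ℝ (Fin 3)) ∞
    (Subtype.val : S2 → EuclideanSpace ℝ (Fin 3)) :=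
  have := Fact.mk (@finrank_euclideanSpace_fin ℝ _ (2 + 1))
  contMDiff_coe_sphere

theorem inclS2_mfderiv {E : Type*} [NormedAddCommGroup E] [NormedSpace ℝ E] {g : E → S2} {x : E}
    (hg : MDifferentiableAt 𝓘(ℝ, E) (𝓡 2) g x) (v : E) :
    inclS2 (g x) (mfderiv 𝓘(ℝ, E) (𝓡 2) g x v) =
      fderiv ℝ (fun y => (g y : EuclideanSpace ℝ (Fin 3))) x v := by
  have h1 : MDifferentiableAt (𝓡 2) 𝓘(ℝ, EuclideanSpace ℝ (Fin 3))
      (Subtype.val : S2 → EuclideanSpace ℝ (Fin 3)) (g x) :=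
    contMDiff_coe_S2.mdifferentiableAt (by simp)
  have h2 := congrArg (fun L => L v) (mfderiv_comp x h1 hg)
  refine h2.symm.trans ?_
  rw [mfderiv_eq_fderiv]
  rfl

theorem inclS2_mfderiv_hopf {x : C2} (hx : x ≠ 0) (v : C2) :
    inclS2 (hopf x) (mfderiv 𝓘(ℝ, C2) (𝓡 2) hopf x v) = fderiv ℝ hopfVec x v := by
  rw [inclS2_mfderiv ((contMDiffAt_hopf hx).mdifferentiableAt (by simp))]
  have : (fun y => (hopf y : EuclideanSpace ℝ (Fin 3))) =ᶠ[𝓝 x] hopfVec := by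
    filter_upwards [isOpen_compl_singleton.mem_nhds hx] with y hy using coe_hopf hy
  rw [this.fderiv_eq]

theorem omega0_eq_det3 (p : S2) (v w : TangentSpace (𝓡 2) p) :
    omega0 p v w = (1 / 2 : ℝ) * det3 p.1 (inclS2 p v) (inclS2 p w) := rfl

/-- The curvature of the standard connection form on `ℂ² ∖ 0` is the pullback of `omega0`. -/
theorem fderiv_conn_eq_omega0 {x : C2} (hx : x ≠ 0) (v w : C2) :
    fderiv ℝ conn x v w - fderiv ℝ conn x w v =
      omega0 (hopf x) (mfderiv 𝓘(ℝ, C2) (𝓡 2) hopf x v) (mfderiv 𝓘(ℝ, C2) (𝓡 2) hopf x w) := by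
  rw [omega0_eq_det3, inclS2_mfderiv_hopf hx, inclS2_mfderiv_hopf hx, coe_hopf hx,
    det3_fderiv_hopfVec hx]

/-- The complement in `ℂ²` of a ray of the real axis of the first coordinate. -/
def rayCompl (c : ℝ) : Set C2 := {x | (x 0).im ≠ 0 ∨ x 1 ≠ 0 ∨ 0 < c * (x 0).re}

theorem isOpen_rayCompl (c : ℝ) : IsOpen (rayCompl c) := by
  have h1 : Continuous fun x : C2 => (x 0).im := (contDiff_coord_im 0).continuous
  have h2 : Continuous fun x : C2 => (x 0).re := (contDiff_coord_re 0).continuous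
  have h3 : Continuous fun x : C2 => x 1 := (contDiff_coord 1).continuous
  exact (isOpen_ne_fun h1 continuous_const).union ((isOpen_ne_fun h3 continuous_const).union
    (isOpen_lt continuous_const (continuous_const.mul h2)))

theorem zero_notMem_rayCompl {c : ℝ} {x : C2} (hx : x ∈ rayCompl c) : x ≠ 0 := by
  rintro rfl
  simp [rayCompl] at hx

theorem single_mem_rayCompl {c : ℝ} (hc : 0 < c * c) :
    EuclideanSpace.single 0 (c : ℂ) ∈ rayCompl c := by
  right; right; simpa using hc

theorem starConvex_rayCompl {c : ℝ} (hc : 0 < c * c) :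
    StarConvex ℝ (EuclideanSpace.single 0 (c : ℂ) : C2) (rayCompl c) := by
  intro x hx a b ha hb hab
  rcases hb.eq_or_lt with rfl | hb
  · have : a = 1 := by linarith
    subst this
    simpa using single_mem_rayCompl hc
  rcases hx with hx | hx | hx
  · left
    simpa using ⟨hb.ne', hx⟩
  · right; left
    simpa using ⟨hb.ne', hx⟩
  · right; right
    simp only [PiLp.add_apply, PiLp.smul_apply, PiLp.single_apply, if_true,
      Complex.add_re, Complex.smul_re, Complex.ofReal_re, smul_eq_mul]
    nlinarith [mul_pos hb hx, mul_nonneg ha hc.le]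

theorem rayCompl_union : rayCompl 1 ∪ rayCompl (-1) = ({0}ᶜ : Set C2) := by
  ext x
  constructor
  · rintro (hx | hx) <;> exact zero_notMem_rayCompl hx
  · intro hx
    by_contra hcon
    simp only [rayCompl, mem_union, mem_ofPred_eq, not_or, not_not, not_lt] at hcon
    obtain ⟨⟨h1, h2, h3⟩, -, -, h4⟩ := hcon
    refine hx ?_
    ext i
    fin_cases i
    · exact Complex.ext (by simp; linarith) (by simpa using h1)
    · simpa using h2

/-- Removing both rays removes a real line, which has codimension 3. -/
theorem isPreconnected_rayCompl_inter : IsPreconnected (rayCompl 1 ∩ rayCompl (-1)) := by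
  have h : rayCompl 1 ∩ rayCompl (-1) =
      ((Submodule.span ℝ {(EuclideanSpace.single 0 1 : C2)} : Submodule ℝ C2) : Set C2)ᶜ := by
    ext x
    simp only [mem_compl_iff, SetLike.mem_coe, Submodule.mem_span_singleton, not_exists]
    constructor
    · rintro ⟨h1, h2⟩ c rfl
      simp [rayCompl] at h1 h2
      linarith
    · intro h
      by_contra hcon
      have h0 : ¬ ((x 0).im ≠ 0 ∨ x 1 ≠ 0) := by
        intro h'
        exact hcon (by rcases h' with h' | h' <;> simp [rayCompl, h'])
      simp only [not_or, not_not] at h0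
      refine h (x 0).re ?_
      ext i
      fin_cases i
      · exact Complex.ext (by simp) (by simp [h0.1])
      · simp [h0.2]
  rw [h]
  refine (isConnected_compl_of_one_lt_codim ?_).isPreconnected
  refine Module.lt_rank_of_lt_finrank ?_
  have h1 := (Submodule.span ℝ {(EuclideanSpace.single 0 1 : C2)}).finrank_quotient_add_finrank
  rw [finrank_span_singleton (by simp), finrank_C2.out] at h1
  have h2 : Module.finrank ℝ (C2 ⧸ Submodule.span ℝ {(EuclideanSpace.single 0 1 : C2)}) = 3 :=
    Nat.add_right_cancel h1
  rw [h2]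
  norm_num

/-! ### The lift of the Hopf map to `V` -/

section Global

variable {V : Type*} [TopologicalSpace V] [ChartedSpace E3 V] [IsManifold (𝓡 3) ∞ V]
  [MulAction Circle V] {proj : V → S2} {lam : OneForm V} {k : ℕ}

/-- The Hopf map lifts to `V` in such a way that `lam` pulls back to `k` times the standard
connection form. -/
theorem exists_lift_hopf
    (hV : IsPrequantizationBundle (fun b v w => (k : ℝ) * omega0 b v w) proj lam) :
    ∃ P : C2 → V, ∀ x ≠ 0, IsLift proj lam hopf (fun y => (k : ℝ) • conn y) P x ∧
      ContMDiffAt 𝓘(ℝ, C2) (𝓡 3) ∞ P x := by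
  have hex : ∀ c : ℝ, 0 < c * c → ∃ s : C2 → V, ∀ x ∈ rayCompl c,
      IsLift proj lam hopf (fun y => (k : ℝ) • conn y) s x ∧
        ContMDiffAt 𝓘(ℝ, C2) (𝓡 3) ∞ s x := by
    intro c hc
    refine IsLift.exists_of_starConvex hV (isOpen_rayCompl c) (single_mem_rayCompl hc)
      (starConvex_rayCompl hc) (fun x hx => ?_) ?_ ?_
    · exact (contMDiffAt_hopf (zero_notMem_rayCompl hx)).contMDiffWithinAt
    · exact (contDiffOn_conn.mono fun x hx => zero_notMem_rayCompl hx).const_smul (k : ℝ)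
    · intro x hx v w
      have hx0 := zero_notMem_rayCompl hx
      have h1 : DifferentiableAt ℝ conn x :=
        (contDiffOn_conn.contDiffAt (isOpen_compl_singleton.mem_nhds hx0)).differentiableAt
          (by simp)
      have h2 : fderiv ℝ (fun y => (k : ℝ) • conn y) x = (k : ℝ) • fderiv ℝ conn x :=
        fderiv_const_smul (c := (k : ℝ)) h1
      rw [h2, ← fderiv_conn_eq_omega0 hx0]
      simp [mul_sub]
  obtain ⟨s₁, h₁⟩ := hex 1 (by norm_num)
  obtain ⟨s₂, h₂⟩ := hex (-1) (by norm_num)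
  obtain ⟨s, hs⟩ := IsLift.exists_of_union hV (isOpen_rayCompl 1) (isOpen_rayCompl (-1))
    isPreconnected_rayCompl_inter h₁ h₂
  rw [rayCompl_union] at hs
  exact ⟨s, hs⟩

end Global
end
end Prequantization

namespace Prequantization
open Filter Topology

noncomputable section

/-! ### Fibres and surjectivity of the Hopf map -/

section Fibres

theorem nsq_smul (z : ℂ) (x : C2) : nsq (z • x) = Complex.normSq z * nsq x := by
  simp [nsq, Complex.normSq_apply]; ring

theorem hopfQuad_smul (z : ℂ) (x : C2) : hopfQuad (z • x) = Complex.normSq z • hopfQuad x := by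
  ext i
  fin_cases i
  · simp [hopfQuad, Complex.normSq_apply]; ring
  · simp [hopfQuad, Complex.normSq_apply]; ring
  · simp [hopfQuad, Complex.normSq_apply]; ring

theorem hopfVec_smul {z : ℂ} (hz : z ≠ 0) (x : C2) : hopfVec (z • x) = hopfVec x := by
  have h : Complex.normSq z ≠ 0 := by simpa using hz
  rw [hopfVec, hopfVec, nsq_smul, hopfQuad_smul, smul_smul, mul_inv]
  congr 1
  field_simp

theorem circle_smul_ne_zero (z : Circle) {x : C2} (hx : x ≠ 0) : (z : ℂ) • x ≠ 0 :=
  smul_ne_zero z.coe_ne_zero hx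

theorem hopf_circle_smul (z : Circle) {x : C2} (hx : x ≠ 0) : hopf ((z : ℂ) • x) = hopf x := by
  refine Subtype.ext ?_
  rw [coe_hopf hx, coe_hopf (circle_smul_ne_zero z hx), hopfVec_smul z.coe_ne_zero]

theorem S3.ne_zero (x : S3) : x.1 ≠ 0 := ne_zero_of_mem_unit_sphere x

theorem nsq_S3 (x : S3) : nsq x.1 = 1 := by
  rw [← norm_sq_eq_nsq, norm_eq_of_mem_sphere x, one_pow]

/-- For a unit vector the Hopf map records the projector `x x^*`. If `x x^* = y y^*`, then `y = y
y^* y = x (x^* y)`, so the phase is the Hermitian product `z = x^* y`. The facts `hA`, `hB`, `hC`,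
`hE` are the entries of the matrix equation, and `hD` is `y^* y = 1`. -/
theorem exists_smul_eq_of_hopf_eq {x y : S3} (h : hopf x.1 = hopf y.1) :
    ∃ z : Circle, y = z • x := by
  have h1 : hopfQuad x.1 = hopfQuad y.1 := by
    have := congrArg Subtype.val h
    rw [coe_hopf x.ne_zero, coe_hopf y.ne_zero, hopfVec, hopfVec, nsq_S3, nsq_S3] at this
    simpa using this
  have e0 := congrArg (fun v : EuclideanSpace ℝ (Fin 3) => v 0) h1
  have e1 := congrArg (fun v : EuclideanSpace ℝ (Fin 3) => v 1) h1
  have e2 := congrArg (fun v : EuclideanSpace ℝ (Fin 3) => v 2) h1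
  have nx := nsq_S3 x
  have ny := nsq_S3 y
  simp [hopfQuad] at e0 e1 e2
  simp only [nsq] at nx ny
  let z : ℂ := (starRingEnd ℂ) (x.1 0) * y.1 0 + (starRingEnd ℂ) (x.1 1) * y.1 1
  have hA : (starRingEnd ℂ) (x.1 0) * x.1 1 = (starRingEnd ℂ) (y.1 0) * y.1 1 :=
    Complex.ext (by simp; linarith) (by simp; linarith)
  have hB : x.1 0 * (starRingEnd ℂ) (x.1 1) = y.1 0 * (starRingEnd ℂ) (y.1 1) :=
    Complex.ext (by simp; linarith) (by simp; linarith)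
  have hC : x.1 0 * (starRingEnd ℂ) (x.1 0) = y.1 0 * (starRingEnd ℂ) (y.1 0) :=
    Complex.ext (by simp; linarith) (by simp; ring)
  have hE : x.1 1 * (starRingEnd ℂ) (x.1 1) = y.1 1 * (starRingEnd ℂ) (y.1 1) :=
    Complex.ext (by simp; linarith) (by simp; ring)
  have hD : y.1 0 * (starRingEnd ℂ) (y.1 0) + y.1 1 * (starRingEnd ℂ) (y.1 1) = 1 :=
    Complex.ext (by simp; linarith) (by simp; ring)
  have hz : y.1 = z • x.1 := by
    ext i
    fin_cases i
    · simp only [z, PiLp.smul_apply, smul_eq_mul, Fin.zero_eta]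
      linear_combination (-y.1 0) * hC - y.1 1 * hB - y.1 0 * hD
    · simp only [z, PiLp.smul_apply, smul_eq_mul, Fin.mk_one]
      linear_combination (-y.1 0) * hA - y.1 1 * hE - y.1 1 * hD
  have hn : ‖z‖ = 1 := by
    have := congrArg norm hz
    rw [norm_smul, norm_eq_of_mem_sphere x, norm_eq_of_mem_sphere y, mul_one] at this
    exact this.symm
  exact ⟨⟨z, by simpa [Submonoid.unitSphere] using hn⟩, Subtype.ext hz⟩

/-- Up to a phase the first coordinate is a nonnegative real `r`, and the height of `b` forces `r² =
(1 + b₂) / 2`; the second coordinate follows on dividing by `2 r`. The south pole, where `r = 0`, is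
separate. -/
theorem hopf_surjective (b : S2) : ∃ x : S3, hopf x.1 = b := by
  have hb : b.1 0 ^ 2 + b.1 1 ^ 2 + b.1 2 ^ 2 = 1 := by
    have h1 : ‖b.1‖ ^ 2 = 1 := by rw [norm_eq_of_mem_sphere b, one_pow]
    rw [EuclideanSpace.norm_sq_eq] at h1
    simpa [Fin.sum_univ_three] using h1
  suffices h : ∃ x : C2, nsq x = 1 ∧ hopfQuad x = b.1 by
    obtain ⟨x, h1, h2⟩ := h
    have h3 : ‖x‖ = 1 := by
      have := norm_sq_eq_nsq x
      rw [h1] at this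
      exact (pow_left_inj₀ (norm_nonneg _) zero_le_one two_ne_zero).mp (by simpa using this)
    refine ⟨⟨x, by simpa using h3⟩, Subtype.ext ?_⟩
    have hx : x ≠ 0 := by rintro rfl; simp at h3
    rw [coe_hopf hx, hopfVec, h1, h2, inv_one, one_smul]
  by_cases hs : 1 + b.1 2 = 0
  · have h2 : b.1 2 = -1 := by linarith
    have h0 : b.1 0 = 0 := by nlinarith [sq_nonneg (b.1 0), sq_nonneg (b.1 1)]
    have h1 : b.1 1 = 0 := by nlinarith [sq_nonneg (b.1 0), sq_nonneg (b.1 1)]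
    refine ⟨!₂[0, 1], by simp [nsq], ?_⟩
    ext i
    fin_cases i
    · simp [hopfQuad, h0]
    · simp [hopfQuad, h1]
    · simp [hopfQuad, h2]
  · have hpos : 0 < 1 + b.1 2 := by
      refine lt_of_le_of_ne ?_ (Ne.symm hs)
      nlinarith [sq_nonneg (b.1 0), sq_nonneg (b.1 1), sq_nonneg (b.1 2 - 1)]
    set r := Real.sqrt ((1 + b.1 2) / 2) with hr
    have hr0 : 0 < r := Real.sqrt_pos.mpr (by positivity)
    have hr2 : r ^ 2 = (1 + b.1 2) / 2 := Real.sq_sqrt (by positivity)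
    have hq : (b.1 0 / (2 * r)) ^ 2 + (b.1 1 / (2 * r)) ^ 2 = (1 - b.1 2) / 2 := by
      have h4 : b.1 0 ^ 2 + b.1 1 ^ 2 = (1 - b.1 2) / 2 * (4 * r ^ 2) := by
        rw [hr2]; linear_combination hb
      field_simp
      field_simp at h4
      linarith
    refine ⟨!₂[(r : ℂ), ⟨b.1 0 / (2 * r), b.1 1 / (2 * r)⟩], ?_, ?_⟩
    · simp [nsq]
      linarith
    · ext i
      fin_cases i
      · simp [hopfQuad]; field_simp
      · simp [hopfQuad]; field_simp
      · simp [hopfQuad]; linarith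

end Fibres

/-! ### The Reeb flow is the circle action -/

section Curves

variable {V : Type*} [TopologicalSpace V] [ChartedSpace E3 V]
  [MulAction Circle V] {proj : V → S2} {lam : OneForm V} {om : TwoFormS2}

/-- A curve in a fibre along which `lam` has constant value is an orbit of the circle action. -/
theorem curve_eq_exp_smul (hV : IsPrequantizationBundle om proj lam) {c : ℝ → V} {r : ℝ} {b : S2}
    (hc : ∀ t, MDifferentiableAt 𝓘(ℝ, ℝ) (𝓡 3) c t) (hb : ∀ t, proj (c t) = b)
    (hr : ∀ t, lam (c t) (mfderiv 𝓘(ℝ, ℝ) (𝓡 3) c t (1 : ℝ)) = r) (t : ℝ) :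
    c t = Circle.exp (r * t) • c 0 := by
  have hB := hV.toIsPrincipalBundle
  -- Both curves are lifts of the constant map `b` with form `r dt`, so they differ by a constant
  -- rotation, which is trivial because they agree at 0.
  have h1 : ∀ t ∈ univ, IsLift proj lam (fun _ => b)
      (fun _ => r • ContinuousLinearMap.id ℝ ℝ) c t := by
    refine fun t _ => ⟨hc t, hb t, fun w => ?_⟩
    have h2 : mfderiv 𝓘(ℝ, ℝ) (𝓡 3) c t w = w • mfderiv 𝓘(ℝ, ℝ) (𝓡 3) c t (1 : ℝ) := by
      refine Eq.trans ?_ (map_smul _ _ _)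
      exact congrArg (mfderiv 𝓘(ℝ, ℝ) (𝓡 3) c t) (mul_one w).symm
    have h3 := (congrArg (lam (c t)) h2).trans (map_smul _ _ _)
    rw [hr] at h3
    refine h3.trans ?_
    simp [mul_comm]
  have h2 : ∀ t ∈ univ, IsLift proj lam (fun _ : ℝ => b)
      (fun _ => r • ContinuousLinearMap.id ℝ ℝ) (fun t => Circle.exp (r * t) • c 0) t := by
    intro t _
    have h3 : IsLift proj lam (fun _ : ℝ => b) (fun _ => 0) (fun _ => c 0) t :=
      ⟨mdifferentiableAt_const, hb 0, fun w => by
        rw [mfderiv_const]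
        exact map_zero _⟩
    have h4 : HasFDerivAt (fun t => r * t) (r • ContinuousLinearMap.id ℝ ℝ) t :=
      (hasFDerivAt_id t).const_mul r
    have h5 := h3.exp_smul hV h4
    exact ⟨h5.1, h5.2, fun w => by rw [h5.3 w]; simp⟩
  obtain ⟨z, hz⟩ := IsLift.exists_smul_eq hV isOpen_univ isPreconnected_univ h2 h1
  have h0 := hz 0 (mem_univ _)
  simp only [mul_zero, Circle.exp_zero, one_smul] at h0
  have := hB.eq_one_of_smul_eq h0.symm
  rw [hz t (mem_univ _), this, one_smul]

/-- The orbits are vertical, so their velocity is killed by the differential of `proj` and hence by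
the curvature. The assumption `hom` is there because a `TwoFormS2` is not required to be linear. -/
theorem isReebFlow_exp_smul (hV : IsPrequantizationBundle om proj lam)
    (hom : ∀ p w, om p 0 w = 0) : IsReebFlow lam (fun t x => Circle.exp t • x) where
  zero x := by simp
  mdifferentiableAt x t :=
    (hV.toIsPrincipalBundle.contMDiff_exp_smul x).mdifferentiableAt (by simp)
  reeb x t := by
    have hB := hV.toIsPrincipalBundle
    refine ⟨hV.normalized x t, fun w => ?_⟩
    rw [hV.curvature]
    have h1 : MDifferentiableAt 𝓘(ℝ, ℝ) (𝓡 3) (fun t : ℝ => Circle.exp t • x) t :=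
      (hB.contMDiff_exp_smul x).mdifferentiableAt (by simp)
    have h2 : MDifferentiableAt (𝓡 3) (𝓡 2) proj (Circle.exp t • x) :=
      hB.smooth_proj.mdifferentiableAt (by simp)
    have h3 := congrArg (fun L => L (1 : ℝ)) (mfderiv_comp t h2 h1)
    have h4 : proj ∘ (fun t : ℝ => Circle.exp t • x) = fun _ => proj x :=
      funext fun t => hB.proj_smul _ _
    have h5 : mfderiv (𝓡 3) (𝓡 2) proj (Circle.exp t • x)
        (mfderiv 𝓘(ℝ, ℝ) (𝓡 3) (fun s : ℝ => Circle.exp s • x) t (1 : ℝ)) = 0 := by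
      refine h3.symm.trans ?_
      rw [h4, mfderiv_const]
      rfl
    rw [h5, hom]

/-- A local trivialization provides a differentiable section through `x`, whose derivative is a
right inverse. -/
theorem IsPrincipalBundle.mfderiv_proj_surjective (hB : IsPrincipalBundle proj) (x : V) :
    Function.Surjective (mfderiv (𝓡 3) (𝓡 2) proj x) := by
  obtain ⟨U, e, hU, hb, hs, ht, h1, h2, h3, h4⟩ := hB.locally_trivial (proj x)
  have hx : x ∈ e.source := by rw [hs]; exact hb
  let s : S2 → V := fun y => e.symm (y, (e x).2)
  have hsx : s (proj x) = x := by
    simp only [s]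
    rw [← h3 x hx]
    exact e.left_inv hx
  have htgt : ∀ y ∈ U, (y, (e x).2) ∈ e.target := fun y hy => by rw [ht]; exact ⟨hy, mem_univ _⟩
  have hs' : MDifferentiableAt (𝓡 2) (𝓡 3) s (proj x) := by
    have a1 : ContMDiffAt ((𝓡 2).prod (𝓡 1)) (𝓡 3) ∞ e.symm (proj x, (e x).2) :=
      h2.contMDiffAt (e.open_target.mem_nhds (htgt _ hb))
    have a2 : ContMDiffAt (𝓡 2) ((𝓡 2).prod (𝓡 1)) ∞ (fun y : S2 => (y, (e x).2)) (proj x) :=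
      contMDiffAt_id.prodMk contMDiffAt_const
    exact (a1.comp (proj x) a2).mdifferentiableAt (by simp)
  have hp : MDifferentiableAt (𝓡 3) (𝓡 2) proj (s (proj x)) :=
    hB.smooth_proj.mdifferentiableAt (by simp)
  have hid : (proj ∘ s) =ᶠ[𝓝 (proj x)] id := by
    filter_upwards [hU.mem_nhds hb] with y hy
    simp only [Function.comp_apply, s, id]
    rw [← h3 _ (e.map_target (htgt y hy)), e.right_inv (htgt y hy)]
  intro w
  have h5 := congrArg (fun L : EuclideanSpace ℝ (Fin 2) →L[ℝ] EuclideanSpace ℝ (Fin 2) =>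
    L w) ((mfderiv_comp (proj x) hp hs').symm.trans hid.mfderiv_eq)
  have h6 : (mfderiv (𝓡 2) (𝓡 2) (id : S2 → S2) (proj x) :
      EuclideanSpace ℝ (Fin 2) →L[ℝ] EuclideanSpace ℝ (Fin 2)) w = w := by
    rw [mfderiv_id]; rfl
  have h7 : ∀ x' : V, x' = x → ∀ L : EuclideanSpace ℝ (Fin 2) →L[ℝ] E3,
      (mfderiv (𝓡 3) (𝓡 2) proj x' : E3 →L[ℝ] EuclideanSpace ℝ (Fin 2)) (L w) = w →
      ∃ a, mfderiv (𝓡 3) (𝓡 2) proj x a = w := by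
    rintro x' rfl L hL
    exact ⟨L w, hL⟩
  exact h7 _ hsx _ (h5.trans h6)

theorem range_inclS2 (p : S2) {w : EuclideanSpace ℝ (Fin 3)}
    (hw : inner ℝ (p : EuclideanSpace ℝ (Fin 3)) w = 0) : ∃ v, inclS2 p v = w := by
  have := Fact.mk (@finrank_euclideanSpace_fin ℝ _ (2 + 1))
  have h : (inclS2 p : EuclideanSpace ℝ (Fin 2) →L[ℝ] EuclideanSpace ℝ (Fin 3)).range =
      (Submodule.span ℝ {p.1})ᗮ :=
    range_mvfderiv_subtypeVal (n := 2) p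
  have h2 : w ∈ (Submodule.span ℝ {(p : EuclideanSpace ℝ (Fin 3))})ᗮ :=
    Submodule.mem_orthogonal_singleton_iff_inner_right.mpr hw
  rw [← h] at h2
  exact h2

theorem inner_inclS2 (p : S2) (v : TangentSpace (𝓡 2) p) :
    inner ℝ (p : EuclideanSpace ℝ (Fin 3)) (inclS2 p v) = 0 := by
  have := Fact.mk (@finrank_euclideanSpace_fin ℝ _ (2 + 1))
  have h : (inclS2 p : EuclideanSpace ℝ (Fin 2) →L[ℝ] EuclideanSpace ℝ (Fin 3)).range =
      (Submodule.span ℝ {p.1})ᗮ :=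
    range_mvfderiv_subtypeVal (n := 2) p
  refine Submodule.mem_orthogonal_singleton_iff_inner_right.mp ?_
  rw [← h]
  exact ⟨v, rfl⟩

theorem omega0_nondegenerate {p : S2} {v : TangentSpace (𝓡 2) p} (h : ∀ w, omega0 p v w = 0) :
    inclS2 p v = 0 := by
  set a := inclS2 p v with ha
  have hpa : inner ℝ (p : EuclideanSpace ℝ (Fin 3)) a = 0 := inner_inclS2 p v
  have hp : ‖(p : EuclideanSpace ℝ (Fin 3))‖ ^ 2 = 1 := by
    rw [norm_eq_of_mem_sphere p, one_pow]
  let q : EuclideanSpace ℝ (Fin 3) := p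
  -- The cross product `p × a` is tangent at `p`, and `det (p, a, p × a) = |a|²` since `a` is
  -- orthogonal to the unit vector `p`.
  let b : EuclideanSpace ℝ (Fin 3) := !₂[q 1 * a 2 - q 2 * a 1, q 2 * a 0 - q 0 * a 2,
    q 0 * a 1 - q 1 * a 0]
  have hb : inner ℝ (p : EuclideanSpace ℝ (Fin 3)) b = 0 := by
    simp [PiLp.inner_apply, Fin.sum_univ_three, b, q]
    ring
  obtain ⟨w, hw⟩ := range_inclS2 p hb
  have h1 := h w
  rw [omega0_eq_det3, hw, ← ha, det3_eq] at h1
  rw [EuclideanSpace.norm_sq_eq] at hp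
  simp [PiLp.inner_apply, Fin.sum_univ_three] at hpa hp
  simp [b, q] at h1
  have h2 : a 0 ^ 2 + a 1 ^ 2 + a 2 ^ 2 = 0 := by
    linear_combination h1 - (a 0 ^ 2 + a 1 ^ 2 + a 2 ^ 2) * hp +
      (a 0 * p.1 0 + a 1 * p.1 1 + a 2 * p.1 2) * hpa
  ext i
  fin_cases i
  · simp; nlinarith [sq_nonneg (a 0), sq_nonneg (a 1), sq_nonneg (a 2)]
  · simp; nlinarith [sq_nonneg (a 0), sq_nonneg (a 1), sq_nonneg (a 2)]
  · simp; nlinarith [sq_nonneg (a 0), sq_nonneg (a 1), sq_nonneg (a 2)]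

/-- The Reeb flow is the circle action. -/
theorem reebFlow_eq {k : ℕ} [NeZero k]
    (hV : IsPrequantizationBundle (fun b v w => (k : ℝ) * omega0 b v w) proj lam)
    {φ : ℝ → V → V} (hφ : IsReebFlow lam φ) : φ = fun t x => Circle.exp t • x := by
  have hB := hV.toIsPrincipalBundle
  have hk : (k : ℝ) ≠ 0 := NeZero.ne _
  funext t x
  let c : ℝ → V := fun t => φ t x
  have hc : ∀ t, MDifferentiableAt 𝓘(ℝ, ℝ) (𝓡 3) c t := hφ.mdifferentiableAt x
  have hp : ∀ t, MDifferentiableAt (𝓡 3) (𝓡 2) proj (c t) := fun t =>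
    hB.smooth_proj.mdifferentiableAt (by simp)
  have hpc : ∀ t, MDifferentiableAt 𝓘(ℝ, ℝ) (𝓡 2) (fun t => proj (c t)) t := fun t =>
    (hp t).comp t (hc t)
  -- The velocity annihilates `lam.d`, and the differential of `proj` is onto, so the projected
  -- velocity annihilates `omega0`; by nondegeneracy the curve stays in one fibre.
  have hd : ∀ t, fderiv ℝ (fun t => (proj (c t) : EuclideanSpace ℝ (Fin 3))) t = 0 := by
    intro t
    ext1
    rw [← inclS2_mfderiv (hpc t)]
    have h1 := congrArg (fun L => L (1 : ℝ)) (mfderiv_comp t (hp t) (hc t))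
    refine (congrArg (inclS2 (proj (c t))) h1).trans ?_
    refine omega0_nondegenerate fun w => ?_
    obtain ⟨w', rfl⟩ := hB.mfderiv_proj_surjective (c t) w
    have h2 := (hφ.reeb x t).2 w'
    rw [hV.curvature] at h2
    exact (mul_eq_zero.mp h2).resolve_left hk
  have hcoe : Differentiable ℝ (fun t => (proj (c t) : EuclideanSpace ℝ (Fin 3))) := fun t =>
    ((contMDiff_coe_S2.mdifferentiableAt (by simp)).comp t (hpc t)).differentiableAt
  have hconst : ∀ t, proj (c t) = proj (c 0) := fun t =>
    Subtype.ext (is_const_of_fderiv_eq_zero hcoe hd t 0)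
  have h3 := curve_eq_exp_smul hV hc hconst (fun t => (hφ.reeb x t).1) t
  rw [one_mul] at h3
  simpa [c, hφ.zero] using h3

theorem period_eq_two_pi (hB : IsPrincipalBundle proj) {p : V} {T : ℝ}
    (h : IsSimpleClosedOrbit (fun t x => Circle.exp t • x) p T) : T = 2 * Real.pi := by
  have h1 : Circle.exp T = 1 := hB.eq_one_of_smul_eq h.closed
  by_contra hne
  rcases lt_or_gt_of_ne hne with hlt | hgt
  · obtain ⟨n, hn⟩ := Circle.exp_eq_one.mp h1
    have hT := h.pos
    have hpi := Real.pi_pos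
    rw [hn] at hT hlt
    have h2 : (0 : ℝ) < n := by
      by_contra hcon
      push Not at hcon
      nlinarith
    have h3 : (n : ℝ) < 1 := by
      by_contra hcon
      push Not at hcon
      nlinarith
    have h4 : 0 < n := by exact_mod_cast h2
    have h5 : n < 1 := by exact_mod_cast h3
    omega
  · exact h.simple (2 * Real.pi) ⟨by positivity, hgt⟩ (by simp)

end Curves
end
end Prequantization

namespace Prequantization
open Filter Topology

noncomputable section

/-! ### Inverse function theorem between three-manifolds -/

section InverseFunction

theorem exists_equiv_of_injective {L : E3 →L[ℝ] E3} (hL : Function.Injective L) :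
    ∃ A : E3 ≃L[ℝ] E3, (A : E3 →L[ℝ] E3) = L :=
  ⟨(LinearEquiv.ofInjectiveEndo L.toLinearMap hL).toContinuousLinearEquiv, by ext1 w; rfl⟩

variable {M N : Type*} [TopologicalSpace M] [ChartedSpace E3 M] [IsManifold (𝓡 3) ∞ M]
  [TopologicalSpace N] [ChartedSpace E3 N]

/-- The inverse function theorem for maps between three-manifolds. -/
theorem exists_local_rightInverse {f : M → N} {x : M} (hf : ContMDiffAt (𝓡 3) (𝓡 3) ∞ f x)
    (hinj : Function.Injective (mfderiv (𝓡 3) (𝓡 3) f x)) :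
    ∃ g : N → M, ContMDiffAt (𝓡 3) (𝓡 3) ∞ g (f x) ∧ g (f x) = x ∧
      ∀ᶠ y in 𝓝 (f x), f (g y) = y := by
  let φ := extChartAt (𝓡 3) x
  let ψ := extChartAt (𝓡 3) (f x)
  let F : E3 → E3 := fun u => ψ (f (φ.symm u))
  have hF : ContDiffAt ℝ ∞ F (φ x) := by
    have := (contMDiffAt_iff.mp hf).2
    rw [ModelWithCorners.range_eq_univ, contDiffWithinAt_univ] at this
    exact this
  have hfm : MDifferentiableAt (𝓡 3) (𝓡 3) f x := hf.mdifferentiableAt (by simp)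
  have hF' : fderiv ℝ F (φ x) = (mfderiv (𝓡 3) (𝓡 3) f x : E3 →L[ℝ] E3) := by
    refine Eq.trans ?_ hfm.mfderiv.symm
    simp only [writtenInExtChartAt, ModelWithCorners.range_eq_univ, fderivWithin_univ]
    rfl
  obtain ⟨A, hA'⟩ := exists_equiv_of_injective (L := mfderiv (𝓡 3) (𝓡 3) f x) hinj
  have hA : (A : E3 →L[ℝ] E3) = fderiv ℝ F (φ x) := hA'.trans hF'.symm
  have hd : HasFDerivAt F (A : E3 →L[ℝ] E3) (φ x) := by
    rw [hA]
    exact (hF.differentiableAt (by simp)).hasFDerivAt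
  let G := hF.localInverse hd (by simp)
  have hGx : G (F (φ x)) = φ x := hF.localInverse_apply_image hd (by simp)
  have hFx : F (φ x) = ψ (f x) := by simp [F, φ]
  have hG : ContDiffAt ℝ ∞ G (ψ (f x)) := by
    rw [← hFx]
    exact hF.to_localInverse hd (by simp)
  have hright : ∀ᶠ u in 𝓝 (ψ (f x)), F (G u) = u := by
    rw [← hFx]
    exact (hF.hasStrictFDerivAt' hd (by simp)).eventually_right_inverse
  have hψ : ContMDiffAt (𝓡 3) 𝓘(ℝ, E3) ∞ ψ (f x) := contMDiffAt_extChartAt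
  have hGψ : G (ψ (f x)) = φ x := by rw [← hFx, hGx]
  have hφ : ContMDiffAt 𝓘(ℝ, E3) (𝓡 3) ∞ φ.symm (G (ψ (f x))) := by
    rw [hGψ]
    exact (contMDiffOn_extChartAt_symm x).contMDiffAt (extChartAt_target_mem_nhds x)
  have hg : ContMDiffAt (𝓡 3) (𝓡 3) ∞ (fun y => φ.symm (G (ψ y))) (f x) :=
    ContMDiffAt.comp (f x) hφ (hG.contMDiffAt.comp (f x) hψ)
  have hgx : φ.symm (G (ψ (f x))) = x := by rw [hGψ]; simp [φ]
  refine ⟨fun y => φ.symm (G (ψ y)), hg, hgx, ?_⟩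
  have h1 : ∀ᶠ y in 𝓝 (f x), f (φ.symm (G (ψ y))) ∈ ψ.source := by
    have hc : ContinuousAt (fun y => f (φ.symm (G (ψ y)))) (f x) :=
      ContinuousAt.comp (by rw [hgx]; exact hf.continuousAt) hg.continuousAt
    refine hc.eventually_mem ?_
    rw [hgx]
    exact extChartAt_source_mem_nhds (f x)
  filter_upwards [h1, hψ.continuousAt.eventually hright,
    extChartAt_source_mem_nhds (I := 𝓡 3) (f x)] with y hy1 hy2 hy3
  exact ψ.injOn hy1 hy3 hy2

end InverseFunction

/-! ### The quotient map `S³ → L(k, 1)` in charts -/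

section Lens

variable (k : ℕ)

theorem contMDiff_smul_S3 (z : Circle) : ContMDiff (𝓡 3) (𝓡 3) ∞ (fun x : S3 => z • x) := by
  intro x
  refine contMDiffAt_sphere_of_coe (E := C2) (n := 3) ?_
  have h1 : ContMDiff 𝓘(ℝ, C2) 𝓘(ℝ, C2) ∞ (fun x : C2 => (z : ℂ) • x) :=
    (contDiff_id.const_smul (z : ℂ)).contMDiff
  exact (h1.comp (contMDiff_coe_sphere (E := C2) (n := 3))).contMDiffAt

variable [NeZero k]

theorem isCoveringMap_lensMk : IsCoveringMap (lensMk k) :=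
  isQuotientCoveringMap_quotientMk_of_properlyDiscontinuousSMul.isCoveringMap

omit [NeZero k] in
theorem lensMk_surjective : Function.Surjective (lensMk k) := Quotient.mk_surjective

omit [NeZero k] in
theorem lensMk_eq_iff {x y : S3} :
    lensMk k x = lensMk k y ↔ ∃ z : Circle, z ^ k = 1 ∧ x = z • y := by
  refine (Quotient.eq (r := MulAction.orbitRel (rootsOfUnityCircle k) S3)).trans ?_
  rw [MulAction.orbitRel_apply, MulAction.mem_orbit_iff]
  constructor
  · rintro ⟨z, hz⟩
    exact ⟨z.1, z.2, hz.symm⟩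
  · rintro ⟨z, hz, h⟩
    exact ⟨⟨z, hz⟩, h.symm⟩

/-- The point of `S³` used by the preferred chart at a point of the lens space. -/
def lensSec (y : LensSpace k) : S3 :=
  (Quotient.mk_surjective (s := MulAction.orbitRel (rootsOfUnityCircle k) S3)).hasRightInverse.choose
    y

omit [NeZero k] in
theorem lensMk_lensSec (y : LensSpace k) : lensMk k (lensSec k y) = y :=
  (Quotient.mk_surjective (s := MulAction.orbitRel (rootsOfUnityCircle k)
    S3)).hasRightInverse.choose_spec y

/-- The local inverse of the quotient map used by the preferred chart. -/
def lensInv (y : LensSpace k) : OpenPartialHomeomorph (LensSpace k) S3 :=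
  (isCoveringMap_lensMk k).isLocalHomeomorph.localInverseAt (lensSec k y)

/-- True by definition because `lensSec` makes the same choice of representative as the atlas; this
representative need not be the `Quotient.out` used in `lensForm`. -/
theorem lens_chartAt (y : LensSpace k) :
    chartAt E3 y = (lensInv k y).trans (chartAt E3 (lensSec k y)) := rfl

theorem lensInv_symm (y : LensSpace k) : (lensInv k y).symm = lensMk k :=
  (isCoveringMap_lensMk k).isLocalHomeomorph.localInverseAt_symm _

theorem mem_lensInv_source (y : LensSpace k) : y ∈ (lensInv k y).source := by
  have := (isCoveringMap_lensMk k).isLocalHomeomorph.apply_self_mem_localInverseAt_source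
    (x := lensSec k y)
  rwa [lensMk_lensSec] at this

theorem lensSec_mem_target (y : LensSpace k) : lensSec k y ∈ (lensInv k y).target :=
  (isCoveringMap_lensMk k).isLocalHomeomorph.self_mem_localInverseAt_target

theorem lensInv_self (y : LensSpace k) : lensInv k y y = lensSec k y := by
  have := (lensInv k y).right_inv (lensSec_mem_target k y)
  rwa [lensInv_symm, lensMk_lensSec] at this

theorem lensMk_lensInv {y y' : LensSpace k} (h : y' ∈ (lensInv k y).source) :
    lensMk k (lensInv k y y') = y' := by
  have := (lensInv k y).left_inv h
  rwa [lensInv_symm] at this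

/-- Read in the preferred charts at `y` and at `lensSec k y`, the local inverse is the identity. -/
theorem contMDiffAt_lensInv (y : LensSpace k) :
    ContMDiffAt (𝓡 3) (𝓡 3) ∞ (lensInv k y) y := by
  rw [contMDiffAt_iff]
  refine ⟨(lensInv k y).continuousAt (mem_lensInv_source k y), ?_⟩
  refine ContDiffWithinAt.congr_of_eventuallyEq (f := id) contDiffWithinAt_id ?_ ?_
  · have h1 : ∀ᶠ u in 𝓝 (extChartAt (𝓡 3) y y), u ∈ (extChartAt (𝓡 3) y).target :=
      extChartAt_target_mem_nhds y
    filter_upwards [nhdsWithin_le_nhds h1] with u hu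
    have := (extChartAt (𝓡 3) y).right_inv hu
    rw [lensInv_self]
    exact this
  · have := (extChartAt (𝓡 3) y).right_inv (mem_extChartAt_target y)
    simp only [Function.comp_apply, extChartAt_to_inv, id]
    rw [lensInv_self]
    simp [extChartAt, lens_chartAt, lensInv_self]

/-- The chart at the image of `x` is built on another representative `z • x`, so in that chart the
quotient map is the rotation by `z` followed by a chart of `S³`. -/
theorem contMDiff_lensMk : ContMDiff (𝓡 3) (𝓡 3) ∞ (lensMk k) := by
  intro x
  rw [contMDiffAt_iff_target]
  refine ⟨(isCoveringMap_lensMk k).continuous.continuousAt, ?_⟩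
  set y := lensMk k x with hy
  obtain ⟨z, hz, hzx⟩ := (lensMk_eq_iff k).mp (lensMk_lensSec k y)
  have h1 : ContMDiffAt (𝓡 3) 𝓘(ℝ, E3) ∞ (extChartAt (𝓡 3) (lensSec k y)) (z • x) := by
    rw [← hzx]; exact contMDiffAt_extChartAt
  have h2 := h1.comp x (contMDiff_smul_S3 z).contMDiffAt
  refine h2.congr_of_eventuallyEq ?_
  have h3 : ∀ᶠ x' in 𝓝 x, z • x' ∈ (lensInv k y).target :=
    (contMDiff_smul_S3 z).continuous.continuousAt.eventually_mem
      ((lensInv k y).open_target.mem_nhds (by rw [← hzx]; exact lensSec_mem_target k y))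
  filter_upwards [h3] with x' hx'
  have h4 := (lensInv k y).right_inv hx'
  rw [lensInv_symm] at h4
  have h5 : lensMk k (z • x') = lensMk k x' := (lensMk_eq_iff k).mpr ⟨z, hz, rfl⟩
  rw [h5] at h4
  simp only [Function.comp_apply]
  rw [← h4]
  rfl

end Lens
end
end Prequantization

namespace Prequantization
open Filter Topology

noncomputable section

/-! ### Equivariance, fibres and immersivity of the lift -/

section HopfLift

variable {V : Type*} [TopologicalSpace V] [ChartedSpace E3 V]
  [MulAction Circle V] {proj : V → S2} {lam : OneForm V} {k : ℕ} {P : C2 → V}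

/-- `P` is a smooth lift of the Hopf map to `V` that pulls `lam` back to `k` times the standard
connection form. -/
def IsHopfLift (k : ℕ) (proj : V → S2) (lam : OneForm V) (P : C2 → V) : Prop :=
  ∀ x ≠ 0, IsLift proj lam hopf (fun y => (k : ℝ) • conn y) P x ∧
    ContMDiffAt 𝓘(ℝ, C2) (𝓡 3) ∞ P x

namespace IsHopfLift

variable (hP : IsHopfLift k proj lam P)
include hP

omit [MulAction Circle V] in
theorem proj_eq {x : C2} (hx : x ≠ 0) : proj (P x) = hopf x := (hP x hx).1.proj_eq

omit [MulAction Circle V] in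
theorem mdifferentiableAt {x : C2} (hx : x ≠ 0) : MDifferentiableAt 𝓘(ℝ, C2) (𝓡 3) P x :=
  (hP x hx).1.mdifferentiableAt

omit [MulAction Circle V] in
theorem form_eq {x : C2} (hx : x ≠ 0) (w : C2) :
    lam (P x) (mfderiv 𝓘(ℝ, C2) (𝓡 3) P x w) = k * conn x w :=
  (hP x hx).1.form_eq w

variable (hV : IsPrequantizationBundle (fun b v w => (k : ℝ) * omega0 b v w) proj lam)
include hV

/-- The velocity of a Hopf circle at `x` is `i x`, on which `conn` equals 1; its image therefore
runs through the fibre with constant speed `k`. -/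
theorem exp_smul {x : C2} (hx : x ≠ 0) (t : ℝ) :
    P ((Circle.exp t : ℂ) • x) = Circle.exp (k * t) • P x := by
  let γ : ℝ → C2 := fun t => (Circle.exp t : ℂ) • x
  have hγ0 : ∀ t, γ t ≠ 0 := fun t => circle_smul_ne_zero _ hx
  have hγ : ∀ t, HasFDerivAt γ ((1 : ℝ →L[ℝ] ℝ).smulRight (Complex.I • γ t)) t := by
    intro t
    have h1 : HasDerivAt (fun t : ℝ => Complex.exp (t * Complex.I))
        (Complex.exp (t * Complex.I) * (1 * Complex.I)) t :=
      HasDerivAt.cexp ((Complex.ofRealCLM.hasDerivAt (x := t)).mul_const Complex.I)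
    have h2 := h1.smul_const x
    have h3 : HasDerivAt γ (Complex.I • γ t) t := by
      simp only [γ, Circle.coe_exp]
      refine h2.congr_deriv ?_
      rw [smul_smul, one_mul, mul_comm]
    exact h3.hasFDerivAt
  have hγm : ∀ t, MDifferentiableAt 𝓘(ℝ, ℝ) 𝓘(ℝ, C2) γ t := fun t =>
    (hγ t).differentiableAt.mdifferentiableAt
  have h := curve_eq_exp_smul hV (c := fun t => P (γ t)) (r := k) (b := hopf x)
    (fun t => (hP.mdifferentiableAt (hγ0 t)).comp t (hγm t))
    (fun t => by rw [hP.proj_eq (hγ0 t)]; exact hopf_circle_smul _ hx) ?_ t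
  · simpa [γ] using h
  · intro t
    have h1 := congrArg (fun L => L (1 : ℝ)) (mfderiv_comp t (hP.mdifferentiableAt (hγ0 t)) (hγm t))
    refine (congrArg (lam (P (γ t))) h1).trans ?_
    have h2 : (mfderiv 𝓘(ℝ, ℝ) 𝓘(ℝ, C2) γ t : ℝ →L[ℝ] C2) 1 = Complex.I • γ t := by
      rw [mfderiv_eq_fderiv, (hγ t).fderiv]
      exact one_smul ℝ (Complex.I • γ t)
    refine (congrArg (fun w => lam (P (γ t)) (mfderiv 𝓘(ℝ, C2) (𝓡 3) P (γ t) w)) h2).trans ?_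
    refine (hP.form_eq (hγ0 t) (Complex.I • γ t)).trans ?_
    have h3 : idot (γ t) (Complex.I • γ t) = nsq (γ t) := by
      simp [idot, nsq]; ring
    rw [conn_apply, h3, inv_mul_cancel₀ (nsq_pos (hγ0 t)).ne', mul_one]

theorem circle_smul {x : C2} (hx : x ≠ 0) (z : Circle) : P ((z : ℂ) • x) = z ^ k • P x := by
  have h := hP.exp_smul hV hx (Complex.arg z)
  have h1 : Circle.exp (k * Complex.arg z) = z ^ k := by
    apply Circle.ext
    rw [Circle.coe_pow, Circle.coe_exp]
    conv_rhs => rw [← Circle.exp_arg z, Circle.coe_exp, ← Complex.exp_nat_mul]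
    push_cast
    ring_nf
  rwa [Circle.exp_arg, h1] at h

theorem surjective [NeZero k] (p : V) : ∃ x : S3, P x.1 = p := by
  have hB := hV.toIsPrincipalBundle
  obtain ⟨x, hx⟩ := hopf_surjective (proj p)
  obtain ⟨z, hz⟩ := hB.exists_smul_eq (x := P x.1) (y := p) (by rw [hP.proj_eq x.ne_zero, hx])
  -- Rotating by an angle upstairs rotates by `k` times that angle in `V`, hence the division by
  -- `k`.
  refine ⟨Circle.exp (Complex.arg z / k) • x, ?_⟩
  have h1 : (k : ℝ) * (Complex.arg z / k) = Complex.arg z :=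
    mul_div_cancel₀ _ (NeZero.ne _)
  have h2 := hP.exp_smul hV x.ne_zero (Complex.arg z / k)
  rw [h1, Circle.exp_arg, ← hz] at h2
  exact h2

/-- Equal images lie over the same point of `S²`, so the points differ by some `z`; by equivariance
`z ^ k` fixes a point of `V`, and freeness gives `z ^ k = 1`. -/
theorem eq_iff {x y : S3} : P x.1 = P y.1 ↔ lensMk k x = lensMk k y := by
  have hB := hV.toIsPrincipalBundle
  rw [lensMk_eq_iff]
  constructor
  · intro h
    have h1 := congrArg proj h
    rw [hP.proj_eq x.ne_zero, hP.proj_eq y.ne_zero] at h1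
    obtain ⟨z, hz⟩ := exists_smul_eq_of_hopf_eq h1.symm
    refine ⟨z, ?_, hz⟩
    have h2 : P x.1 = z ^ k • P y.1 := by
      rw [← hP.circle_smul hV y.ne_zero z, hz]
      rfl
    rw [h] at h2
    exact hB.eq_one_of_smul_eq h2.symm
  · rintro ⟨z, hz, rfl⟩
    have := hP.circle_smul hV y.ne_zero z
    rw [hz, one_smul] at this
    exact this

omit [MulAction Circle V] hV in
theorem contMDiff_sphere : ContMDiff (𝓡 3) (𝓡 3) ∞ (fun x : S3 => P x.1) := fun x =>
  (hP x.1 x.ne_zero).2.comp x (contMDiff_coe_sphere (E := C2) (n := 3)).contMDiffAt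

omit [MulAction Circle V] hV in
theorem mfderiv_sphere (x : S3) (w : TangentSpace (𝓡 3) x) :
    mfderiv (𝓡 3) (𝓡 3) (fun x : S3 => P x.1) x w =
      mfderiv 𝓘(ℝ, C2) (𝓡 3) P x.1 (mfderiv (𝓡 3) 𝓘(ℝ, C2) (Subtype.val : S3 → C2) x w) := by
  have h1 : MDifferentiableAt (𝓡 3) 𝓘(ℝ, C2) (Subtype.val : S3 → C2) x :=
    (contMDiff_coe_sphere (E := C2) (n := 3) (m := ∞)).mdifferentiableAt (by simp)
  exact congrArg (fun L => L w) (mfderiv_comp x (hP.mdifferentiableAt x.ne_zero) h1)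

omit [MulAction Circle V] hV in
theorem lam_mfderiv_sphere (x : S3) (w : TangentSpace (𝓡 3) x) :
    lam (P x.1) (mfderiv (𝓡 3) (𝓡 3) (fun x : S3 => P x.1) x w) = k * stdForm x w := by
  rw [hP.mfderiv_sphere]
  refine (hP.form_eq x.ne_zero _).trans ?_
  simp only [conn, nsq_S3, inv_one, one_smul]
  rfl

theorem inclS2_mfderiv_proj {x : C2} (hx : x ≠ 0) (w : C2) :
    inclS2 (proj (P x)) (mfderiv (𝓡 3) (𝓡 2) proj (P x) (mfderiv 𝓘(ℝ, C2) (𝓡 3) P x w)) =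
      fderiv ℝ hopfVec x w := by
  have hp : MDifferentiableAt (𝓡 3) (𝓡 2) proj (P x) :=
    hV.toIsPrincipalBundle.smooth_proj.mdifferentiableAt (by simp)
  have h1 := congrArg (fun L => L w) (mfderiv_comp x hp (hP.mdifferentiableAt hx))
  refine (congrArg (inclS2 (proj (P x))) h1.symm).trans ?_
  have h2 := inclS2_mfderiv (hp.comp x (hP.mdifferentiableAt hx)) w
  refine h2.trans ?_
  have h3 : (fun y => ((proj ∘ P) y : EuclideanSpace ℝ (Fin 3))) =ᶠ[𝓝 x] hopfVec := by
    filter_upwards [isOpen_compl_singleton.mem_nhds hx] with y hy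
    rw [Function.comp_apply, hP.proj_eq hy, coe_hopf hy]
  rw [h3.fderiv_eq]

/-- A kernel vector `u` is orthogonal to `i x` because `lam` vanishes on its image, orthogonal to
`x` because it is tangent to `S³`, and killed by the derivative of the Hopf map. The curvature
identity on the pair `(u, i u)` then reads `0 = 2 |u|²`. -/
theorem mfderiv_sphere_injective [NeZero k] (x : S3) :
    Function.Injective (mfderiv (𝓡 3) (𝓡 3) (fun x : S3 => P x.1) x) := by
  rw [injective_iff_map_eq_zero]
  intro w hw
  set u : C2 := mfderiv (𝓡 3) 𝓘(ℝ, C2) (Subtype.val : S3 → C2) x w with hu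
  have hk : (k : ℝ) ≠ 0 := NeZero.ne _
  have hx := x.ne_zero
  have h0 : mfderiv 𝓘(ℝ, C2) (𝓡 3) P x.1 u = 0 := (hP.mfderiv_sphere x w).symm.trans hw
  have h1 : idot x.1 u = 0 := by
    have h2 := hP.form_eq hx u
    rw [h0] at h2
    have h3 := (mul_eq_zero.mp (h2.symm.trans (map_zero _))).resolve_left hk
    rw [conn_apply, nsq_S3] at h3
    simpa using h3
  have h2 : fderiv ℝ hopfVec x.1 u = 0 := by
    have h3 := hP.inclS2_mfderiv_proj hV hx u
    rw [h0] at h3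
    refine h3.symm.trans ?_
    have h4 : mfderiv (𝓡 3) (𝓡 2) proj (P x.1) 0 = 0 := map_zero _
    exact (congrArg (inclS2 (proj (P x.1))) h4).trans (map_zero _)
  have h3 : rdot x.1 u = 0 := by
    have h := range_mvfderiv_subtypeVal (E := C2) (n := 3) x
    rw [← inner_eq_rdot]
    refine Submodule.mem_orthogonal_singleton_iff_inner_right.mp ?_
    rw [← h]
    exact ⟨w, rfl⟩
  have h4 := det3_fderiv_hopfVec hx u (Complex.I • u)
  rw [fderiv_conn hx, fderiv_conn hx, h2, h1, h3, nsq_S3] at h4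
  have h5 : idot u (Complex.I • u) = nsq u := by simp [idot, nsq]; ring
  have h6 : idot (Complex.I • u) u = - nsq u := by simp [idot, nsq]; ring
  rw [h5, h6, det3_eq] at h4
  simp at h4
  have h7 : u = 0 := by
    by_contra hne
    have := nsq_pos hne
    linarith
  have h8 := injective_mvfderiv_subtypeVal_sphere (E := C2) (n := 3) x
  refine h8 ?_
  rw [map_zero]
  exact h7

end IsHopfLift
end HopfLift
end
end Prequantization

namespace Prequantization
open Filter Topology

noncomputable section

/-! ### The contactomorphism with the lens space -/

section Contactomorphism

variable {V : Type*} [TopologicalSpace V] [ChartedSpace E3 V]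
  [MulAction Circle V] {proj : V → S2} {lam : OneForm V} {k : ℕ} [NeZero k] {P : C2 → V}

/-- The map from the lens space induced by a map on the sphere. -/
def ofLens {V : Type*} (k : ℕ) [NeZero k] (P : C2 → V) (y : LensSpace k) : V := P (lensSec k y).1

namespace IsHopfLift

variable (hP : IsHopfLift k proj lam P)
  (hV : IsPrequantizationBundle (fun b v w => (k : ℝ) * omega0 b v w) proj lam)

include hP hV

theorem ofLens_lensMk (x : S3) : (ofLens k P) (lensMk k x) = P x.1 :=
  (hP.eq_iff hV).mpr (lensMk_lensSec k _)

theorem contMDiff_ofLens : ContMDiff (𝓡 3) (𝓡 3) ∞ (ofLens k P) := by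
  intro y
  have h1 := (hP.contMDiff_sphere.contMDiffAt (x := lensInv k y y)).comp y (contMDiffAt_lensInv k y)
  refine h1.congr_of_eventuallyEq ?_
  filter_upwards [(lensInv k y).open_source.mem_nhds (mem_lensInv_source k y)] with y' hy'
  have h2 := hP.ofLens_lensMk hV (lensInv k y y')
  rwa [lensMk_lensInv k hy'] at h2

theorem mfderiv_lensMk_injective (x : S3) :
    Function.Injective (mfderiv (𝓡 3) (𝓡 3) (lensMk k) x) := by
  have h1 : MDifferentiableAt (𝓡 3) (𝓡 3) (ofLens k P) (lensMk k x) :=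
    (hP.contMDiff_ofLens hV).mdifferentiableAt (by simp)
  have h2 : MDifferentiableAt (𝓡 3) (𝓡 3) (lensMk k) x :=
    (contMDiff_lensMk k).mdifferentiableAt (by simp)
  have h3 : (ofLens k P) ∘ lensMk k = fun x : S3 => P x.1 := funext (hP.ofLens_lensMk hV)
  have h4 := mfderiv_comp x h1 h2
  intro v w hvw
  have h5 : mfderiv (𝓡 3) (𝓡 3) ((ofLens k P) ∘ lensMk k) x v =
      mfderiv (𝓡 3) (𝓡 3) ((ofLens k P) ∘ lensMk k) x w := by
    have h6 := congrArg (fun L => L v) h4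
    have h7 := congrArg (fun L => L w) h4
    exact h6.trans ((congrArg (mfderiv (𝓡 3) (𝓡 3) (ofLens k P) (lensMk k x)) hvw).trans h7.symm)
  rw [h3] at h5
  exact hP.mfderiv_sphere_injective hV x h5

/-- Injectivity makes the differential of `lensMk` invertible, so `ContinuousLinearMap.inverse` in
`lensForm` is the true inverse and not its default value zero. -/
theorem lensForm_apply (y : LensSpace k) (w : TangentSpace (𝓡 3) (Quotient.out y)) :
    lensForm k y (mfderiv (𝓡 3) (𝓡 3) (lensMk k) (Quotient.out y) w : E3) =
      stdForm (Quotient.out y) w := by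
  obtain ⟨A, hA⟩ := exists_equiv_of_injective
    (L := mfderiv (𝓡 3) (𝓡 3) (lensMk k) (Quotient.out y))
    (hP.mfderiv_lensMk_injective hV (Quotient.out y))
  have h1 : ∀ L : E3 →L[ℝ] E3, (A : E3 →L[ℝ] E3) = L → ∀ w, L.inverse (L w) = w := by
    rintro _ rfl w
    rw [ContinuousLinearMap.inverse_equiv]
    exact A.symm_apply_apply w
  exact congrArg (stdForm (Quotient.out y)) (h1 _ hA w)

/-- A prequantization bundle over the sphere with Euler number `-k` is contactomorphic to a lens
space. -/
theorem exists_contactomorphism : ∃ Φ : V ≃ₘ^∞⟮𝓡 3, 𝓡 3⟯ LensSpace k,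
    IsContactomorphism lam (lensForm k) Φ ∧ ∀ x : S3, Φ (P x.1) = lensMk k x := by
  -- The preimages are chosen without continuity; by `eq_iff` the class of `σ v` does not depend on
  -- the choice, and smoothness comes from local smooth right inverses of `P`.
  choose σ hσ using hP.surjective hV
  let Ψ : V → LensSpace k := fun v => lensMk k (σ v)
  have hΨ : ∀ x : S3, Ψ (P x.1) = lensMk k x := fun x => (hP.eq_iff hV).mp (hσ _)
  have hΨs : ContMDiff (𝓡 3) (𝓡 3) ∞ Ψ := by
    intro v
    obtain ⟨x, rfl⟩ := hP.surjective hV v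
    obtain ⟨g, hg, hgx, hgP⟩ := exists_local_rightInverse (hP.contMDiff_sphere.contMDiffAt (x := x))
      (hP.mfderiv_sphere_injective hV x)
    have h1 := (contMDiff_lensMk k).contMDiffAt.comp _ hg
    refine h1.congr_of_eventuallyEq ?_
    filter_upwards [hgP] with v hv
    rw [Function.comp_apply, ← hΨ, hv]
  let Φ : V ≃ₘ^∞⟮𝓡 3, 𝓡 3⟯ LensSpace k :=
    { toFun := Ψ
      invFun := (ofLens k P)
      left_inv := fun v => by
        rw [← hσ v, hΨ, hP.ofLens_lensMk hV]
      right_inv := fun y => by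
        obtain ⟨x, rfl⟩ := lensMk_surjective k y
        rw [hP.ofLens_lensMk hV, hΨ]
      contMDiff_toFun := hΨs
      contMDiff_invFun := hP.contMDiff_ofLens hV }
  -- On `S³` the form `lam` pulls back to `k` times the standard form, so the conformal factor is
  -- the constant `1 / k`.
  refine ⟨Φ, ⟨fun _ => (k : ℝ)⁻¹, contMDiff_const, fun _ => ?_, fun v u => ?_⟩, hΨ⟩
  · exact inv_pos.mpr (Nat.cast_pos.mpr (NeZero.pos k))
  · have hk : (k : ℝ) ≠ 0 := NeZero.ne _
    change lensForm k (Ψ v) (mfderiv (𝓡 3) (𝓡 3) Ψ v u) = _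
    set q : S3 := Quotient.out (Ψ v) with hq
    have hqv : P q.1 = v := by
      have h1 : lensMk k q = Ψ v := Quotient.out_eq _
      rw [← hP.ofLens_lensMk hV, h1]
      exact Φ.left_inv v
    obtain ⟨A, hA⟩ := exists_equiv_of_injective
      (L := mfderiv (𝓡 3) (𝓡 3) (fun x : S3 => P x.1) q) (hP.mfderiv_sphere_injective hV q)
    obtain ⟨w, hw⟩ := A.surjective (u : E3)
    have hAw : (mfderiv (𝓡 3) (𝓡 3) (fun x : S3 => P x.1) q w : E3) = u := by
      rw [← hw]
      exact (congrArg (fun L : E3 →L[ℝ] E3 => L w) hA).symm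
    have h1 : MDifferentiableAt (𝓡 3) (𝓡 3) Ψ (P q.1) := hΨs.mdifferentiableAt (by simp)
    have h2 : MDifferentiableAt (𝓡 3) (𝓡 3) (fun x : S3 => P x.1) q :=
      hP.contMDiff_sphere.mdifferentiableAt (by simp)
    have h3 : Ψ ∘ (fun x : S3 => P x.1) = lensMk k := funext hΨ
    have h4 := mfderiv_comp q h1 h2
    rw [h3] at h4
    have h5 := congrArg (fun L : E3 →L[ℝ] E3 => L w) h4
    have h6 : ∀ v' : V, v' = v →
        (mfderiv (𝓡 3) (𝓡 3) Ψ v' : E3 →L[ℝ] E3) = mfderiv (𝓡 3) (𝓡 3) Ψ v := by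
      rintro v' rfl; rfl
    have h7 : (mfderiv (𝓡 3) (𝓡 3) (lensMk k) q : E3 →L[ℝ] E3) w =
        (mfderiv (𝓡 3) (𝓡 3) Ψ v : E3 →L[ℝ] E3) u := by
      refine h5.trans ?_
      refine Eq.trans (congrArg (mfderiv (𝓡 3) (𝓡 3) Ψ (P q.1) : E3 →L[ℝ] E3) hAw) ?_
      exact congrArg (fun L : E3 →L[ℝ] E3 => L u) (h6 _ hqv)
    have h8 := hP.lensForm_apply hV (Ψ v) w
    have h9 := hP.lam_mfderiv_sphere q w
    have h10 : lam (P q.1) (mfderiv (𝓡 3) (𝓡 3) (fun x : S3 => P x.1) q w) = lam v u :=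
      lam.apply_congr hqv hAw
    have h11 : lensForm k (Ψ v) (mfderiv (𝓡 3) (𝓡 3) Ψ v u) = stdForm q w :=
      (congrArg (lensForm k (Ψ v)) h7.symm).trans h8
    rw [h11, ← h10, h9]
    field_simp

end IsHopfLift
end Contactomorphism
end
end Prequantization

namespace Prequantization
open Filter Topology

noncomputable section

/-! ### The quaternionic frame and a disk bounded by a Hopf circle -/

section HopfFrame

/-- Multiplication by the quaternion `j` on `ℂ²`. -/
def quatJ (x : C2) : C2 := !₂[-(starRingEnd ℂ) (x 1), (starRingEnd ℂ) (x 0)]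

theorem continuous_quatJ : Continuous quatJ := by
  have h (i : Fin 2) : Continuous fun x : C2 => x i := (contDiff_coord i).continuous
  refine (PiLp.continuous_toLp 2 _).comp (continuous_pi fun i => ?_)
  fin_cases i
  · exact (Complex.continuous_conj.comp (h 1)).neg
  · exact Complex.continuous_conj.comp (h 0)

/-- A frame of the orthogonal complement of the complex line spanned by `x`. -/
def hopfFrame (i : Fin 2) (x : C2) : C2 := ![quatJ x, Complex.I • quatJ x] i

theorem continuous_hopfFrame (i : Fin 2) : Continuous (hopfFrame i) := by
  fin_cases i
  · exact continuous_quatJ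
  · exact continuous_quatJ.const_smul Complex.I

theorem rdot_hopfFrame (i : Fin 2) (x : C2) : rdot x (hopfFrame i x) = 0 := by
  fin_cases i <;> simp [rdot, hopfFrame, quatJ] <;> ring

theorem idot_hopfFrame (i : Fin 2) (x : C2) : idot x (hopfFrame i x) = 0 := by
  fin_cases i <;> simp [idot, hopfFrame, quatJ] <;> ring

theorem idot_hopfFrame_hopfFrame (x : C2) : idot (hopfFrame 0 x) (hopfFrame 1 x) = nsq x := by
  simp [idot, nsq, hopfFrame, quatJ]; ring

theorem nsq_smul_add_smul_quatJ (x : C2) (z : ℂ) (r : ℝ) :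
    nsq (z • x + r • quatJ x) = (Complex.normSq z + r ^ 2) * nsq x := by
  simp [nsq, quatJ, Complex.normSq_apply]; ring

/-- A disk in `S³` that is bounded by the Hopf circle through `y`. -/
def hopfDisk (y : S3) (z : ℂ) : C2 := z • y.1 + Real.sqrt (1 - ‖z‖ ^ 2) • quatJ y.1

theorem continuous_hopfDisk (y : S3) : Continuous (hopfDisk y) := by
  unfold hopfDisk; fun_prop

theorem nsq_hopfDisk (y : S3) {z : ℂ} (hz : ‖z‖ ≤ 1) : nsq (hopfDisk y z) = 1 := by
  have h : 0 ≤ 1 - ‖z‖ ^ 2 := by nlinarith [norm_nonneg z]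
  rw [hopfDisk, nsq_smul_add_smul_quatJ, nsq_S3, Real.sq_sqrt h, Complex.normSq_eq_norm_sq]
  ring

/-- This holds on the whole plane: outside the unit disk `Real.sqrt` returns 0 and the value is `z •
y`. So `P ∘ hopfDisk y` is defined and continuous on a contractible space. -/
theorem hopfDisk_ne_zero (y : S3) (z : ℂ) : hopfDisk y z ≠ 0 := by
  intro h
  have h1 := nsq_smul_add_smul_quatJ y.1 z (Real.sqrt (1 - ‖z‖ ^ 2))
  have h2 : nsq (0 : C2) = 0 := by simp [nsq]
  rw [show z • y.1 + Real.sqrt (1 - ‖z‖ ^ 2) • quatJ y.1 = 0 from h, h2, nsq_S3, mul_one,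
    Complex.normSq_eq_norm_sq] at h1
  have h3 : ‖z‖ ^ 2 = 0 := by nlinarith [sq_nonneg ‖z‖, sq_nonneg (Real.sqrt (1 - ‖z‖ ^ 2))]
  rw [h3] at h1
  simp at h1

theorem hopfDisk_circle (y : S3) (z : Circle) : hopfDisk y z = (z : ℂ) • y.1 := by
  simp [hopfDisk, Circle.norm_coe]

end HopfFrame

theorem bdry_eq_circleExp (k : ℕ) [NeZero k] (t : ℝ) :
    bdry (k * (2 * Real.pi)) t = Circle.exp (t / k) := by
  have hk : (k : ℝ) ≠ 0 := NeZero.ne _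
  rw [bdry, Circle.coe_exp]
  congr 3
  field_simp

/-! ### Contractibility of the `k`-fold orbit and existence of a capping frame -/

section Capping

variable {V : Type*} [TopologicalSpace V] [ChartedSpace E3 V]
  [MulAction Circle V] {proj : V → S2} {lam : OneForm V} {k : ℕ} {P : C2 → V}

namespace IsHopfLift

variable (hP : IsHopfLift k proj lam P)
include hP

omit [MulAction Circle V] in
theorem continuous_comp {X : Type*} [TopologicalSpace X] {g : X → C2} (hg : Continuous g)
    (h0 : ∀ z, g z ≠ 0) : Continuous fun z => P (g z) :=
  continuous_iff_continuousAt.mpr fun z =>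
    ContinuousAt.comp (hP _ (h0 z)).2.continuousAt hg.continuousAt

omit [MulAction Circle V] in
theorem continuous_mfderiv_comp [IsManifold (𝓡 3) ∞ V] {X : Type*} [TopologicalSpace X]
    {g w : X → C2} (hg : Continuous g) (h0 : ∀ z, g z ≠ 0) (hw : Continuous w) :
    Continuous fun z => (⟨P (g z), mfderiv 𝓘(ℝ, C2) (𝓡 3) P (g z) (w z)⟩ :
      TangentBundle (𝓡 3) V) := by
  have := IsManifold.of_le (M := V) (I := 𝓡 3) (m := 1) (n := ∞) (by simp)
  have ho : IsOpen ({0}ᶜ : Set C2) := isOpen_compl_singleton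
  have h1 : ContMDiffOn 𝓘(ℝ, C2) (𝓡 3) ∞ P {0}ᶜ := fun x hx => (hP x hx).2.contMDiffWithinAt
  have h2 := h1.continuousOn_tangentMapWithin (by simp) ho.uniqueMDiffOn
  have h3 : Continuous fun z => (⟨g z, w z⟩ : TangentBundle 𝓘(ℝ, C2) C2) :=
    (tangentBundleModelSpaceHomeomorph 𝓘(ℝ, C2)).symm.continuous.comp (hg.prodMk hw)
  have h4 := h2.comp_continuous h3 h0
  refine h4.congr fun z => ?_
  exact congrArg (fun L : C2 →L[ℝ] E3 => (⟨P (g z), L (w z)⟩ : TangentBundle (𝓡 3) V))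
    (mfderivWithin_of_isOpen (I := 𝓘(ℝ, C2)) (I' := 𝓡 3) (f := P) ho (h0 z))

variable (hV : IsPrequantizationBundle (fun b v w => (k : ℝ) * omega0 b v w) proj lam)
include hV

theorem d_mfderiv {x : C2} (hx : x ≠ 0) (v w : C2) :
    lam.d (P x) (mfderiv 𝓘(ℝ, C2) (𝓡 3) P x v) (mfderiv 𝓘(ℝ, C2) (𝓡 3) P x w) =
      k * ((1 / 2 : ℝ) * det3 (hopfVec x) (fderiv ℝ hopfVec x v) (fderiv ℝ hopfVec x w)) := by
  rw [hV.curvature, omega0_eq_det3, hP.inclS2_mfderiv_proj hV hx, hP.inclS2_mfderiv_proj hV hx,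
    hP.proj_eq hx, coe_hopf hx]

theorem nullhomotopic_circle_smul (y : S3) : ∃ c : C(Circle, V),
    (∀ θ : ℝ, c (Circle.exp θ) = Circle.exp (k * θ) • P y.1) ∧ c.Nullhomotopic := by
  let U : C(ℂ, V) := ⟨fun z => P (hopfDisk y z),
    hP.continuous_comp (continuous_hopfDisk y) (hopfDisk_ne_zero y)⟩
  let i : C(Circle, ℂ) := ⟨fun z => z, continuous_subtype_val⟩
  refine ⟨U.comp i, fun θ => ?_, ?_⟩
  · rw [← hP.exp_smul hV y.ne_zero, ← hopfDisk_circle]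
    rfl
  · have h := ((id_nullhomotopic ℂ).comp_left i).comp_right U
    simpa using h

/-- The disk is the image under `P` of `hopfDisk`, and the frame is the pushforward of a multiple of
`jx, ijx`, which spans the contact planes of `S³`. -/
theorem exists_isCappingFrame [IsManifold (𝓡 3) ∞ V] [NeZero k] (y : S3) :
    ∃ (u : ℂ → V) (e : Fin 2 → (z : ℂ) → TangentSpace (𝓡 3) (u z)),
      IsCappingFrame lam (fun t x => Circle.exp t • x) (P y.1) (k * (2 * Real.pi)) u e := by
  have hk : 0 < (k : ℝ) := Nat.cast_pos.mpr (NeZero.pos k)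
  -- At unit vectors `k • conn` has derivative `2k` on the pair `jx, ijx`, so scaling both by `1 /
  -- √(2k)` makes the frame symplectic.
  set c : ℝ := (Real.sqrt (2 * k))⁻¹ with hc
  have hc2 : c * c * (2 * k) = 1 := by
    rw [hc, ← mul_inv, Real.mul_self_sqrt (by positivity)]
    exact inv_mul_cancel₀ (by positivity)
  let x := hopfDisk y
  have hx0 : ∀ z, x z ≠ 0 := hopfDisk_ne_zero y
  have hx : Continuous x := continuous_hopfDisk y
  refine ⟨fun z => P (x z), fun i z =>
    mfderiv 𝓘(ℝ, C2) (𝓡 3) P (x z) (c • hopfFrame i (x z)), ?_, ?_, ?_, ?_, ?_⟩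
  · exact (hP.continuous_comp hx hx0).continuousOn
  · intro t
    have h := hP.exp_smul hV y.ne_zero (t / k)
    rw [mul_div_cancel₀ _ hk.ne'] at h
    rw [← h, bdry_eq_circleExp]
    exact congrArg P (hopfDisk_circle y _)
  · intro i
    exact (hP.continuous_mfderiv_comp hx hx0
      (((continuous_hopfFrame i).comp hx).const_smul c)).continuousOn
  · intro i z hz
    refine (hP.form_eq (hx0 z) _).trans ?_
    rw [map_smul, conn_apply, idot_hopfFrame]
    simp
  · intro z hz
    have hn : nsq (x z) = 1 := nsq_hopfDisk y (by simpa using hz)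
    refine (hP.d_mfderiv hV (hx0 z) _ _).trans ?_
    rw [det3_fderiv_hopfVec (hx0 z)]
    simp only [map_smul, smul_apply, fderiv_conn (hx0 z), rdot_hopfFrame, idot_hopfFrame, hn]
    have h1 := idot_hopfFrame_hopfFrame (x z)
    have h2 : idot (hopfFrame 1 (x z)) (hopfFrame 0 (x z)) = - nsq (x z) := by
      rw [← h1]; simp only [idot]; ring
    rw [h1, h2, hn]
    simp only [smul_eq_mul]
    linear_combination hc2

end IsHopfLift
end Capping
end
end Prequantization

namespace Prequantization
open Filter Topology

noncomputable section

/-! ### Robbin–Salamon index of a double rotation -/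

section Index

theorem stdSymp_apply (v w : Fin 2 → ℝ) : stdSymp v w = v 0 * w 1 - v 1 * w 0 := by
  simp [stdSymp, Matrix.toBilin'_apply, Fin.sum_univ_two]; ring

theorem isSymplectic_of_det_eq_one {A : Mat2} (h : A.det = 1) : IsSymplectic A := by
  intro v w
  rw [Matrix.det_fin_two] at h
  simp only [stdSymp_apply, Matrix.mulVec, dotProduct, Fin.sum_univ_two]
  linear_combination (v 0 * w 1 - v 1 * w 0) * h

theorem sigPos_eq_finrank_of_posDef {M : Type*} [AddCommGroup M] [Module ℝ M]
    [FiniteDimensional ℝ M] {Q : QuadraticForm ℝ M} (hQ : Q.PosDef) :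
    sigPos Q = Module.finrank ℝ M ∧ sigNeg Q = 0 := by
  have h1 : Module.finrank ℝ (⊤ : Submodule ℝ M) ≤ sigPos Q :=
    le_sigPos_of_posDef Q fun v hv => hQ v.1 fun h => hv (Subtype.ext h)
  rw [finrank_top] at h1
  have h2 := QuadraticForm.sigPos_add_sigNeg_add_radical (Q := Q)
  omega

theorem separatingLeft_polarBilin_of_posDef {M : Type*} [AddCommGroup M] [Module ℝ M]
    {Q : QuadraticForm ℝ M} (hQ : Q.PosDef) : Q.polarBilin.SeparatingLeft := by
  intro v hv
  by_contra hne
  have h1 := hv v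
  rw [QuadraticMap.polarBilin_apply_apply, QuadraticMap.polar_self] at h1
  have := hQ v hne
  simp at h1
  linarith

/-- The path `t ↦ exp (4 π t N / S)`, for a complex structure `N` of the plane. -/
def rotationPath (N : Mat2) (S t : ℝ) : Mat2 :=
  Real.cos (4 * Real.pi * t / S) • (1 : Mat2) + Real.sin (4 * Real.pi * t / S) • N

variable {a b c S : ℝ} (hc : 0 < c) (hN : a ^ 2 + b * c = -1) (hS : 0 < S)

include hN in
theorem det_rotationPath (t : ℝ) : (rotationPath !![a, b; c, -a] S t).det = 1 := by
  have := Real.cos_sq_add_sin_sq (4 * Real.pi * t / S)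
  simp [rotationPath, Matrix.det_fin_two]
  linear_combination this - Real.sin (4 * Real.pi * t / S) ^ 2 * hN

include hN in
-- The assumption `hN` says that the matrix squares to `-1`. A crossing thus occurs only where the
-- cosine is 1, and there the path passes through the identity with full kernel.
theorem det_rotationPath_sub_one (t : ℝ) : (rotationPath !![a, b; c, -a] S t - 1).det =
    2 - 2 * Real.cos (4 * Real.pi * t / S) := by
  have := Real.cos_sq_add_sin_sq (4 * Real.pi * t / S)
  simp [rotationPath, Matrix.det_fin_two]
  linear_combination this - Real.sin (4 * Real.pi * t / S) ^ 2 * hN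

theorem contDiff_rotationPath (N : Mat2) (i j : Fin 2) :
    ContDiff ℝ 1 (fun t => rotationPath N S t i j) := by
  simp only [rotationPath, Matrix.add_apply, Matrix.smul_apply, smul_eq_mul]
  fun_prop

include hS in
theorem velocity_rotationPath (N : Mat2) {t : ℝ} (ht : t ∈ Icc 0 S)
    (h : Real.cos (4 * Real.pi * t / S) = 1) :
    velocity (rotationPath N S) S t = (4 * Real.pi / S) • N := by
  have hs : Real.sin (4 * Real.pi * t / S) = 0 := by
    have := Real.cos_sq_add_sin_sq (4 * Real.pi * t / S)
    rw [h] at this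
    nlinarith
  ext i j
  have h0 : HasDerivAt (fun t : ℝ => 4 * Real.pi * t / S) (4 * Real.pi / S) t :=
    (((hasDerivAt_id t).const_mul (4 * Real.pi)).div_const S).congr_deriv (by simp)
  have h1 := (h0.cos.mul_const ((1 : Mat2) i j)).add (h0.sin.mul_const (N i j))
  rw [h, hs] at h1
  have h2 : HasDerivAt (fun s => rotationPath N S s i j) ((4 * Real.pi / S) * N i j) t :=
    h1.congr_deriv (by ring)
  exact h2.hasDerivWithinAt.derivWithin (uniqueDiffOn_Icc hS t ht)

include hN in
theorem cos_eq_one_of_mem_crossingSpace {t : ℝ} {v : Fin 2 → ℝ}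
    (hv : v ∈ crossingSpace (rotationPath !![a, b; c, -a] S) t) (h0 : v ≠ 0) :
    Real.cos (4 * Real.pi * t / S) = 1 := by
  by_contra hne
  refine h0 (Matrix.eq_zero_of_mulVec_eq_zero ?_ (LinearMap.mem_ker.mp hv))
  rw [det_rotationPath_sub_one hN]
  intro h
  exact hne (by linarith)

include hc hN hS in
theorem posDef_crossingForm_rotationPath {t : ℝ} (ht : t ∈ Icc 0 S) :
    (crossingForm (rotationPath !![a, b; c, -a] S) S t).PosDef := by
  rintro ⟨v, hv⟩ hne
  have h0 : v ≠ 0 := fun h => hne (Subtype.ext h)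
  have h1 := cos_eq_one_of_mem_crossingSpace hN hv h0
  change 0 < stdSymp v ((velocity (rotationPath !![a, b; c, -a] S) S t).mulVec v)
  rw [velocity_rotationPath hS _ ht h1, stdSymp_apply]
  have h2 : 0 < 4 * Real.pi / S := by positivity
  have h3 : 0 < c * v 0 ^ 2 - 2 * a * (v 0 * v 1) - b * v 1 ^ 2 := by
    -- Completing the square with `a² + bc = -1`: the sign of `c` decides the definiteness of the
    -- crossing form.
    have h4 : c * (c * v 0 ^ 2 - 2 * a * (v 0 * v 1) - b * v 1 ^ 2) =
        (c * v 0 - a * v 1) ^ 2 + v 1 ^ 2 := by linear_combination (-v 1 ^ 2) * hN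
    refine pos_of_mul_pos_right (a := c) ?_ hc.le
    rw [h4]
    by_cases hv1 : v 1 = 0
    · have hv0 : v 0 ≠ 0 := by
        intro hv0
        exact h0 (funext fun i => by fin_cases i <;> assumption)
      rw [hv1]
      have : 0 < (c * v 0) ^ 2 := by positivity
      simpa using this
    · have : 0 < v 1 ^ 2 := by positivity
      nlinarith [sq_nonneg (c * v 0 - a * v 1)]
  have h5 := mul_pos h2 h3
  simp [Matrix.mulVec, dotProduct, Fin.sum_univ_two]
  linarith

include hc hN hS in
theorem isRegularPath_rotationPath : IsRegularPath (rotationPath !![a, b; c, -a] S) S where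
  contDiffOn i j := (contDiff_rotationPath _ i j).contDiffOn
  symplectic t _ := isSymplectic_of_det_eq_one (det_rotationPath hN t)
  start := by simp [rotationPath]
  regular t ht :=
    separatingLeft_polarBilin_of_posDef (posDef_crossingForm_rotationPath hc hN hS ht)

include hc hN hS in
theorem crossingSign_rotationPath {t : ℝ} (ht : t ∈ Icc 0 S) :
    crossingSign (rotationPath !![a, b; c, -a] S) S t =
      if Real.cos (4 * Real.pi * t / S) = 1 then 2 else 0 := by
  obtain ⟨h1, h2⟩ := sigPos_eq_finrank_of_posDef (posDef_crossingForm_rotationPath hc hN hS ht)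
  rw [crossingSign, h1, h2]
  split_ifs with h
  · have hs : Real.sin (4 * Real.pi * t / S) = 0 := by
      have := Real.cos_sq_add_sin_sq (4 * Real.pi * t / S)
      rw [h] at this
      nlinarith
    have : crossingSpace (rotationPath !![a, b; c, -a] S) t = ⊤ := by
      simp [crossingSpace, rotationPath, h, hs]
    rw [this, finrank_top]
    simp
  · have : crossingSpace (rotationPath !![a, b; c, -a] S) t = ⊥ := by
      refine (Submodule.eq_bot_iff _).mpr fun v hv => ?_
      by_contra h0
      exact h (cos_eq_one_of_mem_crossingSpace hN hv h0)
    rw [this, finrank_bot]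
    simp

include hc hN hS in
theorem regularIndex_rotationPath : regularIndex (rotationPath !![a, b; c, -a] S) S = 4 := by
  have hπ := Real.pi_pos
  have h0 : crossingSign (rotationPath !![a, b; c, -a] S) S 0 = 2 := by
    rw [crossingSign_rotationPath hc hN hS ⟨le_rfl, hS.le⟩]
    simp
  have h1 : crossingSign (rotationPath !![a, b; c, -a] S) S S = 2 := by
    rw [crossingSign_rotationPath hc hN hS ⟨hS.le, le_rfl⟩, if_pos]
    rw [mul_div_assoc, div_self hS.ne', Real.cos_eq_one_iff]
    exact ⟨2, by push_cast; ring⟩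
  -- The angle `4πt/S` is a multiple of `2π` in the open interval only at the midpoint.
  have h2 : ∑ᶠ t ∈ Ioo 0 S, crossingSign (rotationPath !![a, b; c, -a] S) S t = 2 := by
    rw [finsum_eq_single _ (S / 2)]
    · have hm : S / 2 ∈ Ioo 0 S := ⟨by linarith, by linarith⟩
      rw [finsum_eq_if, if_pos hm, crossingSign_rotationPath hc hN hS (Ioo_subset_Icc_self hm),
        if_pos]
      rw [Real.cos_eq_one_iff]
      exact ⟨1, by field_simp; norm_num⟩
    · intro t ht
      rw [finsum_eq_if]
      split_ifs with hm
      · rw [crossingSign_rotationPath hc hN hS (Ioo_subset_Icc_self hm), if_neg]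
        intro hcos
        obtain ⟨n, hn⟩ := (Real.cos_eq_one_iff _).mp hcos
        have h3 : (n : ℝ) * S = 2 * t := by
          field_simp at hn
          linarith
        have h4 : 0 < (n : ℝ) := by
          by_contra h
          nlinarith [hm.1]
        have h5 : (n : ℝ) < 2 := by
          by_contra h
          nlinarith [hm.2]
        have h6 : n = 1 := by
          have h7 : 0 < n := by exact_mod_cast h4
          have h8 : n < 2 := by exact_mod_cast h5
          omega
        rw [h6] at h3
        refine ht ?_
        push_cast at h3
        linarith
      · rfl
  rw [regularIndex, h0, h1, h2]
  norm_num

end Index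
end
end Prequantization

namespace Prequantization
open Filter Topology

noncomputable section

/-! ### Contracting the change of frame over the disk -/

section MatrixLoop

/-- The rotation of the plane by the angle `θ`. -/
def rot (θ : ℝ) : Mat2 := !![Real.cos θ, -Real.sin θ; Real.sin θ, Real.cos θ]

theorem continuous_rot : Continuous rot := by
  refine continuous_matrix fun i j => ?_
  fin_cases i <;> fin_cases j <;> simp [rot] <;> fun_prop

theorem det_rot (θ : ℝ) : (rot θ).det = 1 := by
  simp [rot, Matrix.det_fin_two, ← pow_two]

theorem norm_bdry (S t : ℝ) : ‖bdry S t‖ = 1 := Complex.norm_exp_ofReal_mul_I _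

theorem continuous_bdry (S : ℝ) : Continuous (bdry S) := by
  unfold bdry; fun_prop

theorem bdry_zero (S : ℝ) : bdry S 0 = 1 := by simp [bdry]

theorem bdry_self {S : ℝ} (hS : S ≠ 0) : bdry S S = 1 := by
  rw [bdry, mul_div_assoc, div_self hS, mul_one]
  push_cast
  exact Complex.exp_two_pi_mul_I

/-- A path that winds twice in a frame that extends over the disk has Robbin–Salamon index `4`. -/
theorem hasRobbinSalamonIndex_four {G : ℂ → Mat2} {κ S : ℝ} {Ψ : ℝ → Mat2}
    (hG : ContinuousOn G (closedBall 0 1)) (hκ : 0 < κ)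
    (hdet : ∀ z ∈ closedBall (0 : ℂ) 1, κ * (G z).det = 1) (hS : 0 < S)
    (hΨ : ∀ t ∈ Icc 0 S,
      Ψ t = κ • ((G (bdry S t)).adjugate * rot (4 * Real.pi * t / S) * G 1)) :
    HasRobbinSalamonIndex Ψ S 4 := by
  have h1 : (1 : ℂ) ∈ closedBall (0 : ℂ) 1 := by simp
  have hd := hdet 1 h1
  -- The boundary circle is contracted linearly to `1` inside the disk. At `t = 0` and `t = S` the
  -- boundary point is already `1`, so the end points of the path do not move.
  let M : ℝ × ℝ → ℂ := fun q => (1 - q.1) • bdry S q.2 + q.1 • 1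
  have hM : ∀ q ∈ Icc (0 : ℝ) 1 ×ˢ Icc 0 S, M q ∈ closedBall (0 : ℂ) 1 := by
    rintro ⟨s, t⟩ ⟨hs, -⟩
    exact convex_closedBall (0 : ℂ) 1 (by simp [norm_bdry]) h1 (by linarith [hs.2]) hs.1 (by ring)
  have hMc : Continuous M := by
    have := continuous_bdry S
    fun_prop
  let H : ℝ × ℝ → Mat2 := fun q =>
    κ • ((G (M q)).adjugate * rot (4 * Real.pi * q.2 / S) * G 1)
  set p := G 1 0 0 with hp
  set q := G 1 0 1 with hq
  set r := G 1 1 0 with hr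
  set s := G 1 1 1 with hs
  rw [Matrix.det_fin_two, ← hp, ← hq, ← hr, ← hs] at hd
  have hG1 : G 1 = !![p, q; r, s] := Matrix.eta_fin_two _
  set a := -(κ * (s * r + q * p)) with ha
  set b := -(κ * (s ^ 2 + q ^ 2)) with hb
  set c := κ * (r ^ 2 + p ^ 2) with hc
  have hc0 : 0 < c := by
    refine mul_pos hκ ?_
    rcases eq_or_ne r 0 with h | h
    · rcases eq_or_ne p 0 with h' | h'
      · rw [h, h'] at hd
        simp at hd
      · positivity
    · positivity
  have hN : a ^ 2 + b * c = -1 := by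
    linear_combination (-(κ * (p * s - q * r)) - 1) * hd
  refine ⟨rotationPath !![a, b; c, -a] S, isRegularPath_rotationPath hc0 hN hS, ⟨H, ?_, ?_, ?_, ?_⟩,
    regularIndex_rotationPath hc0 hN hS⟩
  · have h2 : ContinuousOn (fun q => (G (M q)).adjugate) (Icc (0 : ℝ) 1 ×ˢ Icc 0 S) :=
      continuous_id.matrix_adjugate.comp_continuousOn (hG.comp hMc.continuousOn hM)
    have h3 : Continuous fun q : ℝ × ℝ => rot (4 * Real.pi * q.2 / S) :=
      continuous_rot.comp (by fun_prop)
    exact ((h2.mul h3.continuousOn).mul continuousOn_const).const_smul κ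
  · intro s hs t ht
    refine isSymplectic_of_det_eq_one ?_
    have h2 := hdet _ (hM (s, t) ⟨hs, ht⟩)
    have h3 := hdet 1 h1
    have h4 : (G (M (s, t))).adjugate.det = (G (M (s, t))).det := by
      rw [Matrix.det_adjugate]; simp
    simp only [H, Matrix.det_smul, Matrix.det_mul, det_rot, h4, Fintype.card_fin]
    linear_combination κ * (G 1).det * h2 + h3
  · intro t ht
    constructor
    · rw [hΨ t ht]
      simp [H, M]
    · have h2 : M (1, t) = 1 := by simp [M]
      simp only [H, h2]
      rw [hG1]
      ext i j
      fin_cases i <;> fin_cases j <;>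
        simp [rotationPath, rot, Matrix.adjugate_fin_two]
      · linear_combination Real.cos (4 * Real.pi * t / S) * hd
      · ring
      · ring
      · linear_combination Real.cos (4 * Real.pi * t / S) * hd
  · intro s hs
    rw [hΨ 0 ⟨le_rfl, hS.le⟩, hΨ S ⟨hS.le, le_rfl⟩, bdry_zero, bdry_self hS.ne']
    have h2 : M (s, 0) = 1 := by simp [M, bdry_zero]
    have h3 : M (s, S) = 1 := by simp [M, bdry_self hS.ne']
    simp only [H, h2, h3, and_self]

end MatrixLoop

/-! ### The tangent frame of `S²` along the Hopf map and its coordinates -/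

section Plucker

/-- With `n` fixed, `det3 n` is an area form on the quotient by the line of `n`; this is the
three-term Plücker relation there. -/
theorem det3_plucker (n a b c d : EuclideanSpace ℝ (Fin 3)) :
    det3 n c d * det3 n a b = det3 n a d * det3 n c b - det3 n b d * det3 n c a := by
  simp only [det3_eq]; ring

/-- A frame of the tangent plane of `S²` at the image of `x` under the Hopf map. -/
def baseFrame (i : Fin 2) (x : C2) : EuclideanSpace ℝ (Fin 3) := hopfPolar x (hopfFrame i x)

theorem det3_baseFrame {x : C2} (hx : nsq x = 1) :
    det3 (hopfQuad x) (baseFrame 0 x) (baseFrame 1 x) = 4 := by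
  rw [baseFrame, baseFrame, det3_hopfPolar, rdot_hopfFrame, rdot_hopfFrame, idot_hopfFrame,
    idot_hopfFrame, idot_hopfFrame_hopfFrame, hx]
  norm_num

/-- Source of the winding number two: `j (z x) = z̄ (j x)`, whereas for unit `z` the Hopf derivative
is unchanged when point and vector are both multiplied by `z`. Hence the frame at `z x` is the image
of `z̄² (j x)` and `i z̄² (j x)` at `x`. -/
theorem baseFrame_smul (z : ℂ) (x : C2) :
    baseFrame 0 (z • x) = (z ^ 2).re • baseFrame 0 x - (z ^ 2).im • baseFrame 1 x ∧
    baseFrame 1 (z • x) = (z ^ 2).im • baseFrame 0 x + (z ^ 2).re • baseFrame 1 x := by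
  constructor <;> ext i <;> fin_cases i <;>
    simp [baseFrame, hopfPolar, hopfFrame, quatJ, pow_two] <;> ring

theorem continuous_baseFrame (i : Fin 2) : Continuous (baseFrame i) := by
  have h0 := (contDiff_coord_re 0).continuous
  have h1 := (contDiff_coord_re 1).continuous
  have h2 := (contDiff_coord_im 0).continuous
  have h3 := (contDiff_coord_im 1).continuous
  refine (PiLp.continuous_toLp 2 _).comp (continuous_pi fun j => ?_)
  fin_cases i <;> fin_cases j <;> simp [hopfFrame, quatJ] <;> fun_prop

theorem continuous_det3 {X : Type*} [TopologicalSpace X] {f g h : X → EuclideanSpace ℝ (Fin 3)}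
    (hf : Continuous f) (hg : Continuous g) (hh : Continuous h) :
    Continuous fun x => det3 (f x) (g x) (h x) := by
  simp only [det3_eq]
  fun_prop

/-- The coordinates of two vectors tangent to `S²` at the image of `x`, in the frame
`baseFrame`. -/
def frameMatrix (x : C2) (a : Fin 2 → EuclideanSpace ℝ (Fin 3)) : Mat2 :=
  (1 / 4 : ℝ) • Matrix.of ![fun j => det3 (hopfQuad x) (a j) (baseFrame 1 x),
    fun j => det3 (hopfQuad x) (baseFrame 0 x) (a j)]

theorem continuousOn_frameMatrix {X : Type*} [TopologicalSpace X] {s : Set X} {x : X → C2}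
    {a : Fin 2 → X → EuclideanSpace ℝ (Fin 3)} (hx : ContinuousOn x s)
    (ha : ∀ i, ContinuousOn (a i) s) :
    ContinuousOn (fun z => frameMatrix (x z) (fun i => a i z)) s := by
  have h : Continuous fun q : C2 × (Fin 2 → EuclideanSpace ℝ (Fin 3)) => frameMatrix q.1 q.2 := by
    have hq : Continuous fun q : C2 × (Fin 2 → EuclideanSpace ℝ (Fin 3)) => hopfQuad q.1 :=
      contDiff_hopfQuad.continuous.comp continuous_fst
    have hf (i : Fin 2) :
        Continuous fun q : C2 × (Fin 2 → EuclideanSpace ℝ (Fin 3)) => baseFrame i q.1 :=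
      (continuous_baseFrame i).comp continuous_fst
    have ha (j : Fin 2) : Continuous fun q : C2 × (Fin 2 → EuclideanSpace ℝ (Fin 3)) => q.2 j := by
      fun_prop
    have h0 (j : Fin 2) := (continuous_det3 hq (ha j) (hf 1)).const_smul (1 / 4 : ℝ)
    have h1 (j : Fin 2) := (continuous_det3 hq (hf 0) (ha j)).const_smul (1 / 4 : ℝ)
    refine continuous_matrix fun i j => ?_
    match i with
    | 0 => exact h0 j
    | 1 => exact h1 j
  exact h.comp_continuousOn (f := fun z => (x z, fun i => a i z))
    (hx.prodMk (continuousOn_pi.mpr ha))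

theorem det_frameMatrix {x : C2} (hx : nsq x = 1) (a : Fin 2 → EuclideanSpace ℝ (Fin 3)) :
    (frameMatrix x a).det = (1 / 4 : ℝ) * det3 (hopfQuad x) (a 0) (a 1) := by
  have h := det3_plucker (hopfQuad x) (a 0) (a 1) (baseFrame 0 x) (baseFrame 1 x)
  rw [det3_baseFrame hx] at h
  simp [frameMatrix, Matrix.det_fin_two]
  linear_combination (-1 / 16 : ℝ) * h

theorem det3_add_smul_left (n a b v : EuclideanSpace ℝ (Fin 3)) (r s : ℝ) :
    det3 n (r • a + s • b) v = r * det3 n a v + s * det3 n b v := by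
  simp [det3_eq]; ring

theorem det3_swap (n a b : EuclideanSpace ℝ (Fin 3)) : det3 n a b = - det3 n b a := by
  simp [det3_eq]; ring

/-- The frame turns by `-2θ`, so coordinates with respect to it turn by `+2θ`. -/
theorem frameMatrix_smul {z : ℂ} {θ : ℝ} (hz : z = Complex.exp (θ * Complex.I)) (x : C2)
    (a : Fin 2 → EuclideanSpace ℝ (Fin 3)) :
    frameMatrix (z • x) a = rot (2 * θ) * frameMatrix x a := by
  have hn : Complex.normSq z = 1 := by
    rw [Complex.normSq_eq_norm_sq, hz, Complex.norm_exp_ofReal_mul_I, one_pow]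
  have hz2 : z ^ 2 = Complex.exp ((2 * θ : ℝ) * Complex.I) := by
    rw [hz, ← Complex.exp_nat_mul]; push_cast; ring_nf
  have hre : (z ^ 2).re = Real.cos (2 * θ) := by rw [hz2, Complex.exp_ofReal_mul_I_re]
  have him : (z ^ 2).im = Real.sin (2 * θ) := by rw [hz2, Complex.exp_ofReal_mul_I_im]
  have hq : hopfQuad (z • x) = hopfQuad x := by rw [hopfQuad_smul, hn, one_smul]
  obtain ⟨h0, h1⟩ := baseFrame_smul z x
  rw [hre, him] at h0 h1
  ext i j
  fin_cases i
  · simp [frameMatrix, rot, Matrix.mul_apply, Fin.sum_univ_two, hq, h1]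
    rw [det3_swap, det3_add_smul_left, det3_swap _ _ (baseFrame 1 x)]
    ring
  · simp [frameMatrix, rot, Matrix.mul_apply, Fin.sum_univ_two, hq, h0]
    rw [sub_eq_add_neg, ← neg_smul, det3_add_smul_left, det3_swap _ _ (baseFrame 1 x)]
    ring

/-- By the Plücker relation the auxiliary `baseFrame` cancels, leaving the determinants that appear
in `linearizedPath`. -/
theorem adjugate_frameMatrix_mul {x : C2} (hx : nsq x = 1)
    (a b : Fin 2 → EuclideanSpace ℝ (Fin 3)) :
    (frameMatrix x a).adjugate * frameMatrix x b = (1 / 4 : ℝ) • Matrix.of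
      ![fun j => det3 (hopfQuad x) (b j) (a 1), fun j => det3 (hopfQuad x) (a 0) (b j)] := by
  ext i j
  fin_cases i
  · have h := det3_plucker (hopfQuad x) (b j) (a 1) (baseFrame 0 x) (baseFrame 1 x)
    rw [det3_baseFrame hx] at h
    simp [frameMatrix, Matrix.adjugate_fin_two, Matrix.mul_apply, Fin.sum_univ_two]
    linear_combination (-1 / 16 : ℝ) * h
  · have h := det3_plucker (hopfQuad x) (a 0) (b j) (baseFrame 0 x) (baseFrame 1 x)
    rw [det3_baseFrame hx] at h
    simp [frameMatrix, Matrix.adjugate_fin_two, Matrix.mul_apply, Fin.sum_univ_two]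
    linear_combination (-1 / 16 : ℝ) * h

end Plucker
end
end Prequantization

namespace Prequantization
open Filter Topology

noncomputable section

/-! ### Extending maps from the disk to the plane -/

section Retraction

/-- The radial retraction of the plane to the closed unit disk. -/
def diskRetract (z : ℂ) : ℂ := (max 1 ‖z‖)⁻¹ • z

theorem continuous_diskRetract : Continuous diskRetract :=
  ((continuous_const.max continuous_norm).inv₀ fun _ =>
    (lt_max_of_lt_left one_pos).ne').smul continuous_id

theorem diskRetract_mem (z : ℂ) : diskRetract z ∈ closedBall (0 : ℂ) 1 := by
  have h : 0 < max 1 ‖z‖ := by positivity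
  rw [mem_closedBall_zero_iff, diskRetract, norm_smul, norm_inv, Real.norm_of_nonneg h.le,
    inv_mul_le_one₀ h]
  exact le_max_right _ _

theorem diskRetract_of_mem {z : ℂ} (hz : z ∈ closedBall (0 : ℂ) 1) : diskRetract z = z := by
  rw [diskRetract, max_eq_left (by simpa using hz), inv_one, one_smul]

end Retraction

/-! ### The linearized Reeb flow in a capping frame -/

section LinearizedFlow

variable {V : Type*} [TopologicalSpace V] [ChartedSpace E3 V]
  [MulAction Circle V] {proj : V → S2} {lam : OneForm V} {k : ℕ} {P : C2 → V}

/-- The projection to `ℝ³ ⊇ T S²` of a tangent vector of `V`. -/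
def baseVec (proj : V → S2) (x : V) (v : TangentSpace (𝓡 3) x) : EuclideanSpace ℝ (Fin 3) :=
  inclS2 (proj x) (mfderiv (𝓡 3) (𝓡 2) proj x v)

omit [MulAction Circle V] in
theorem baseVec_congr {x y : V} (h : x = y) (v : E3) : baseVec proj x v = baseVec proj y v := by
  subst h; rfl

omit [MulAction Circle V] in
theorem continuous_baseVec [IsManifold (𝓡 3) ∞ V] (hp : ContMDiff (𝓡 3) (𝓡 2) ∞ proj) :
    Continuous fun q : TangentBundle (𝓡 3) V => baseVec proj q.1 q.2 := by
  have := IsManifold.of_le (M := V) (I := 𝓡 3) (m := 1) (n := ∞) (by simp)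
  have h1 := hp.continuous_tangentMap (by simp)
  have h2 := contMDiff_coe_S2.continuous_tangentMap (by simp)
  have h3 := (tangentBundleModelSpaceHomeomorph 𝓘(ℝ, EuclideanSpace ℝ (Fin 3))).continuous
  exact continuous_snd.comp (h3.comp (h2.comp h1))

theorem d_eq_det3
    (hV : IsPrequantizationBundle (fun b v w => (k : ℝ) * omega0 b v w) proj lam) (x : V)
    (v w : TangentSpace (𝓡 3) x) : lam.d x v w =
      (k / 2 : ℝ) * det3 (proj x).1 (baseVec proj x v) (baseVec proj x w) := by
  rw [hV.curvature, omega0_eq_det3]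
  change _ = (k / 2 : ℝ) * det3 (proj x).1 (inclS2 (proj x) _) (inclS2 (proj x) _)
  ring

/-- Since `proj` is invariant, the linearized flow becomes the identity after projection to `TS²`.
-/
theorem IsPrincipalBundle.baseVec_mfderiv_smul (hB : IsPrincipalBundle proj) (z : Circle) (x : V)
    (v : TangentSpace (𝓡 3) x) :
    baseVec proj (z • x) (mfderiv (𝓡 3) (𝓡 3) (fun y : V => z • y) x v) = baseVec proj x v := by
  have hp := hB.smooth_proj
  have h1 : MDifferentiableAt (𝓡 3) (𝓡 2) proj (z • x) := hp.mdifferentiableAt (by simp)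
  have h2 : MDifferentiableAt (𝓡 3) (𝓡 3) (fun y : V => z • y) x :=
    (hB.contMDiff_smul_left z).mdifferentiableAt (by simp)
  have h3 : proj ∘ (fun y : V => z • y) = proj := funext fun y => hB.proj_smul z y
  have h4 := mfderiv_comp x h1 h2
  rw [h3] at h4
  have h5 := congrArg (fun L => L v) h4
  have h6 : ∀ b c : S2, b = c → ∀ w : EuclideanSpace ℝ (Fin 2),
      inclS2 b w = inclS2 c w := by
    rintro b _ rfl w; rfl
  refine Eq.trans ?_ (h6 _ _ (hB.proj_smul z x) _)
  exact congrArg (inclS2 (proj (z • x))) h5.symm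

namespace IsHopfLift

variable [NeZero k] (hP : IsHopfLift k proj lam P)
  (hV : IsPrequantizationBundle (fun b v w => (k : ℝ) * omega0 b v w) proj lam)
include hP hV

/-- Precomposed with the radial retraction, the disk becomes a map from the simply connected plane
to the lens space, and lifts through the covering by `S³`. -/
theorem exists_lift_disk {u : ℂ → V} (hu : ContinuousOn u (closedBall 0 1)) :
    ∃ x : C(ℂ, S3), ∀ z ∈ closedBall (0 : ℂ) 1, P (x z).1 = u z := by
  obtain ⟨Φ, -, hΦ⟩ := hP.exists_contactomorphism hV
  let f : C(ℂ, LensSpace k) := ⟨fun z => Φ (u (diskRetract z)), Φ.continuous.comp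
    (hu.comp_continuous continuous_diskRetract diskRetract_mem)⟩
  obtain ⟨y, hy⟩ := lensMk_surjective k (f 0)
  obtain ⟨x, ⟨-, hx⟩, -⟩ := (isCoveringMap_lensMk k).existsUnique_continuousMap_lifts f 0 y hy
  refine ⟨x, fun z hz => Φ.injective ((hΦ (x z)).trans ?_)⟩
  have h := congrFun hx z
  simpa [f, diskRetract_of_mem hz] using h

/-- Both sides, as functions of `θ`, lift the same path in the lens space and agree at `θ = 0`. -/
theorem lift_circle {u : ℂ → V} {x : C(ℂ, S3)}
    (hx : ∀ z ∈ closedBall (0 : ℂ) 1, P (x z).1 = u z)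
    (hu : ∀ θ : ℝ, u (Circle.exp θ) = Circle.exp (k * θ) • u 1) (θ : ℝ) :
    x (Circle.exp θ) = Circle.exp θ • x 1 := by
  have hx1 := hx 1 (by simp)
  have h1 : Continuous fun θ : ℝ => x (Circle.exp θ) :=
    x.continuous.comp (continuous_subtype_val.comp Circle.exp.continuous)
  have h2 : Continuous fun θ : ℝ => Circle.exp θ • x 1 := by
    refine Continuous.subtype_mk ?_ _
    exact (continuous_subtype_val.comp Circle.exp.continuous).smul continuous_const
  have h3 := (isCoveringMap_lensMk k).eq_of_comp_eq h1 h2 ?_ 0 (by simp)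
  · exact congrFun h3 θ
  · funext θ
    refine (hP.eq_iff hV).mp ?_
    rw [hx _ (by simp), hu, ← hx1]
    exact (hP.exp_smul hV (x 1).ne_zero θ).symm

theorem hasRobbinSalamonIndex_linearizedPath [IsManifold (𝓡 3) ∞ V] {p : V} {u : ℂ → V}
    {e : Fin 2 → (z : ℂ) → TangentSpace (𝓡 3) (u z)}
    (h : IsCappingFrame lam (fun t x => Circle.exp t • x) p (k * (2 * Real.pi)) u e) :
    HasRobbinSalamonIndex (linearizedPath lam (fun t x => Circle.exp t • x) p
      (k * (2 * Real.pi)) u e) (k * (2 * Real.pi)) 4 := by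
  have hB := hV.toIsPrincipalBundle
  have hk : 0 < (k : ℝ) := Nat.cast_pos.mpr (NeZero.pos k)
  have hu1 : u 1 = p := by
    have h1 := h.boundary 0
    rw [bdry_zero] at h1
    simpa using h1
  subst hu1
  obtain ⟨x, hx⟩ := hP.exists_lift_disk hV h.continuousOn_disk
  have hxb := hP.lift_circle hV hx (fun θ => by
    have h1 := h.boundary (k * θ)
    rwa [bdry_eq_circleExp, mul_div_cancel_left₀ _ hk.ne'] at h1)
  let a : Fin 2 → ℂ → EuclideanSpace ℝ (Fin 3) := fun i z => baseVec proj (u z) (e i z)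
  have ha (i : Fin 2) : ContinuousOn (a i) (closedBall 0 1) :=
    (continuous_baseVec hB.smooth_proj).comp_continuousOn (h.continuousOn_frame i)
  have hproj : ∀ z ∈ closedBall (0 : ℂ) 1, (proj (u z)).1 = hopfQuad (x z).1 := by
    intro z hz
    rw [← hx z hz, hP.proj_eq (x z).ne_zero, coe_hopf (x z).ne_zero, hopfVec, nsq_S3, inv_one,
      one_smul]
  -- The symplectic condition is `(k / 2) det3 = 1`, while the determinant of `frameMatrix` is `det3
  -- / 4`; hence `κ = 2k`.
  refine hasRobbinSalamonIndex_four (κ := 2 * k)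
    (G := fun z => frameMatrix (x z).1 (fun i => a i z)) ?_ (by positivity) ?_ (by positivity) ?_
  · exact continuousOn_frameMatrix
      (continuous_subtype_val.comp x.continuous).continuousOn ha
  · intro z hz
    have h1 := h.symplectic z hz
    rw [d_eq_det3 hV, hproj z hz] at h1
    rw [det_frameMatrix (nsq_S3 _)]
    linear_combination h1
  · intro t _
    have hbm : bdry (k * (2 * Real.pi)) t ∈ closedBall (0 : ℂ) 1 := by simp [norm_bdry]
    have hb := bdry_eq_circleExp k t
    set b := bdry (k * (2 * Real.pi)) t with hbdef
    have hxt : (x b).1 = b • (x 1).1 := by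
      rw [hb, hxb]
      rfl
    have hub : u b = Circle.exp t • u 1 := h.boundary t
    have hw (j : Fin 2) : baseVec proj (u b)
        (mfderiv (𝓡 3) (𝓡 3) (fun y : V => Circle.exp t • y) (u 1) (e j 1) : E3) = a j 1 :=
      (baseVec_congr hub _).trans (hB.baseVec_mfderiv_smul (Circle.exp t) (u 1) (e j 1))
    have hfm := frameMatrix_smul (θ := t / k) (hb.trans (Circle.coe_exp _)) (x 1).1
      (fun i => a i 1)
    -- At time `t` the lifted boundary point has turned by `t / k`, and the frame coordinates by
    -- twice that.
    have hθ : 4 * Real.pi * t / (k * (2 * Real.pi)) = 2 * (t / k) := by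
      have := Real.pi_ne_zero
      field_simp
      ring
    rw [hθ, Matrix.mul_assoc, ← hfm, ← hxt, adjugate_frameMatrix_mul (nsq_S3 _), smul_smul]
    have hc : 2 * (k : ℝ) * (1 / 4) = k / 2 := by ring
    rw [hc]
    ext i j
    fin_cases i
    · refine (d_eq_det3 hV (u b) _ _).trans ?_
      rw [hw, hproj b hbm]
      rfl
    · refine (d_eq_det3 hV (u b) _ _).trans ?_
      rw [hw, hproj b hbm]
      rfl

end IsHopfLift
end LinearizedFlow
end
end Prequantization

/-! ### The main theorem -/

theorem mainTheorem11 (k : ℕ) [NeZero k]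
    {V : Type*} [TopologicalSpace V] [T2Space V] [SecondCountableTopology V]
    [ChartedSpace E3 V] [IsManifold (𝓡 3) ∞ V] [MulAction Circle V]
    (proj : V → S2) (lam : OneForm V)
    (hV : IsPrequantizationBundle (fun b v w => (k : ℝ) * omega0 b v w) proj lam) :
    (∃ Φ : V ≃ₘ^∞⟮𝓡 3, 𝓡 3⟯ LensSpace k, IsContactomorphism lam (lensForm k) Φ) ∧
    IsReebFlow lam (fun t x => Circle.exp t • x) ∧
    ∀ φ : ℝ → V → V, IsReebFlow lam φ →
      ∀ (p : V) (T : ℝ), IsSimpleClosedOrbit φ p T →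
        (∃ c : C(Circle, V),
          (∀ θ : ℝ, c (Circle.exp θ) = φ (k * T * θ / (2 * Real.pi)) p) ∧ c.Nullhomotopic) ∧
        (∃ (u : ℂ → V) (e : Fin 2 → (z : ℂ) → TangentSpace (𝓡 3) (u z)),
          IsCappingFrame lam φ p (k * T) u e) ∧
        ∀ (u : ℂ → V) (e : Fin 2 → (z : ℂ) → TangentSpace (𝓡 3) (u z)),
          IsCappingFrame lam φ p (k * T) u e →
            HasRobbinSalamonIndex (linearizedPath lam φ p (k * T) u e) (k * T) 4 := by
  obtain ⟨P, hP⟩ := exists_lift_hopf hV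
  replace hP : IsHopfLift k proj lam P := hP
  refine ⟨?_, isReebFlow_exp_smul hV fun p w => ?_, ?_⟩
  · obtain ⟨Φ, hΦ, -⟩ := hP.exists_contactomorphism hV
    exact ⟨Φ, hΦ⟩
  · simp only [omega0_eq_det3, det3_eq, map_zero, PiLp.zero_apply]
    ring
  · intro φ hφ p T hT
    -- An arbitrary Reeb flow and period are replaced by the circle action and `2π`; the orbit then
    -- starts at the image of a point of `S³`.
    obtain rfl := reebFlow_eq hV hφ
    obtain rfl := period_eq_two_pi hV.toIsPrincipalBundle hT
    obtain ⟨y, rfl⟩ := hP.surjective hV p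
    refine ⟨?_, hP.exists_isCappingFrame hV y,
      fun u e h => hP.hasRobbinSalamonIndex_linearizedPath hV h⟩
    obtain ⟨c, hc, hn⟩ := hP.nullhomotopic_circle_smul hV y
    refine ⟨c, fun θ => ?_, hn⟩
    have h1 : k * (2 * Real.pi) * θ / (2 * Real.pi) = k * θ := by
      have := Real.pi_ne_zero
      field_simp
    rw [hc, h1]
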